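/- Let $(\Omega,\mathcal F,\mathbb P)$ be an atomless probability space, $L^2=L^2(\Omega;\mathbb R^d)$, $\mathcal L(X)$ the law of $X$, and $\mathcal P_p(\mathbb R^d)$ ($p=1,2$) the Borel probability measures on $\mathbb R^d$ with finite $p$-th moment, with the Wasserstein distance ${\bf d}_p$. Let $\beta\ge 0$, let $H=H(p,x):\mathbb R^d\times\mathbb R^d\to\mathbb R$ be of class $C^1$, and let $F:\mathbb R^d\times\mathcal P_1(\mathbb R^d)\to\mathbb R$ be continuous and of class $C^1$ in the space variable. The gradient master equation for $W=(W_1,\dots,W_d):\mathbb R^d\times\mathcal P_2(\mathbb R^d)\to\mathbb R^d$ is, for $i=1,\dots,d$, $$ \begin{aligned} & W_i(x,m)-\beta\Delta W_i(x,m)+D_pH(W(x,m),x)\cdot D_xW_i(x,m)+D_{x_i}H(W(x,m),x)\\ &+\int_{\mathbb R^d}D_mW_i(x,m,y)\cdot D_pH(W(y,m),y)\,m(dy)-\beta\Bigl(\int_{\mathbb R^d}\mathrm{Tr}\,D^2_{ym}W_i(x,m,y)\,m(dy)\\ &+2\int_{\mathbb R^d}\mathrm{Tr}\,D^2_{xm}W_i(x,m,y)\,m(dy)+\int_{\mathbb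 R^{2d}}\mathrm{Tr}\,D^2_{mm}W_i(x,m,y,y')\,m(dy)\,m(dy')\Bigr)=F_{x_i}(x,m).\qquad(\mathrm{ME3}) \end{aligned} $$ Here $u:\mathcal P_2(\mathbb R^d)\to\mathbb R$ has the derivative $D_mu(m,\cdot)\in L^2(m)$ at $m$ if $X\mapsto u(\mathcal L(X))$ is Fréchet differentiable in $L^2$ at every $X$ with $\mathcal L(X)=m$, with gradient $D_mu(m,X)$. *Weak solutions.* Let $L^\infty_{ac}$ be the set of $X\in L^2$ whose law has a bounded density $d\mathcal L(X)/d\lambda$ with respect to the Lebesgue measure $\lambda$, and, for $\varepsilon>0$, $$\hat W(X,Y)=\mathbb E\Bigl[\int_0^1W((1-t)X+tY,\mathcal L(X))\cdot(X-Y)\,dt\Bigr],\qquad \hat W^\varepsilon(X,Y)=\hat W(X,Y)+\varepsilon\Bigl\|\frac{d\mathcal L(X)}{d\lambda}\Bigr\|_\infty\quad\text{on } L^\infty_{ac}\times L^2 .$$ For $\varphi$ with domain $S$ in a Hilbert space and $z\in S$, $D^{2,-}\varphi(z)$ is the set of pairs $(\mathcal X,p)$ of a bounded bilinear form and a vector with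 $\liminf_{z'\to z,\,z'\in S}|z'-z|^{-2}\bigl(\varphi(z')-\varphi(z)-(p,z'-z)-\frac12\mathcal X(z'-z,z'-z)\bigr)\ge0$, and $\bar D^{2,-}\varphi(z)$ is the set of limits of $(\mathcal X_n,p_n)\in D^{2,-}\varphi(z_n)$ with $z_n\to z$ and $\varphi(z_n)\to\varphi(z)$. Put $\Lambda(\mathcal X)=\sum_{k=1}^d\mathcal X((e_k,e_k),(e_k,e_k))$, the $e_k$ being the canonical basis of $\mathbb R^d$ viewed as constant random variables. $W$ is a weak solution of (ME3) if (i) $W$ is bounded, $m\mapsto W(\cdot,m)$ is continuous into $L^1_{loc}(\mathbb R^d)$, $W(\cdot,m)$ is irrotational for every $m$, and $(W(x,m)-W(y,m))\cdot(x-y)\le C|x-y|^2$ for some $C$ and all $x,y,m$; (ii) there is $C>0$ such that, for all $(X,Y)\in L^\infty_{ac}\times L^2$, $\varepsilon\in(0,1)$ and $(\mathcal X,(p_X,p_Y))\in\bar D^{2,-}\hat W^\varepsilon(X,Y)$ for which the three expectations below make sense, $$ \begin{aligned} 0\le{}&\hat W(X,Y)-\beta\Lambda(\mathcal X)-\mathbb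 E[F(X,\mathcal L(X))-F(Y,\mathcal L(X))]+\mathbb E[H(W(X,\mathcal L(X)),X)-H(-p_Y,Y)]\\ &-\mathbb E\bigl[(W(X,\mathcal L(X))-p_X)\cdot D_pH(W(X,\mathcal L(X)),X)\bigr]+C\varepsilon\Bigl(1+\Bigl\|\frac{d\mathcal L(X)}{d\lambda}\Bigr\|_\infty\Bigr). \end{aligned} $$ **Proposition.** Let $W$ be a weak solution of (ME3) such that $D_xW$, $D_mW$, $D^2_{ym}W$, $D^2_{xm}W$, $D^2_{mm}W$ exist and, like $W$, are continuous in all their arguments, where $D^2_{ym}W(x,m,y)$, $D^2_{xm}W(x,m,y)$, $D^2_{mm}W(x,m,y,y')$ are bounded uniformly in $y,y'\in\mathbb R^d$ for $(x,m)$ in a neighbourhood of each point. Then $W$ is a classical solution of (ME3): the integrals in (ME3) converge and the equations hold at all $x\in\mathbb R^d$, for every compactly supported $m\in\mathcal P_2(\mathbb R^d)$, and for every $m\in\mathcal P_2(\mathbb R^d)$ if, for each $R$, $|D_pH(p,x)|\le C_R(1+|x|)$ for all $x$ and $|p|\le R$. Here, if $\beta>0$, the distributional Laplacian $\Delta W_i(\cdot,m)$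 is a continuous function; it is the usual Laplacian, and (ME3) holds with the usual Laplacian, whenever $W_i(\cdot,m)$ is of class $C^2$. -/

import Mathlib

open MeasureTheory Filter Topology Set
open scoped ENNReal InnerProductSpace

noncomputable section

namespace MasterEq

/-- Euclidean space `ℝ^d`. -/
abbrev E (d : ℕ) : Type := EuclideanSpace ℝ (Fin d)

/-- The `k`-th vector of the canonical basis of `ℝ^d`. -/
def e {d : ℕ} (k : Fin d) : E d := EuclideanSpace.single k (1 : ℝ)

/-- The trace of a `d × d` matrix, given as a linear map of `ℝ^d`. -/
def tr {d : ℕ} (A : E d →L[ℝ] E d) : ℝ := ∑ k, (A (e k)) k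

/-! ### Probability measures with finite moments and the Wasserstein distance -/

/-- `𝒫_p(ℝ^d)`: Borel probability measures on `ℝ^d` with finite moment of order `p`. -/
def PSpace (d : ℕ) (p : ℝ≥0∞) : Type :=
  {m : ProbabilityMeasure (E d) // MemLp id p (m : Measure (E d))}

/-- The underlying measure. -/
def PSpace.meas {d : ℕ} {p : ℝ≥0∞} (m : PSpace d p) : Measure (E d) := (m.1 : Measure (E d))

/-- The Wasserstein distance `d_p(μ, ν)`: the infimum, over all couplings `π` of `μ` and `ν`, of
`(∫ |x - y| ^ p dπ(x, y)) ^ (1 / p)`. -/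
def wassDist {d : ℕ} (p : ℝ≥0∞) (μ ν : Measure (E d)) : ℝ≥0∞ :=
  ⨅ (π : Measure (E d × E d)) (_ : π.map Prod.fst = μ) (_ : π.map Prod.snd = ν),
    eLpNorm (fun z : E d × E d => z.1 - z.2) p π

/-- The topology of the metric `d_p` on `𝒫_p(ℝ^d)`. -/
instance (d : ℕ) (p : ℝ≥0∞) : TopologicalSpace (PSpace d p) where
  IsOpen s := ∀ m ∈ s, ∃ r : ℝ≥0∞, 0 < r ∧ ∀ m' : PSpace d p, wassDist p m.meas m'.meas < r → m' ∈ s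
  isOpen_univ := fun _ _ => ⟨1, one_pos, fun _ _ => mem_univ _⟩
  isOpen_inter := by
    intro s t hs ht m hm
    obtain ⟨r, hr, h⟩ := hs m hm.1
    obtain ⟨r', hr', h'⟩ := ht m hm.2
    exact ⟨min r r', lt_min hr hr', fun m' hm' =>
      ⟨h m' (hm'.trans_le (min_le_left _ _)), h' m' (hm'.trans_le (min_le_right _ _))⟩⟩
  isOpen_sUnion := by
    intro S hS m hm
    obtain ⟨t, htS, hmt⟩ := hm
    obtain ⟨r, hr, h⟩ := hS t htS m hmt
    exact ⟨r, hr, fun m' hm' => ⟨t, htS, h m' hm'⟩⟩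

/-- `𝒫_2(ℝ^d)` with the topology of `d_2`. -/
abbrev P2 (d : ℕ) : Type := PSpace d 2

/-- `𝒫_1(ℝ^d)` with the topology of `d_1`. -/
abbrev P1 (d : ℕ) : Type := PSpace d 1

/-- The inclusion `𝒫_2(ℝ^d) ⊆ 𝒫_1(ℝ^d)`. -/
def P2.toP1 {d : ℕ} (m : P2 d) : P1 d := ⟨m.1, m.2.mono_exponent (by norm_num)⟩

/-! ### Random variables -/

section Prob

variable {Ω : Type*} [MeasurableSpace Ω]

/-- The measure `P` has no atoms: each event of positive probability contains an event of strictly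
smaller positive probability. -/
def Atomless (P : Measure Ω) : Prop :=
  ∀ A : Set Ω, MeasurableSet A → 0 < P A → ∃ B ⊆ A, MeasurableSet B ∧ 0 < P B ∧ P B < P A

/-- The Hilbert space `L² = L²(Ω; ℝ^d)`. -/
abbrev L2 (d : ℕ) (P : Measure Ω) : Type _ := Lp (E d) 2 P

/-- The Hilbert space `L² × L²` (with the Hilbert product norm). -/
abbrev L2L2 (d : ℕ) (P : Measure Ω) : Type _ := WithLp 2 (L2 d P × L2 d P)

/-- The law of a square integrable random variable, as an element of `𝒫_2(ℝ^d)`. -/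
def law {d : ℕ} {P : Measure Ω} [IsProbabilityMeasure P] (X : L2 d P) : P2 d :=
  ⟨⟨P.map X, Measure.isProbabilityMeasure_map (Lp.aestronglyMeasurable X).aemeasurable⟩,
    (memLp_map_measure_iff aestronglyMeasurable_id
      (Lp.aestronglyMeasurable X).aemeasurable).2 (Lp.memLp X)⟩

/-- `‖dm/dλ‖_∞` as an extended real, for `m` absolutely continuous with respect to the Lebesgue
measure `λ`. -/
def densSup {d : ℕ} (m : P2 d) : ℝ≥0∞ := essSup (m.meas.rnDeriv volume) volume

/-- The set `L^∞_ac` of the `X ∈ L²` whose law has a bounded density. -/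
def Linfac (d : ℕ) (P : Measure Ω) [IsProbabilityMeasure P] : Set (L2 d P) :=
  {X | (law X).meas ≪ volume ∧ densSup (law X) < ⊤}

/-- `u : 𝒫_2(ℝ^d) → ℝ` is differentiable at `m` with derivative `D_m u(m, ·) = g`: the lift
`X ↦ u(ℒ(X))` to `L²` is Fréchet differentiable at the `X` of law `m`, with gradient `g(X)`. -/
def HasLGradAt {d : ℕ} (P : Measure Ω) [IsProbabilityMeasure P] (u : P2 d → ℝ) (m : P2 d)
    (g : E d → E d) : Prop :=
  MemLp g 2 m.meas ∧ ∀ X G : L2 d P, law X = m → G =ᵐ[P] (fun ω => g (X ω)) →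
    HasGradientAt (fun Z : L2 d P => u (law Z)) G X

/-! ### Second-order subdifferentials -/

/-- The second-order subdifferential `D^{2,-} φ(x₀)` of a function `φ` with domain `S` in a Hilbert
space (that is, `φ` is extended by `+∞` outside of `S`), for `x₀ ∈ S`: the pairs `(𝒳, p)` with
`liminf_{x → x₀} |x - x₀|⁻² (φ(x) - φ(x₀) - (p, x - x₀) - ½ 𝒳(x - x₀, x - x₀)) ≥ 0`. -/
def subjet {K : Type*} [NormedAddCommGroup K] [InnerProductSpace ℝ K] (S : Set K) (φ : K → ℝ)
    (x₀ : K) : Set ((K →L[ℝ] K →L[ℝ] ℝ) × K) :=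
  {J | ∀ η : ℝ, 0 < η → ∀ᶠ x in 𝓝[S] x₀,
    -η * ‖x - x₀‖ ^ 2 ≤
      φ x - φ x₀ - ⟪J.2, x - x₀⟫_ℝ - (1 / 2) * J.1 (x - x₀) (x - x₀)}

/-- The closure `D̄^{2,-} φ(x₀)` of the second-order subdifferential. -/
def subjetClosure {K : Type*} [NormedAddCommGroup K] [InnerProductSpace ℝ K] (S : Set K)
    (φ : K → ℝ) (x₀ : K) : Set ((K →L[ℝ] K →L[ℝ] ℝ) × K) :=
  {J | ∃ (Jn : ℕ → (K →L[ℝ] K →L[ℝ] ℝ) × K) (xn : ℕ → K),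
    (∀ n, xn n ∈ S ∧ Jn n ∈ subjet S φ (xn n)) ∧
    Tendsto xn atTop (𝓝 x₀) ∧ Tendsto Jn atTop (𝓝 J) ∧
    Tendsto (fun n => φ (xn n)) atTop (𝓝 (φ x₀))}

/-- `Λ(𝒳) = ∑_k 𝒳((e_k, e_k), (e_k, e_k))`, with `e_k` viewed as a constant random variable. -/
def Lam {d : ℕ} {P : Measure Ω} [IsProbabilityMeasure P]
    (𝒳 : L2L2 d P →L[ℝ] L2L2 d P →L[ℝ] ℝ) : ℝ :=
  ∑ k : Fin d, 𝒳 (WithLp.toLp 2 (Lp.const 2 P (e k), Lp.const 2 P (e k)))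
    (WithLp.toLp 2 (Lp.const 2 P (e k), Lp.const 2 P (e k)))

/-! ### Weak solutions -/

/-- `Ŵ(X, Y) = 𝔼[∫₀¹ W((1 - t) X + t Y, ℒ(X)) ⬝ (X - Y) dt]`. -/
def What {d : ℕ} {P : Measure Ω} [IsProbabilityMeasure P] (W : E d → P2 d → E d)
    (z : L2L2 d P) : ℝ :=
  ∫ ω, (∫ t in (0 : ℝ)..1,
    ⟪W ((1 - t) • z.fst ω + t • z.snd ω) (law z.fst), z.fst ω - z.snd ω⟫_ℝ) ∂P

/-- `Ŵ^ε(X, Y) = Ŵ(X, Y) + ε ‖dℒ(X)/dλ‖_∞`, considered for `X ∈ L^∞_ac`. -/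
def WhatEps {d : ℕ} {P : Measure Ω} [IsProbabilityMeasure P] (W : E d → P2 d → E d) (ε : ℝ)
    (z : L2L2 d P) : ℝ :=
  What W z + ε * (densSup (law z.fst)).toReal

/-- The domain `L^∞_ac × L²` of `Ŵ^ε`. -/
def dom (d : ℕ) (P : Measure Ω) [IsProbabilityMeasure P] : Set (L2L2 d P) :=
  {z | z.fst ∈ Linfac d P}

/-- `D_p H(p, x)`, where `H = H(p, x)`. -/
def DpH {d : ℕ} (H : E d → E d → ℝ) (p x : E d) : E d := gradient (fun q => H q x) p

/-- `D_x H(p, x)`, where `H = H(p, x)`. -/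
def DxH {d : ℕ} (H : E d → E d → ℝ) (p x : E d) : E d := gradient (fun z => H p z) x

/-- A locally integrable vector field is irrotational (in the sense of distributions). -/
def Irrotational {d : ℕ} (w : E d → E d) : Prop :=
  ∀ φ : E d → ℝ, ContDiff ℝ ((⊤ : ℕ∞) : WithTop ℕ∞) φ → HasCompactSupport φ → ∀ i j : Fin d,
    ∫ x, w x i * fderiv ℝ φ x (e j) = ∫ x, w x j * fderiv ℝ φ x (e i)

/-- Weak solutions of the gradient master equation. In the last field, the inequality is required
whenever its three expectations make sense (that is, the random variables are integrable). -/
structure IsWeakSolution {d : ℕ} (P : Measure Ω) [IsProbabilityMeasure P] (β : ℝ)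
    (H : E d → E d → ℝ) (F : E d → P1 d → ℝ) (W : E d → P2 d → E d) : Prop where
  bounded : ∃ C : ℝ, ∀ x m, ‖W x m‖ ≤ C
  measurable : ∀ m, Measurable fun x => W x m
  continuous_L1loc : ∀ (m₀ : P2 d) (K : Set (E d)), IsCompact K →
    Tendsto (fun m => ∫ x in K, ‖W x m - W x m₀‖) (𝓝 m₀) (𝓝 0)
  irrotational : ∀ m, Irrotational fun x => W x m
  oneSided : ∃ C : ℝ, ∀ x y m, ⟪W x m - W y m, x - y⟫_ℝ ≤ C * ‖x - y‖ ^ 2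
  inequality : ∃ C : ℝ, 0 < C ∧ ∀ X ∈ Linfac d P, ∀ Y : L2 d P, ∀ ε ∈ Ioo (0 : ℝ) 1,
    ∀ 𝒳 : L2L2 d P →L[ℝ] L2L2 d P →L[ℝ] ℝ, ∀ pX pY : L2 d P,
    (𝒳, WithLp.toLp 2 (pX, pY)) ∈
      subjetClosure (dom d P) (WhatEps W ε) (WithLp.toLp 2 (X, Y)) →
    Integrable (fun ω => F (X ω) (law X).toP1 - F (Y ω) (law X).toP1) P →
    Integrable (fun ω => H (W (X ω) (law X)) (X ω) - H (-pY ω) (Y ω)) P →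
    Integrable (fun ω => ⟪W (X ω) (law X) - pX ω, DpH H (W (X ω) (law X)) (X ω)⟫_ℝ) P →
    0 ≤ What W (WithLp.toLp 2 (X, Y)) - β * Lam 𝒳
      - ∫ ω, (F (X ω) (law X).toP1 - F (Y ω) (law X).toP1) ∂P
      + ∫ ω, (H (W (X ω) (law X)) (X ω) - H (-pY ω) (Y ω)) ∂P
      - ∫ ω, ⟪W (X ω) (law X) - pX ω, DpH H (W (X ω) (law X)) (X ω)⟫_ℝ ∂P
      + C * ε * (1 + (densSup (law X)).toReal)

/-! ### Smoothness and classical solutions -/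

/-- `W` has the derivatives `D_x W`, `D_m W(x, m, y)`, `D²_{ym} W(x, m, y)`, `D²_{xm} W(x, m, y)`
and `D²_{mm} W(x, m, y, y')`, and these are continuous in all their arguments, the second-order
ones being bounded in `y, y'`, locally uniformly in `(x, m)`. Here `DmW i` is `D_m W_i` and
`DmmW i j x m y` is the derivative in `m` of the `j`-th coordinate of `D_m W_i(x, m, y)`. -/
structure HasContinuousDerivatives {d : ℕ} (P : Measure Ω) [IsProbabilityMeasure P]
    (W : E d → P2 d → E d)
    (DxW : E d → P2 d → E d →L[ℝ] E d)
    (DmW : Fin d → E d → P2 d → E d → E d)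
    (DymW DxmW : Fin d → E d → P2 d → E d → E d →L[ℝ] E d)
    (DmmW : Fin d → Fin d → E d → P2 d → E d → E d → E d) : Prop where
  cont_W : Continuous fun q : E d × P2 d => W q.1 q.2
  deriv_x : ∀ x m, HasFDerivAt (fun z => W z m) (DxW x m) x
  cont_x : Continuous fun q : E d × P2 d => DxW q.1 q.2
  deriv_m : ∀ i x m, HasLGradAt P (fun μ => W x μ i) m (DmW i x m)
  cont_m : ∀ i, Continuous fun q : E d × P2 d × E d => DmW i q.1 q.2.1 q.2.2
  deriv_ym : ∀ i x m y, HasFDerivAt (fun z => DmW i x m z) (DymW i x m y) y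
  cont_ym : ∀ i, Continuous fun q : E d × P2 d × E d => DymW i q.1 q.2.1 q.2.2
  deriv_xm : ∀ i x m y, HasFDerivAt (fun z => DmW i z m y) (DxmW i x m y) x
  cont_xm : ∀ i, Continuous fun q : E d × P2 d × E d => DxmW i q.1 q.2.1 q.2.2
  deriv_mm : ∀ i j x m y, HasLGradAt P (fun μ => DmW i x μ y j) m (DmmW i j x m y)
  cont_mm : ∀ i j, Continuous fun q : E d × P2 d × E d × E d =>
    DmmW i j q.1 q.2.1 q.2.2.1 q.2.2.2
  locally_bounded : ∀ i j x₀ m₀, ∃ C : ℝ, ∀ᶠ q : E d × P2 d in 𝓝 (x₀, m₀), ∀ y y' : E d,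
    ‖DymW i q.1 q.2 y‖ ≤ C ∧ ‖DxmW i q.1 q.2 y‖ ≤ C ∧ ‖DmmW i j q.1 q.2 y y'‖ ≤ C

end Prob

/-- `g` is the Laplacian of `f` in the sense of distributions. -/
def IsWeakLaplacian {d : ℕ} (f g : E d → ℝ) : Prop :=
  ∀ φ : E d → ℝ, ContDiff ℝ ((⊤ : ℕ∞) : WithTop ℕ∞) φ → HasCompactSupport φ →
    ∫ x, f x * Laplacian.laplacian φ x = ∫ x, g x * φ x

/-- The `i`-th equation of the gradient master equation at the point `(x, m)`, with the number `L`
in the place of `Δ W_i(x, m)`: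
`W_i - β L + D_p H(W, x) ⬝ D_x W_i + D_{x_i} H(W, x) + ∫ D_m W_i(x, m, y) ⬝ D_p H(W(y, m), y) m(dy)
- β (∫ Tr D²_{ym} W_i dm + 2 ∫ Tr D²_{xm} W_i dm + ∫∫ Tr D²_{mm} W_i dm dm) = F_{x_i}(x, m)`. -/
def EquationAt {d : ℕ} (β : ℝ) (H : E d → E d → ℝ) (F : E d → P1 d → ℝ) (W : E d → P2 d → E d)
    (DxW : E d → P2 d → E d →L[ℝ] E d)
    (DmW : Fin d → E d → P2 d → E d → E d)
    (DymW DxmW : Fin d → E d → P2 d → E d → E d →L[ℝ] E d)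
    (DmmW : Fin d → Fin d → E d → P2 d → E d → E d → E d)
    (i : Fin d) (x : E d) (m : P2 d) (L : ℝ) : Prop :=
  W x m i - β * L + (DxW x m (DpH H (W x m) x)) i + DxH H (W x m) x i
    + ∫ y, ⟪DmW i x m y, DpH H (W y m) y⟫_ℝ ∂m.meas
    - β * (∫ y, tr (DymW i x m y) ∂m.meas + 2 * ∫ y, tr (DxmW i x m y) ∂m.meas
      + ∫ q, (∑ j, DmmW i j x m q.1 q.2 j) ∂(m.meas.prod m.meas))
  = gradient (fun z => F z m.toP1) x i

/-- The gradient master equation holds in the classical sense on `ℝ^d × {m}`: all the integrals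
converge and the equations hold at every point `x`. The term `Δ W_i`, which only matters if
`β ≠ 0`, is a continuous function of `x`, namely the Laplacian of `W_i(·, m)` in the sense of
distributions, and it is the usual Laplacian if `W_i(·, m)` is of class `C²`. -/
def SolvesAt {d : ℕ} (β : ℝ) (H : E d → E d → ℝ) (F : E d → P1 d → ℝ) (W : E d → P2 d → E d)
    (DxW : E d → P2 d → E d →L[ℝ] E d)
    (DmW : Fin d → E d → P2 d → E d → E d)
    (DymW DxmW : Fin d → E d → P2 d → E d → E d →L[ℝ] E d)
    (DmmW : Fin d → Fin d → E d → P2 d → E d → E d → E d) (m : P2 d) : Prop :=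
  ∀ i : Fin d,
    (∀ x, Integrable (fun y => ⟪DmW i x m y, DpH H (W y m) y⟫_ℝ) m.meas ∧
      Integrable (fun y => tr (DymW i x m y)) m.meas ∧
      Integrable (fun y => tr (DxmW i x m y)) m.meas ∧
      Integrable (fun q : E d × E d => ∑ j, DmmW i j x m q.1 q.2 j) (m.meas.prod m.meas)) ∧
    (∃ L : E d → ℝ, Continuous L ∧ (β ≠ 0 → IsWeakLaplacian (fun x => W x m i) L) ∧
      ∀ x, EquationAt β H F W DxW DmW DymW DxmW DmmW i x m (L x)) ∧
    (ContDiff ℝ 2 (fun x => W x m i) → ∀ x,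
      EquationAt β H F W DxW DmW DymW DxmW DmmW i x m
        (Laplacian.laplacian (fun z => W z m i) x))

/-- `m` is carried by a bounded set. -/
def BoundedSupport {d : ℕ} (m : P2 d) : Prop := ∃ R : ℝ, m.meas (Metric.closedBall 0 R)ᶜ = 0

/-- `D_p H(p, x)` has at most linear growth in `x`, locally uniformly in `p`. -/
def LinearGrowth {d : ℕ} (H : E d → E d → ℝ) : Prop :=
  ∀ R : ℝ, ∃ C : ℝ, ∀ p x : E d, ‖p‖ ≤ R → ‖DpH H p x‖ ≤ C * (1 + ‖x‖)

end MasterEq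

end

open MasterEq

/-!
# Smooth weak solutions of the gradient master equation are classical

Since `W(·, m)` is irrotational it has a potential `U(·, m)`, and
`Ŵ(X, Y) = E[U(X, law X) - U(Y, law X)]`. If `W` has the stated derivatives, `Ŵ` can be
expanded to second order from below at bounded pairs `(X, Y)`
(`HasContinuousDerivatives.What_expansion`). The expansion is sharp in the
mean `a` of the increment of `X`, and the deviations of the increments of `X` and `Y` from `a`
cost a multiple, possibly large, of their squared norms. Since `Λ` sees only the common constant
increments `(e_k, e_k)`, this cost does not enter the weak inequality.

The term `ε ‖d law(X)/dλ‖_∞` has a subgradient at `X` up to a quadratic error if the density of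
`law X` is at most `M`, with equality on a ball: testing densities against a bump supported in
that ball gives it (`exists_densSup_lower_bound`). Hence there is an explicit element of the
second-order subjet of `Ŵ^ε` at `(X, Y)`. Letting `ε → 0` in the weak inequality gives
`E[defect(X, Y, law X)] ≥ 0` (`IsWeakSolution.integral_defect_nonneg`), where `defect(x, y, m)` is
the integral along the segment from `y` to `x` of the difference of the two sides of the master
equation, the Laplacian being integrated as the increment of the divergence.

The inequality in expectation becomes pointwise by localization. Let `X` be a simple random
variable whose values are blurred uniformly over small balls, and let `Y = y` where `X` is near
one of its values `x` and `Y = X` elsewhere, where the defect vanishes. This gives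
`defect(x, y, m) ≥ 0` if `m` is the law of a simple random variable with value `x`
(`IsWeakSolution.defect_nonneg_of_simple`), and then by approximation for all the measures in
question. The defect is antisymmetric in `(x, y)`, so it vanishes. Its derivative in `x` along
`e_i` is the `i`-th equation, in which `β ∂_i (div W)`, now known to be a continuous function, is
`β` times the distributional Laplacian of `W_i` because `W` is irrotational.
-/

set_option linter.unusedSectionVars false

namespace MasterEq

/-! ### Random variables on atomless spaces -/

section Atomless

variable {Ω : Type*} [MeasurableSpace Ω] {P : Measure Ω}

/-- Events of positive probability contain events of arbitrarily small positive probability: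
one of the two halves of a splitting has at most half of the mass. -/
lemma Atomless.exists_small [IsFiniteMeasure P] (hP : Atomless P) {A : Set Ω}
    (hA : MeasurableSet A) (hA0 : 0 < P A) {c : ℝ} (hc : 0 < c) :
    ∃ B ⊆ A, MeasurableSet B ∧ 0 < P B ∧ P.real B ≤ c := by
  have key : ∀ n : ℕ, ∃ B ⊆ A, MeasurableSet B ∧ 0 < P B ∧ P.real B * 2 ^ n ≤ P.real A := by
    intro n
    induction n with
    | zero => exact ⟨A, Subset.rfl, hA, hA0, by simp⟩
    | succ n ih =>
      obtain ⟨B, hBA, hB, hB0, hBn⟩ := ih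
      obtain ⟨D, hDB, hD, hD0, hDlt⟩ := hP B hB hB0
      have hsum : P.real (B \ D) = P.real B - P.real D := measureReal_sdiff hDB hD
      have hpos : 0 < P (B \ D) := by
        rw [measure_sdiff hDB hD.nullMeasurableSet (measure_ne_top _ _)]
        exact tsub_pos_of_lt hDlt
      have h2 : (0 : ℝ) < 2 ^ n := by positivity
      rcases le_total (P.real D) (P.real B / 2) with h | h
      · refine ⟨D, hDB.trans hBA, hD, hD0, ?_⟩
        rw [pow_succ]; nlinarith
      · refine ⟨B \ D, sdiff_subset.trans hBA, hB.diff hD, hpos, ?_⟩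
        rw [pow_succ, hsum]; nlinarith
  obtain ⟨n, hn⟩ := pow_unbounded_of_one_lt (P.real A / c) (one_lt_two)
  obtain ⟨B, hBA, hB, hB0, hBn⟩ := key n
  refine ⟨B, hBA, hB, hB0, ?_⟩
  have h2 : (0 : ℝ) < 2 ^ n := by positivity
  rw [div_lt_iff₀ hc] at hn
  nlinarith

/-- Sierpiński's theorem: an atomless finite measure takes all intermediate values. -/
lemma Atomless.exists_measureReal_eq [IsFiniteMeasure P] (hP : Atomless P) {A A' : Set Ω}
    (hA : MeasurableSet A) (hA' : MeasurableSet A') (hAA' : A ⊆ A') {c : ℝ}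
    (h1 : P.real A ≤ c) (h2 : c ≤ P.real A') :
    ∃ B, A ⊆ B ∧ B ⊆ A' ∧ MeasurableSet B ∧ P.real B = c := by
  let S := {B : Set Ω // MeasurableSet B ∧ A ⊆ B ∧ B ⊆ A' ∧ P.real B ≤ c}
  -- each set has an extension that realizes at least half of the largest possible increase
  have step : ∀ B : S, ∃ B' : S, B.1 ⊆ B'.1 ∧
      ∀ D : S, B.1 ⊆ D.1 → P.real D.1 + P.real B.1 ≤ 2 * P.real B'.1 := by
    intro B
    by_contra! hcon
    have hb : BddAbove (range fun D : {D : S // B.1 ⊆ D.1} => P.real D.1.1) :=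
      ⟨c, by rintro _ ⟨D, rfl⟩; exact D.1.2.2.2.2⟩
    have : Nonempty {D : S // B.1 ⊆ D.1} := ⟨⟨B, Subset.rfl⟩⟩
    set s := ⨆ D : {D : S // B.1 ⊆ D.1}, P.real D.1.1 with hs
    have hBs : P.real B.1 ≤ s := le_ciSup hb ⟨B, Subset.rfl⟩
    obtain ⟨D₀, hD₀, hlt⟩ := hcon B Subset.rfl
    have hD₀s : P.real D₀.1 ≤ s := le_ciSup hb ⟨D₀, hD₀⟩
    obtain ⟨D, hD⟩ := exists_lt_of_lt_ciSup (show (s + P.real B.1) / 2 < s by linarith)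
    obtain ⟨D', hD', hlt'⟩ := hcon D.1 D.2
    have : P.real D'.1 ≤ s := le_ciSup hb ⟨D', hD'⟩
    linarith
  choose next hsub hnext using step
  let E : ℕ → S := fun n => n.rec ⟨A, hA, Subset.rfl, hAA', h1⟩ (fun _ B => next B)
  have hE : Monotone fun n => (E n).1 := monotone_nat_of_le_succ fun n => hsub (E n)
  have hlim : Tendsto (fun n => P.real (E n).1) atTop (𝓝 (P.real (⋃ n, (E n).1))) :=
    (ENNReal.tendsto_toReal (measure_ne_top _ _)).comp (tendsto_measure_iUnion_atTop hE)
  have hUc : P.real (⋃ n, (E n).1) ≤ c := le_of_tendsto' hlim fun n => (E n).2.2.2.2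
  have hUA : A ⊆ ⋃ n, (E n).1 := subset_iUnion_of_subset 0 Subset.rfl
  have hUA' : (⋃ n, (E n).1) ⊆ A' := iUnion_subset fun n => (E n).2.2.2.1
  have hUm : MeasurableSet (⋃ n, (E n).1) := .iUnion fun n => (E n).2.1
  refine ⟨⋃ n, (E n).1, hUA, hUA', hUm, hUc.antisymm ?_⟩
  by_contra! hlt
  have hpos : 0 < P (A' \ ⋃ n, (E n).1) := by
    have := measureReal_sdiff (μ := P) hUA' hUm
    have h3 : 0 < P.real (A' \ ⋃ n, (E n).1) := by linarith
    exact (ENNReal.toReal_pos_iff.1 h3).1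
  obtain ⟨B, hB, hBm, hB0, hBc⟩ := hP.exists_small (hA'.diff hUm) hpos (sub_pos.2 hlt)
  have hdisj : Disjoint (⋃ n, (E n).1) B := disjoint_of_subset_right hB disjoint_sdiff_right
  have hsum : P.real ((⋃ n, (E n).1) ∪ B) = P.real (⋃ n, (E n).1) + P.real B :=
    measureReal_union hdisj hBm
  have hB0' : 0 < P.real B := ENNReal.toReal_pos hB0.ne' (measure_ne_top _ _)
  let D : S := ⟨(⋃ n, (E n).1) ∪ B, hUm.union hBm, hUA.trans subset_union_left,
    union_subset hUA' (hB.trans sdiff_subset), by rw [hsum]; linarith⟩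
  have hD : ∀ n, P.real D.1 + P.real (E n).1 ≤ 2 * P.real (E (n + 1)).1 := fun n =>
    hnext (E n) D ((subset_iUnion (fun n => (E n).1) n).trans subset_union_left)
  have := le_of_tendsto_of_tendsto' (hlim.const_add (P.real D.1))
    ((hlim.comp (tendsto_add_atTop_nat 1)).const_mul 2) hD
  have hD' : P.real D.1 = _ := hsum
  linarith

/-- An increasing family of events, indexed by the dyadic numbers `q` of `[0, 1]`, in which the
event of index `q` has probability `q`. -/
lemma Atomless.exists_dyadic_chain [IsProbabilityMeasure P] (hP : Atomless P) :
    ∃ B : ℕ → ℕ → Set Ω, (∀ n k, MeasurableSet (B n k)) ∧ (∀ n, Monotone (B n)) ∧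
      (∀ n k, k ≤ 2 ^ n → P.real (B n k) = k / 2 ^ n) ∧ ∀ n k, B (n + 1) (2 * k) = B n k := by
  let S := fun n : ℕ => {b : ℕ → Set Ω // (∀ k, MeasurableSet (b k)) ∧ Monotone b ∧
    ∀ k ≤ 2 ^ n, P.real (b k) = k / 2 ^ n}
  have step : ∀ n (b : S n), ∃ b' : S (n + 1), ∀ k, b'.1 (2 * k) = b.1 k := by
    rintro n ⟨b, hbm, hb, hbk⟩
    have h2 : (0 : ℝ) < 2 ^ n := by positivity
    have hmid : ∀ k, ∃ D, b k ⊆ D ∧ D ⊆ b (k + 1) ∧ MeasurableSet D ∧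
        (k < 2 ^ n → P.real D = (2 * k + 1 : ℝ) / 2 ^ (n + 1)) := by
      intro k
      by_cases hk : k < 2 ^ n
      · obtain ⟨D, h1, h2, h3, h4⟩ := hP.exists_measureReal_eq (hbm k) (hbm (k + 1))
          (hb k.le_succ) (c := (2 * k + 1 : ℝ) / 2 ^ (n + 1))
          (by rw [hbk k hk.le, pow_succ, div_le_div_iff₀ h2 (by positivity)]; nlinarith)
          (by rw [hbk (k + 1) hk, pow_succ, div_le_div_iff₀ (by positivity) h2]
              push_cast; nlinarith)
        exact ⟨D, h1, h2, h3, fun _ => h4⟩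
      · exact ⟨b k, Subset.rfl, hb k.le_succ, hbm k, fun h => absurd h hk⟩
    choose D hD1 hD2 hD3 hD4 using hmid
    refine ⟨⟨fun j => if j % 2 = 0 then b (j / 2) else D (j / 2), ?_, ?_, ?_⟩, ?_⟩
    · intro j; dsimp only; split_ifs
      exacts [hbm _, hD3 _]
    · refine monotone_nat_of_le_succ fun j => ?_
      rcases Nat.mod_two_eq_zero_or_one j with h | h
      · rw [if_pos h, if_neg (by omega), show (j + 1) / 2 = j / 2 by omega]
        exact hD1 _
      · rw [if_neg (by omega), if_pos (by omega), show (j + 1) / 2 = j / 2 + 1 by omega]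
        exact hD2 _
    · intro j hj
      dsimp only
      rw [pow_succ] at hj
      rcases Nat.mod_two_eq_zero_or_one j with h | h
      · rw [if_pos h, hbk _ (by omega)]
        have : (j : ℝ) = 2 * (j / 2 : ℕ) := by
          exact_mod_cast (show j = 2 * (j / 2) by omega)
        rw [this, pow_succ]; field_simp
      · rw [if_neg (by omega), hD4 _ (by omega)]
        have : (j : ℝ) = 2 * (j / 2 : ℕ) + 1 := by
          exact_mod_cast (show j = 2 * (j / 2) + 1 by omega)
        rw [this]
    · intro k
      simp
  choose next hnext using step
  let b0 : S 0 := ⟨fun k => if k = 0 then ∅ else univ, fun k => by dsimp only; split_ifs <;> simp,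
    monotone_nat_of_le_succ fun k => by simp, by
      intro k hk
      rcases Nat.le_one_iff_eq_zero_or_eq_one.1 (by simpa using hk) with rfl | rfl <;> simp⟩
  let B : ∀ n, S n := fun n => n.rec b0 next
  exact ⟨fun n => (B n).1, fun n => (B n).2.1, fun n => (B n).2.2.1, fun n => (B n).2.2.2,
    fun n k => hnext n (B n) k⟩

/-- On an atomless probability space there is a random variable with uniform law on `[0, 1]`. -/
lemma Atomless.exists_uniform [IsProbabilityMeasure P] (hP : Atomless P) :
    ∃ U : Ω → ℝ, Measurable U ∧ P.map U = volume.restrict (Icc 0 1) := by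
  obtain ⟨B, hBm, hBmono, hBP, hB⟩ := hP.exists_dyadic_chain
  have hlift : ∀ m n k, B (n + m) (2 ^ m * k) = B n k := by
    intro m
    induction m with
    | zero => simp
    | succ m ih => intro n k; rw [← add_assoc, pow_succ', mul_assoc, hB, ih]
  have hsub : ∀ n (k : ℕ) n' (k' : ℕ), (k : ℝ) / 2 ^ n ≤ k' / 2 ^ n' → B n k ⊆ B n' k' := by
    intro n k n' k' h
    rw [← hlift n' n k, ← hlift n n' k', add_comm n n']
    apply hBmono
    rw [div_le_div_iff₀ (by positivity) (by positivity)] at h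
    have : k * 2 ^ n' ≤ k' * 2 ^ n := by exact_mod_cast h
    linarith
  let S : Ω → Set ℝ := fun ω => {q | ∃ n k, k ≤ 2 ^ n ∧ (ω ∈ B n k ∨ k = 2 ^ n) ∧
    q = (k : ℝ) / 2 ^ n}
  have hS1 : ∀ ω, (1 : ℝ) ∈ S ω := fun ω => ⟨0, 1, by simp, by simp, by simp⟩
  have hS0 : ∀ ω, ∀ q ∈ S ω, 0 ≤ q := by rintro ω q ⟨n, k, -, -, rfl⟩; positivity
  have hbdd : ∀ ω, BddBelow (S ω) := fun ω => ⟨0, hS0 ω⟩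
  let U : Ω → ℝ := fun ω => sInf (S ω)
  have hU : ∀ ω t, U ω < t ↔ ∃ q ∈ S ω, q < t := fun ω t =>
    csInf_lt_iff (hbdd ω) ⟨1, hS1 ω⟩
  have hset : ∀ t ≤ 1, {ω | U ω < t} =
      ⋃ p : {p : ℕ × ℕ // p.2 ≤ 2 ^ p.1 ∧ (p.2 : ℝ) / 2 ^ p.1 < t}, B p.1.1 p.1.2 := by
    intro t ht
    ext ω
    simp only [mem_ofPred_eq, hU, mem_iUnion]
    constructor
    · rintro ⟨q, ⟨n, k, hk, hω, rfl⟩, hq⟩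
      refine ⟨⟨(n, k), hk, hq⟩, hω.resolve_right ?_⟩
      rintro rfl
      simp at hq
      linarith
    · rintro ⟨⟨⟨n, k⟩, hk, hq⟩, hω⟩
      exact ⟨_, ⟨n, k, hk, Or.inl hω, rfl⟩, hq⟩
  have huniv : ∀ t, 1 < t → {ω | U ω < t} = univ := fun t ht =>
    eq_univ_of_forall fun ω => (hU ω t).2 ⟨1, hS1 ω, ht⟩
  have hempty : ∀ t ≤ 0, {ω | U ω < t} = ∅ := fun t ht =>
    eq_empty_of_forall_notMem fun ω hω => by
      obtain ⟨q, hq, hqt⟩ := (hU ω t).1 hω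
      linarith [hS0 ω q hq]
  have hUm : Measurable U := by
    refine measurable_of_Iio fun t => ?_
    change MeasurableSet {ω | U ω < t}
    rcases le_or_gt t 1 with ht | ht
    · rw [hset t ht]; exact .iUnion fun _ => hBm _ _
    · rw [huniv t ht]; exact .univ
  have hprob : ∀ t, 0 < t → t ≤ 1 → P.real {ω | U ω < t} = t := by
    intro t ht0 ht
    rw [hset t ht]
    have hdir : Directed (· ⊆ ·)
        fun p : {p : ℕ × ℕ // p.2 ≤ 2 ^ p.1 ∧ (p.2 : ℝ) / 2 ^ p.1 < t} => B p.1.1 p.1.2 := by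
      intro p q
      rcases le_total ((p.1.2 : ℝ) / 2 ^ p.1.1) (q.1.2 / 2 ^ q.1.1) with h | h
      · exact ⟨q, hsub _ _ _ _ h, Subset.rfl⟩
      · exact ⟨p, Subset.rfl, hsub _ _ _ _ h⟩
    have hval : ∀ p : {p : ℕ × ℕ // p.2 ≤ 2 ^ p.1 ∧ (p.2 : ℝ) / 2 ^ p.1 < t},
        P (B p.1.1 p.1.2) = ENNReal.ofReal (p.1.2 / 2 ^ p.1.1) := fun p => by
      rw [← hBP _ _ p.2.1, ofReal_measureReal]
    rw [measureReal_def, hdir.measure_iUnion]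
    simp only [hval]
    have : (⨆ p : {p : ℕ × ℕ // p.2 ≤ 2 ^ p.1 ∧ (p.2 : ℝ) / 2 ^ p.1 < t},
        ENNReal.ofReal (p.1.2 / 2 ^ p.1.1)) = ENNReal.ofReal t := by
      apply le_antisymm
      · exact iSup_le fun p => ENNReal.ofReal_le_ofReal p.2.2.le
      · refine le_of_forall_lt fun c hc => ?_
        obtain ⟨s, hs, rfl⟩ : ∃ s : ℝ, 0 ≤ s ∧ c = ENNReal.ofReal s :=
          ⟨c.toReal, ENNReal.toReal_nonneg, (ENNReal.ofReal_toReal hc.ne_top).symm⟩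
        have hst : s < t := (ENNReal.ofReal_lt_ofReal_iff ht0).1 hc
        obtain ⟨n, hn⟩ := pow_unbounded_of_one_lt (1 / (t - s)) (one_lt_two)
        have h2 : (0 : ℝ) < 2 ^ n := by positivity
        rw [div_lt_iff₀ (sub_pos.2 hst)] at hn
        have hk1 := Nat.floor_le (mul_nonneg hs h2.le)
        have hk2 := Nat.lt_floor_add_one (s * 2 ^ n)
        set k := ⌊s * 2 ^ n⌋₊
        have hlt : ((k + 1 : ℕ) : ℝ) / 2 ^ n < t := by
          rw [div_lt_iff₀ h2]; push_cast; nlinarith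
        have hle : k + 1 ≤ 2 ^ n := by
          have : ((k + 1 : ℕ) : ℝ) < 2 ^ n := by
            rw [div_lt_iff₀ h2] at hlt; nlinarith
          exact_mod_cast this.le
        refine lt_of_lt_of_le ?_ (le_iSup _ ⟨(n, k + 1), hle, hlt⟩)
        have hs' : s < ((k + 1 : ℕ) : ℝ) / 2 ^ n := by
          rw [lt_div_iff₀ h2]; push_cast; exact hk2
        exact (ENNReal.ofReal_lt_ofReal_iff (hs.trans_lt hs')).2 hs'
    rw [this, ENNReal.toReal_ofReal ht0.le]
  refine ⟨U, hUm, ?_⟩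
  have : IsProbabilityMeasure (P.map U) := Measure.isProbabilityMeasure_map hUm.aemeasurable
  refine Measure.ext_of_Ici _ _ fun t => ?_
  rw [Measure.map_apply hUm measurableSet_Ici, Measure.restrict_apply measurableSet_Ici]
  have hcompl : U ⁻¹' Ici t = {ω | U ω < t}ᶜ := by ext; simp
  have hmeas : MeasurableSet {ω | U ω < t} := hUm measurableSet_Iio
  rw [hcompl, prob_compl_eq_one_sub hmeas]
  rcases le_or_gt t 0 with ht | ht
  · rw [hempty t ht, show Ici t ∩ Icc 0 1 = Icc 0 1 from
      inter_eq_right.2 (Icc_subset_Ici_self.trans (Ici_subset_Ici.2 ht))]; simp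
  rcases le_or_gt t 1 with ht1 | ht1
  · rw [← ofReal_measureReal, hprob t ht ht1,
      show Ici t ∩ Icc 0 1 = Icc t 1 by ext x; simp; intro h _; linarith,
      Real.volume_Icc, ENNReal.ofReal_sub _ ht.le, ENNReal.ofReal_one]
  · rw [huniv t ht1, show Ici t ∩ Icc 0 1 = ∅ by
      ext x; simp only [mem_inter_iff, mem_Ici, mem_Icc, mem_empty_iff_false, iff_false]
      rintro ⟨h, -, h'⟩; linarith]
    simp

/-- On an atomless probability space, every law on a standard Borel space is realized. -/
lemma Atomless.exists_map_eq [IsProbabilityMeasure P] (hP : Atomless P) {α : Type*}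
    [MeasurableSpace α] [StandardBorelSpace α] (μ : Measure α) [IsProbabilityMeasure μ] :
    ∃ Z : Ω → α, Measurable Z ∧ P.map Z = μ := by
  have : Nonempty α := μ.nonempty_of_neZero
  obtain ⟨U, hU, hmap⟩ := hP.exists_uniform
  obtain ⟨f, hf, hfμ⟩ := μ.exists_measurable_map_eq
  refine ⟨fun ω => f (projIcc 0 1 zero_le_one (U ω)),
    hf.comp (continuous_projIcc.measurable.comp hU), ?_⟩
  have hp : Measurable (projIcc (0 : ℝ) 1 zero_le_one) := continuous_projIcc.measurable
  have h1 : P.map (fun ω => f (projIcc 0 1 zero_le_one (U ω)))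
      = ((P.map U).map (projIcc 0 1 zero_le_one)).map f := by
    rw [Measure.map_map hp hU, Measure.map_map hf (hp.comp hU)]; rfl
  have h2 : (volume.restrict (Icc (0 : ℝ) 1)).map (projIcc 0 1 zero_le_one)
      = (volume : Measure unitInterval) := by
    have := (measurePreserving_subtype_coe (μa := (volume : Measure ℝ))
      (measurableSet_Icc (a := (0 : ℝ)) (b := 1)))
    rw [← this.map_eq, Measure.map_map hp measurable_subtype_coe]
    convert! Measure.map_id
    ext x
    simp
  rw [h1, hmap, h2, hfμ]

/-- Every law on a standard Borel space is realized on each event, conditionally on it. -/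
lemma Atomless.exists_map_restrict_eq [IsProbabilityMeasure P] (hP : Atomless P) {α : Type*}
    [MeasurableSpace α] [StandardBorelSpace α] (μ : Measure α) [IsProbabilityMeasure μ]
    {A : Set Ω} (hA : MeasurableSet A) :
    ∃ Z : Ω → α, Measurable Z ∧ (P.restrict A).map Z = P A • μ := by
  have : Nonempty α := μ.nonempty_of_neZero
  rcases eq_or_ne (P A) 0 with h0 | h0
  · refine ⟨fun _ => Classical.arbitrary α, measurable_const, ?_⟩
    rw [Measure.restrict_eq_zero.2 h0, h0]; simp
  have : IsProbabilityMeasure (ProbabilityTheory.cond P A) :=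
    ProbabilityTheory.cond_isProbabilityMeasure h0
  have hatom : Atomless (ProbabilityTheory.cond P A) := by
    intro B hB hB0
    rw [ProbabilityTheory.cond_apply hA] at hB0
    obtain ⟨D, hDB, hD, hD0, hDlt⟩ := hP (A ∩ B) (hA.inter hB) (pos_of_mul_pos_right hB0 (by simp))
    refine ⟨D, hDB.trans inter_subset_right, hD, ?_⟩
    rw [ProbabilityTheory.cond_apply hA, ProbabilityTheory.cond_apply hA,
      inter_eq_right.2 (hDB.trans inter_subset_left)]
    have hi : (P A)⁻¹ ≠ 0 := by simp
    have hi' : (P A)⁻¹ ≠ ⊤ := by simp [h0]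
    exact ⟨ENNReal.mul_pos hi hD0.ne', (ENNReal.mul_lt_mul_iff_right hi hi').2 hDlt⟩
  obtain ⟨Z, hZ, hmap⟩ := hatom.exists_map_eq μ
  refine ⟨Z, hZ, ?_⟩
  rw [← hmap, ProbabilityTheory.cond, Measure.map_smul, smul_smul,
    ENNReal.mul_inv_cancel h0 (measure_ne_top _ _), one_smul]

end Atomless

/-! ### Laws of square-integrable random variables -/

section Law

variable {Ω : Type*} [MeasurableSpace Ω] {P : Measure Ω} [IsProbabilityMeasure P] {d : ℕ}

lemma law_meas (X : L2 d P) : (law X).meas = P.map X := rfl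

lemma aemeasurable_coe (X : L2 d P) : AEMeasurable X P := (Lp.aestronglyMeasurable X).aemeasurable

instance PSpace.isProbabilityMeasure_meas {p : ℝ≥0∞} (m : PSpace d p) :
    IsProbabilityMeasure m.meas := by
  unfold PSpace.meas; infer_instance

lemma PSpace.ext_meas {p : ℝ≥0∞} {m m' : PSpace d p} (h : m.meas = m'.meas) : m = m' :=
  Subtype.ext (Subtype.ext h)

/-- The joint law of `(X, Y)` is a coupling of the laws of `X` and `Y`. -/
lemma wassDist_law_le (X Y : L2 d P) :
    wassDist 2 (law X).meas (law Y).meas ≤ ENNReal.ofReal ‖X - Y‖ := by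
  have hXY : AEMeasurable (fun ω => (X ω, Y ω)) P := (aemeasurable_coe X).prodMk (aemeasurable_coe Y)
  refine iInf_le_of_le (P.map fun ω => (X ω, Y ω)) (iInf_le_of_le ?_ (iInf_le_of_le ?_ ?_))
  · rw [AEMeasurable.map_map_of_aemeasurable measurable_fst.aemeasurable hXY]; rfl
  · rw [AEMeasurable.map_map_of_aemeasurable measurable_snd.aemeasurable hXY]; rfl
  · rw [eLpNorm_map_measure (by fun_prop) hXY, Lp.norm_def, ENNReal.ofReal_toReal (Lp.eLpNorm_ne_top _)]
    refine le_of_eq (eLpNorm_congr_ae ?_)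
    filter_upwards [Lp.coeFn_sub X Y] with ω hω using hω.symm

lemma continuous_law : Continuous (law : L2 d P → P2 d) := by
  refine continuous_def.2 fun s hs => Metric.isOpen_iff.2 fun X hX => ?_
  obtain ⟨r, hr, h⟩ := hs (law X) hX
  obtain ⟨ε, hε, hεr⟩ : ∃ ε : ℝ, 0 < ε ∧ ENNReal.ofReal ε ≤ r := by
    rcases eq_or_ne r ⊤ with rfl | hr'
    · exact ⟨1, one_pos, le_top⟩
    · exact ⟨r.toReal, ENNReal.toReal_pos hr.ne' hr', ENNReal.ofReal_toReal_le⟩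
  refine ⟨ε, hε, fun Y hY => h (law Y) ((wassDist_law_le X Y).trans_lt (lt_of_lt_of_le ?_ hεr))⟩
  rw [Metric.mem_ball, dist_comm, dist_eq_norm] at hY
  exact (ENNReal.ofReal_lt_ofReal_iff hε).2 hY

lemma continuous_toP1 : Continuous (P2.toP1 : P2 d → P1 d) := by
  refine continuous_def.2 fun s hs m hm => ?_
  obtain ⟨r, hr, h⟩ := hs (P2.toP1 m) hm
  refine ⟨r, hr, fun m' hm' => h (P2.toP1 m') (lt_of_le_of_lt ?_ hm')⟩
  refine le_iInf fun π => le_iInf fun h1 => le_iInf fun h2 => ?_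
  refine iInf_le_of_le π (iInf_le_of_le h1 (iInf_le_of_le h2 ?_))
  have : IsProbabilityMeasure π := by
    constructor
    have : π.map Prod.fst univ = 1 := by rw [h1]; exact measure_univ
    rwa [Measure.map_apply measurable_fst .univ] at this
  exact eLpNorm_le_eLpNorm_of_exponent_le (by norm_num) (by fun_prop)

lemma Atomless.exists_law_eq (hP : Atomless P) (m : P2 d) : ∃ X : L2 d P, law X = m := by
  obtain ⟨Z, hZ, hmap⟩ := hP.exists_map_eq m.meas
  have hL : MemLp Z 2 P := by
    have := m.2
    change MemLp id 2 m.meas at this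
    rw [← hmap] at this
    exact (memLp_map_measure_iff aestronglyMeasurable_id hZ.aemeasurable).1 this
  refine ⟨hL.toLp Z, PSpace.ext_meas ?_⟩
  rw [law_meas, Measure.map_congr hL.coeFn_toLp, hmap]

lemma integrable_norm_sq_coe (h : L2 d P) : Integrable (fun ω => ‖h ω‖ ^ 2) P :=
  (memLp_two_iff_integrable_sq_norm (Lp.aestronglyMeasurable h)).1 (Lp.memLp h)

lemma integrable_coe (h : L2 d P) : Integrable h P := (Lp.memLp h).integrable (by norm_num)

lemma integrable_norm_coe (h : L2 d P) : Integrable (fun ω => ‖h ω‖) P := (integrable_coe h).norm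

lemma norm_sq_eq_integral (h : L2 d P) : ‖h‖ ^ 2 = ∫ ω, ‖h ω‖ ^ 2 ∂P := by
  rw [← real_inner_self_eq_norm_sq, L2.inner_def]
  simp

/-- `𝔼|h| ≤ ‖h‖` on a probability space. -/
lemma integral_norm_le_norm (h : L2 d P) : ∫ ω, ‖h ω‖ ∂P ≤ ‖h‖ := by
  set c := ∫ ω, ‖h ω‖ ∂P
  have hc : 0 ≤ c := integral_nonneg fun _ => norm_nonneg _
  have h0 : 0 ≤ ∫ ω, (‖h ω‖ - c) ^ 2 ∂P := integral_nonneg fun _ => sq_nonneg _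
  have h1 : ∫ ω, (‖h ω‖ - c) ^ 2 ∂P = ‖h‖ ^ 2 - c ^ 2 := by
    have : ∀ ω, (‖h ω‖ - c) ^ 2 = ‖h ω‖ ^ 2 - (2 * c) * ‖h ω‖ + c ^ 2 := fun ω => by ring
    simp only [this]
    have h2 : Integrable (fun ω => 2 * c * ‖h ω‖) P := (integrable_norm_coe h).const_mul _
    have h3 : Integrable (fun ω => ‖h ω‖ ^ 2 - 2 * c * ‖h ω‖) P := (integrable_norm_sq_coe h).sub h2
    rw [integral_add h3 (integrable_const _), integral_sub (integrable_norm_sq_coe h) h2, integral_const_mul, ← norm_sq_eq_integral]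
    simp; ring
  nlinarith [norm_nonneg h]

/-- The constant random variable with value `a`. -/
noncomputable abbrev cst (P : Measure Ω) [IsProbabilityMeasure P] (a : E d) : L2 d P :=
  Lp.const 2 P a

lemma coe_cst (a : E d) : (cst P a : Ω → E d) =ᵐ[P] fun _ => a := Lp.coeFn_const 2 P a

lemma norm_cst (a : E d) : ‖cst P a‖ = ‖a‖ := by
  have h : ‖cst P a‖ ^ 2 = ‖a‖ ^ 2 := by
    rw [norm_sq_eq_integral, integral_congr_ae (g := fun _ => ‖a‖ ^ 2)
      (by filter_upwards [coe_cst (P := P) a] with ω hω; rw [hω])]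
    simp
  exact (pow_left_inj₀ (norm_nonneg _) (norm_nonneg _) two_ne_zero).1 h

end Law

/-! ### Irrotational fields, potentials and the weak Laplacian -/

section Fields

variable {d : ℕ}

lemma inner_e (x : E d) (i : Fin d) : ⟪x, e i⟫_ℝ = x i := by
  simp [e, EuclideanSpace.inner_single_right]

lemma sum_smul_e (x : E d) : ∑ i, x i • (e i : E d) = x := by
  have := (EuclideanSpace.basisFun (Fin d) ℝ).sum_repr x
  simpa [e] using this

lemma continuous_tr : Continuous (tr : (E d →L[ℝ] E d) → ℝ) := by
  unfold tr; fun_prop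

/-- The derivative of a `C¹` irrotational field is symmetric, by the fundamental lemma of the
calculus of variations. -/
lemma Irrotational.inner_symm {w : E d → E d} {w' : E d → E d →L[ℝ] E d} (h : Irrotational w)
    (hw : ∀ x, HasFDerivAt w (w' x) x) (hc : Continuous w') (x u v : E d) :
    ⟪w' x u, v⟫_ℝ = ⟪w' x v, u⟫_ℝ := by
  have hwc : Continuous w := continuous_iff_continuousAt.2 fun x => (hw x).continuousAt
  have hwi : ∀ x i, HasFDerivAt (fun z => w z i) ((EuclideanSpace.proj i).comp (w' x)) x :=
    fun x i => (EuclideanSpace.proj (𝕜 := ℝ) i).hasFDerivAt.comp x (hw x)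
  have key : ∀ i j, ∀ x, w' x (e j) i = w' x (e i) j := by
    intro i j
    have hcont : Continuous fun x => w' x (e j) i - w' x (e i) j := by fun_prop
    have hzero : ∀ g : E d → ℝ, ContDiff ℝ ((⊤ : ℕ∞) : WithTop ℕ∞) g → HasCompactSupport g →
        ∫ x, g x • (w' x (e j) i - w' x (e i) j) = 0 := by
      intro g hg hgs
      have hg' : ContDiff ℝ 1 g := hg.of_le (by exact_mod_cast le_top)
      have hgc : Continuous g := hg.continuous
      have hfg : Continuous (fderiv ℝ g) := hg'.continuous_fderiv one_ne_zero
      have hfs : HasCompactSupport (fderiv ℝ g) := hgs.fderiv ℝ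
      have ibp : ∀ i j, ∫ x, w x i * fderiv ℝ g x (e j) = - ∫ x, (w' x (e j) i) * g x := by
        intro i j
        refine integral_bilinear_hasFDerivAt_right_eq_neg_left_of_integrable
          (B := ContinuousLinearMap.mul ℝ ℝ) (f := fun x => w x i)
          (f' := fun x => (EuclideanSpace.proj i).comp (w' x)) (g' := fderiv ℝ g) ?_ ?_ ?_
          (fun x _ => hwi x i) (fun x _ => (hg'.differentiable one_ne_zero x).hasFDerivAt)
        · exact Continuous.integrable_of_hasCompactSupport
            (by simp only [ContinuousLinearMap.mul_apply']; fun_prop) (hgs.mul_left)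
        · exact Continuous.integrable_of_hasCompactSupport
            (by simp only [ContinuousLinearMap.mul_apply']; fun_prop)
            ((hgs.fderiv_apply ℝ (e j)).mul_left)
        · exact Continuous.integrable_of_hasCompactSupport
            (by simp only [ContinuousLinearMap.mul_apply']; fun_prop) (hgs.mul_left)
      have h1 := h g hg hgs i j
      rw [ibp, ibp, neg_inj] at h1
      have hi : ∀ i j, Integrable fun x => (w' x (e j) i) * g x := fun i j =>
        Continuous.integrable_of_hasCompactSupport (by fun_prop) (hgs.mul_left)
      calc ∫ x, g x • (w' x (e j) i - w' x (e i) j)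
          = ∫ x, ((w' x (e j) i) * g x - (w' x (e i) j) * g x) := by
            congr 1; ext x; rw [smul_eq_mul]; ring
        _ = 0 := by rw [integral_sub (hi _ _) (hi _ _), h1, sub_self]
    have hae := ae_eq_zero_of_integral_contDiff_smul_eq_zero
      (hcont.locallyIntegrable (μ := volume)) hzero
    have := (hcont.ae_eq_iff_eq volume continuous_const).1 hae
    intro x
    exact sub_eq_zero.1 (congrFun this x)
  have hexp : ∀ u v : E d, ⟪w' x u, v⟫_ℝ = ∑ i, ∑ j, u j * v i * w' x (e j) i := by
    intro u v
    conv_lhs => rw [← sum_smul_e u, ← sum_smul_e v]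
    simp only [map_sum, map_smul, sum_inner, inner_sum, inner_smul_left, inner_smul_right, inner_e]
    refine Finset.sum_congr rfl fun i _ => ?_
    rw [Finset.mul_sum]
    refine Finset.sum_congr rfl fun j _ => ?_
    simp; ring
  rw [hexp, hexp, Finset.sum_comm]
  refine Finset.sum_congr rfl fun i _ => Finset.sum_congr rfl fun j _ => ?_
  rw [key]; ring

/-- A `C¹` irrotational field on `ℝ^d` is a gradient. -/
lemma Irrotational.exists_potential {w : E d → E d} {w' : E d → E d →L[ℝ] E d}
    (h : Irrotational w) (hw : ∀ x, HasFDerivAt w (w' x) x) (hc : Continuous w') :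
    ∃ U : E d → ℝ, ∀ x, HasGradientAt U (w x) x := by
  have hω : ∀ x, HasFDerivAt (fun x => innerSL ℝ (w x)) ((innerSL ℝ).comp (w' x)) x := fun x =>
    (innerSL ℝ (E := E d)).hasFDerivAt.comp x (hw x)
  obtain ⟨U, hU⟩ := (convex_univ (𝕜 := ℝ) (E := E d)).exists_forall_hasFDerivAt_of_fderiv_symmetric
    isOpen_univ (fun x _ => (hω x).differentiableAt.differentiableWithinAt)
    (fun x _ u v => by
      rw [(hω x).fderiv]
      simpa using h.inner_symm hw hc x u v)
  exact ⟨U, fun x => hasGradientAt_iff_hasFDerivAt.2 (hU x (mem_univ x))⟩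

/-- The line integral of a gradient along a segment. -/
lemma integral_segment_eq_sub {w : E d → E d} {U : E d → ℝ} (hU : ∀ x, HasGradientAt U (w x) x)
    (hw : Continuous w) (x y : E d) :
    ∫ t in (0 : ℝ)..1, ⟪w ((1 - t) • x + t • y), x - y⟫_ℝ = U x - U y := by
  have hd : ∀ t : ℝ, HasDerivAt (fun t : ℝ => (1 - t) • x + t • y) (y - x) t := by
    intro t
    have := (((hasDerivAt_id t).const_sub 1).smul_const x).add ((hasDerivAt_id t).smul_const y)
    convert! this using 1
    simp [sub_eq_neg_add]
  have h1 : ∀ t ∈ uIcc (0 : ℝ) 1, HasDerivAt (fun t : ℝ => - U ((1 - t) • x + t • y))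
      ⟪w ((1 - t) • x + t • y), x - y⟫_ℝ t := by
    intro t _
    have := ((hU ((1 - t) • x + t • y)).hasFDerivAt.comp_hasDerivAt t (hd t)).neg
    convert! this using 1
    simp [← inner_neg_right]
  rw [intervalIntegral.integral_eq_sub_of_hasDerivAt h1
    (Continuous.intervalIntegrable (by fun_prop) _ _)]
  simp; ring

lemma laplacian_eq_sum {f : E d → ℝ} (hf : ContDiff ℝ 2 f) (x : E d) :
    Laplacian.laplacian f x = ∑ j, fderiv ℝ (fun z => fderiv ℝ f z (e j)) x (e j) := by
  have hd : DifferentiableAt ℝ (fderiv ℝ f) x :=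
    (hf.fderiv_right (m := 1) (by norm_num)).differentiable one_ne_zero x
  rw [InnerProductSpace.laplacian_eq_iteratedFDeriv_orthonormalBasis f
    (EuclideanSpace.basisFun (Fin d) ℝ)]
  refine Finset.sum_congr rfl fun j _ => ?_
  rw [iteratedFDeriv_two_apply, fderiv_clm_apply hd (by fun_prop)]
  simp [e]

lemma contDiff_fderiv_apply {φ : E d → ℝ} (hφ : ContDiff ℝ ((⊤ : ℕ∞) : WithTop ℕ∞) φ) (v : E d) :
    ContDiff ℝ ((⊤ : ℕ∞) : WithTop ℕ∞) fun z => fderiv ℝ φ z v :=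
  (hφ.fderiv_right (m := ((⊤ : ℕ∞) : WithTop ℕ∞)) (by norm_cast)).clm_apply contDiff_const

/-- If the divergence of a `C¹` irrotational field `w` has a continuous derivative `L` in the
direction `e_i`, then `L` is the Laplacian of `w_i` in the sense of distributions. -/
lemma Irrotational.isWeakLaplacian {w : E d → E d} {w' : E d → E d →L[ℝ] E d}
    (h : Irrotational w) (hw : ∀ x, HasFDerivAt w (w' x) x) (hc : Continuous w') (i : Fin d)
    {L : E d → ℝ} (hL : Continuous L)
    (hdiv : ∀ x, HasLineDerivAt ℝ (fun z => tr (w' z)) (L x) x (e i)) :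
    IsWeakLaplacian (fun x => w x i) L := by
  intro φ hφ hφs
  have hwc : Continuous w := continuous_iff_continuousAt.2 fun x => (hw x).continuousAt
  have hwi : ∀ x i, HasFDerivAt (fun z => w z i) ((EuclideanSpace.proj i).comp (w' x)) x :=
    fun x i => (EuclideanSpace.proj (𝕜 := ℝ) i).hasFDerivAt.comp x (hw x)
  have hφ2 : ContDiff ℝ 2 φ := contDiff_infty.1 hφ 2
  have hs : ∀ v : E d, HasCompactSupport fun z => fderiv ℝ φ z v := fun v => hφs.fderiv_apply ℝ v
  have hc1 : ∀ v : E d, Continuous fun z => fderiv ℝ φ z v := fun v =>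
    (contDiff_fderiv_apply hφ v).continuous
  have hc2 : ∀ v u : E d, Continuous fun z => fderiv ℝ (fun z => fderiv ℝ φ z v) z u := fun v u =>
    (contDiff_fderiv_apply (contDiff_fderiv_apply hφ v) u).continuous
  have hs2 : ∀ v u : E d, HasCompactSupport fun z => fderiv ℝ (fun z => fderiv ℝ φ z v) z u :=
    fun v u => (hs v).fderiv_apply ℝ u
  have hd : ∀ x, DifferentiableAt ℝ (fderiv ℝ φ) x := fun x =>
    (hφ2.fderiv_right (m := 1) (by norm_num)).differentiable one_ne_zero x
  have hcomm : ∀ x (u v : E d), fderiv ℝ (fun z => fderiv ℝ φ z v) x u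
      = fderiv ℝ (fun z => fderiv ℝ φ z u) x v := by
    intro x u v
    rw [fderiv_clm_apply (hd x) (by fun_prop), fderiv_clm_apply (hd x) (by fun_prop)]
    have := (hφ2.contDiffAt (x := x)).isSymmSndFDerivAt (by simp)
    simpa using this u v
  have hint : ∀ k, ∀ g : E d → ℝ, Continuous g → HasCompactSupport g →
      Integrable fun x => w x k * g x := fun k g hg hgs =>
    Continuous.integrable_of_hasCompactSupport (by fun_prop) hgs.mul_left
  have hint' : ∀ j, Integrable fun x => w' x (e j) j * fderiv ℝ φ x (e i) := fun j =>
    Continuous.integrable_of_hasCompactSupport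
      (by have := hc1 (e i); fun_prop) (hs (e i)).mul_left
  have htr : Continuous fun x => tr (w' x) := continuous_tr.comp hc
  calc ∫ x, w x i * Laplacian.laplacian φ x
      = ∫ x, ∑ j, w x i * fderiv ℝ (fun z => fderiv ℝ φ z (e j)) x (e j) := by
        congr 1; ext x; rw [laplacian_eq_sum hφ2, Finset.mul_sum]
    _ = ∑ j, ∫ x, w x i * fderiv ℝ (fun z => fderiv ℝ φ z (e j)) x (e j) :=
        integral_finsetSum _ fun j _ => hint i _ (hc2 _ _) (hs2 _ _)
    _ = ∑ j, - ∫ x, w' x (e j) j * fderiv ℝ φ x (e i) := by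
        refine Finset.sum_congr rfl fun j _ => ?_
        rw [h _ (contDiff_fderiv_apply hφ (e j)) (hs (e j)) i j]
        simp only [hcomm _ (e i) (e j)]
        refine integral_bilinear_hasFDerivAt_right_eq_neg_left_of_integrable
          (B := ContinuousLinearMap.mul ℝ ℝ) (f := fun x => w x j)
          (f' := fun x => (EuclideanSpace.proj j).comp (w' x))
          (g := fun x => fderiv ℝ φ x (e i))
          (g' := fderiv ℝ (fun x => fderiv ℝ φ x (e i))) ?_ ?_ ?_
          (fun x _ => hwi x j) (fun x _ => ((contDiff_fderiv_apply hφ (e i)).differentiable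
            (by simp) x).hasFDerivAt)
        · exact hint' j
        · exact hint j _ (hc2 _ _) (hs2 _ _)
        · exact hint j _ (hc1 _) (hs _)
    _ = - ∫ x, tr (w' x) * fderiv ℝ φ x (e i) := by
        rw [Finset.sum_neg_distrib, ← integral_finsetSum _ fun j _ => hint' j]
        congr 2; ext x; rw [tr, Finset.sum_mul]
    _ = ∫ x, L x * φ x := by
        rw [neg_eq_iff_eq_neg]
        refine integral_bilinear_hasLineDerivAt_right_eq_neg_left_of_integrable
          (B := ContinuousLinearMap.mul ℝ ℝ) (f := fun x => tr (w' x)) (f' := L) (g := φ)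
          (g' := fun x => fderiv ℝ φ x (e i)) (v := e i) ?_ ?_ ?_
          (fun x _ => hdiv x) (fun x _ => (hφ2.differentiable (by simp) x).hasFDerivAt.hasLineDerivAt _)
        · exact Continuous.integrable_of_hasCompactSupport
            (by have := hφ.continuous; simp only [ContinuousLinearMap.mul_apply']; fun_prop) hφs.mul_left
        · exact Continuous.integrable_of_hasCompactSupport
            (by have := hc1 (e i); simp only [ContinuousLinearMap.mul_apply']; fun_prop)
            (hs (e i)).mul_left
        · exact Continuous.integrable_of_hasCompactSupport
            (by have := hφ.continuous; simp only [ContinuousLinearMap.mul_apply']; fun_prop) hφs.mul_left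

/-- A continuous distributional Laplacian of a `C²` function is its Laplacian. -/
lemma IsWeakLaplacian.eq_laplacian {f L : E d → ℝ} (h : IsWeakLaplacian f L) (hL : Continuous L)
    (hf : ContDiff ℝ 2 f) : L = Laplacian.laplacian f := by
  have hf1 : ∀ v : E d, ContDiff ℝ 1 fun z => fderiv ℝ f z v := fun v =>
    (hf.fderiv_right (m := 1) (by norm_num)).clm_apply contDiff_const
  have hΔ : Continuous (Laplacian.laplacian f) := by
    rw [show Laplacian.laplacian f = fun x => ∑ j, fderiv ℝ (fun z => fderiv ℝ f z (e j)) x (e j)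
      from funext fun x => laplacian_eq_sum hf x]
    exact continuous_finsetSum _ fun j _ =>
      ((hf1 (e j)).continuous_fderiv one_ne_zero).clm_apply continuous_const
  refine (hL.ae_eq_iff_eq volume hΔ).1 (ae_eq_of_integral_contDiff_smul_eq
    hL.locallyIntegrable hΔ.locallyIntegrable fun φ hφ hφs => ?_)
  have hφ2 : ContDiff ℝ 2 φ := contDiff_infty.1 hφ 2
  have hs : ∀ v : E d, HasCompactSupport fun z => fderiv ℝ φ z v := fun v => hφs.fderiv_apply ℝ v
  have hc1 : ∀ v : E d, Continuous fun z => fderiv ℝ φ z v := fun v =>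
    (contDiff_fderiv_apply hφ v).continuous
  have hint : ∀ f g : E d → ℝ, Continuous f → Continuous g → HasCompactSupport g →
      Integrable fun x => f x * g x := fun f g hf hg hgs =>
    Continuous.integrable_of_hasCompactSupport (by fun_prop) hgs.mul_left
  have hc2 : ∀ v u : E d, Continuous fun z => fderiv ℝ (fun z => fderiv ℝ φ z v) z u := fun v u =>
    (contDiff_fderiv_apply (contDiff_fderiv_apply hφ v) u).continuous
  have hs2 : ∀ v u : E d, HasCompactSupport fun z => fderiv ℝ (fun z => fderiv ℝ φ z v) z u :=
    fun v u => (hs v).fderiv_apply ℝ u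
  have hcf2 : ∀ v u : E d, Continuous fun z => fderiv ℝ (fun z => fderiv ℝ f z v) z u := fun v u =>
    ((hf1 v).continuous_fderiv one_ne_zero).clm_apply continuous_const
  have hφd : Differentiable ℝ φ := hφ2.differentiable (by simp)
  calc ∫ x, φ x • L x = ∫ x, L x * φ x := by congr 1; ext x; rw [smul_eq_mul, mul_comm]
    _ = ∫ x, f x * Laplacian.laplacian φ x := (h φ hφ hφs).symm
    _ = ∫ x, ∑ j, f x * fderiv ℝ (fun z => fderiv ℝ φ z (e j)) x (e j) := by
        congr 1; ext x; rw [laplacian_eq_sum hφ2, Finset.mul_sum]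
    _ = ∑ j, ∫ x, f x * fderiv ℝ (fun z => fderiv ℝ φ z (e j)) x (e j) :=
        integral_finsetSum _ fun j _ => hint _ _ hf.continuous (hc2 _ _) (hs2 _ _)
    _ = ∑ j, ∫ x, fderiv ℝ (fun z => fderiv ℝ f z (e j)) x (e j) * φ x := by
        refine Finset.sum_congr rfl fun j _ => ?_
        rw [integral_mul_fderiv_eq_neg_fderiv_mul_of_integrable
          (hint _ _ (hf1 _).continuous (hc1 _) (hs _))
          (hint _ _ hf.continuous (hc2 _ _) (hs2 _ _)) (hint _ _ hf.continuous (hc1 _) (hs _))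
          (fun x _ => hf.differentiable (by simp) x)
          (fun x _ => (contDiff_fderiv_apply hφ (e j)).differentiable (by simp) x),
          integral_mul_fderiv_eq_neg_fderiv_mul_of_integrable
          (hint _ _ (hcf2 _ _) hφ.continuous hφs)
          (hint _ _ (hf1 _).continuous (hc1 _) (hs _)) (hint _ _ (hf1 _).continuous hφ.continuous hφs)
          (fun x _ => (hf1 _).differentiable one_ne_zero x)
          (fun x _ => hφd x), neg_neg]
    _ = ∫ x, φ x • Laplacian.laplacian f x := by
        rw [← integral_finsetSum _ fun j _ => hint _ _ (hcf2 _ _) hφ.continuous hφs]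
        congr 1; ext x; rw [laplacian_eq_sum hf, smul_eq_mul, ← Finset.sum_mul, mul_comm]

end Fields

/-! ### Derivatives along laws, with uniform error estimates -/

section Expansion

variable {Ω : Type*} [MeasurableSpace Ω] {P : Measure Ω} [IsProbabilityMeasure P] {d : ℕ}

lemma MemLp.comp_law {g : E d → E d} {Z : L2 d P} (hg : MemLp g 2 (law Z).meas) :
    MemLp (fun ω => g (Z ω)) 2 P :=
  (memLp_map_measure_iff hg.1 (aemeasurable_coe Z)).1 hg

/-- The lift of `u` to `L²` has the directional derivatives `𝔼[D_m u(ℒ(Z), Z) ⬝ h]`. -/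
lemma hasDerivAt_lift {u : P2 d → ℝ} {g : P2 d → E d → E d} (hu : ∀ m, HasLGradAt P u m (g m))
    (X h : L2 d P) (s : ℝ) :
    HasDerivAt (fun s : ℝ => u (law (X + s • h)))
      (∫ ω, ⟪g (law (X + s • h)) ((X + s • h : L2 d P) ω), h ω⟫_ℝ ∂P) s := by
  obtain ⟨hm, hgrad⟩ := hu (law (X + s • h))
  have hL := MemLp.comp_law hm
  have h1 := (hgrad (X + s • h) (hL.toLp _) rfl hL.coeFn_toLp).hasFDerivAt
  have h2 : HasDerivAt (fun s : ℝ => X + s • h) h s := by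
    simpa using ((hasDerivAt_id s).smul_const h).const_add X
  have h3 := h1.comp_hasDerivAt s h2
  convert! h3 using 1
  rw [InnerProductSpace.toDual_apply_apply, L2.inner_def]
  refine integral_congr_ae ?_
  filter_upwards [hL.coeFn_toLp] with ω hω
  rw [hω]

lemma integrable_inner_lift {u : P2 d → ℝ} {g : P2 d → E d → E d}
    (hu : ∀ m, HasLGradAt P u m (g m)) (Z h : L2 d P) :
    Integrable (fun ω => ⟪g (law Z) (Z ω), h ω⟫_ℝ) P := by
  have hL := MemLp.comp_law (hu (law Z)).1
  refine (L2.integrable_inner (𝕜 := ℝ) (hL.toLp _) h).congr ?_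
  filter_upwards [hL.coeFn_toLp] with ω hω
  rw [hω]

/-- Comparison of `⟪v', k⟫` with `⟪v, a⟫` when `v'` is close to `v` as long as `k` is close
to `a`. -/
lemma abs_inner_sub_inner_le {v v' k a : E d} {C η δ : ℝ} (hη : 0 ≤ η) (hv : ‖v‖ ≤ C)
    (hv' : ‖v'‖ ≤ C) (ha : ‖a‖ < δ) (hclose : ‖k - a‖ < δ → ‖v' - v‖ ≤ η) :
    |⟪v', k⟫_ℝ - ⟪v, a⟫_ℝ| ≤ η * ‖a‖ + (η + 5 * C) * ‖k - a‖ := by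
  have hC : 0 ≤ C := (norm_nonneg v).trans hv
  have hk : ‖k‖ ≤ ‖a‖ + ‖k - a‖ := by
    simpa using norm_add_le a (k - a)
  have hsplit : ⟪v', k⟫_ℝ - ⟪v, a⟫_ℝ = ⟪v' - v, k⟫_ℝ + ⟪v, k - a⟫_ℝ := by
    rw [inner_sub_left, inner_sub_right]; ring
  have h1 : |⟪v, k - a⟫_ℝ| ≤ C * ‖k - a‖ := (abs_real_inner_le_norm _ _).trans (by gcongr)
  have h2 : |⟪v' - v, k⟫_ℝ| ≤ ‖v' - v‖ * ‖k‖ := abs_real_inner_le_norm _ _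
  have h0 := norm_nonneg (k - a)
  rw [hsplit]
  refine (abs_add_le _ _).trans ?_
  rcases lt_or_ge ‖k - a‖ δ with h | h
  · have h3 : ‖v' - v‖ * ‖k‖ ≤ η * (‖a‖ + ‖k - a‖) :=
      mul_le_mul (hclose h) hk (norm_nonneg _) hη
    nlinarith [mul_nonneg hC h0]
  · have h3 : ‖v' - v‖ ≤ 2 * C := (norm_sub_le _ _).trans (by linarith)
    have h4 : ‖v' - v‖ * ‖k‖ ≤ (2 * C) * (2 * ‖k - a‖) :=
      mul_le_mul h3 (by linarith) (norm_nonneg _) (by positivity)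
    nlinarith [mul_nonneg hη h0, mul_nonneg hη (norm_nonneg a)]

/-- First-order expansion of `s ↦ u(ℒ(X + s h))`, with the increment `h` replaced by a constant
`a` in the main term. -/
lemma abs_lift_sub_le {u : P2 d → ℝ} {g : P2 d → E d → E d} (hu : ∀ m, HasLGradAt P u m (g m))
    (X h : L2 d P) {a : E d} {g₀ : E d → E d}
    (hg₀ : AEStronglyMeasurable (fun ω => g₀ (X ω)) P) {C η δ : ℝ} (hη : 0 ≤ η)
    (hC : ∀ s ∈ Icc (0 : ℝ) 1, ∀ y, ‖g (law (X + s • h)) y‖ ≤ C)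
    (hC₀ : ∀ᵐ ω ∂P, ‖g₀ (X ω)‖ ≤ C) (ha : ‖a‖ < δ)
    (hclose : ∀ᵐ ω ∂P, ∀ s ∈ Icc (0 : ℝ) 1, ∀ y, ‖y - X ω‖ < 2 * δ →
      ‖g (law (X + s • h)) y - g₀ (X ω)‖ ≤ η) {s : ℝ} (hs : s ∈ Icc (0 : ℝ) 1) :
    |u (law (X + s • h)) - u (law X) - s * ∫ ω, ⟪g₀ (X ω), a⟫_ℝ ∂P|
      ≤ η * ‖a‖ + (η + 5 * C) * ‖h - cst P a‖ := by
  have hC0 : 0 ≤ C := (norm_nonneg _).trans (hC 0 (by simp) 0)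
  have hint₀ : Integrable (fun ω => ⟪g₀ (X ω), a⟫_ℝ) P := by
    refine Integrable.of_bound (C := C * ‖a‖) (hg₀.inner_const) ?_
    filter_upwards [hC₀] with ω hω
    exact (norm_inner_le_norm _ _).trans (by gcongr)
  have hpt : ∀ s ∈ Icc (0 : ℝ) 1, ∀ᵐ ω ∂P,
      |⟪g (law (X + s • h)) ((X + s • h : L2 d P) ω), h ω⟫_ℝ - ⟪g₀ (X ω), a⟫_ℝ|
        ≤ η * ‖a‖ + (η + 5 * C) * ‖(h - cst P a : L2 d P) ω‖ := by
    intro s hs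
    filter_upwards [hC₀, hclose, Lp.coeFn_add X (s • h), Lp.coeFn_smul s h,
      Lp.coeFn_sub h (cst P a), coe_cst (P := P) a] with ω h1 h2 h3 h4 h5 h6
    rw [h5, Pi.sub_apply, h6, h3, Pi.add_apply, h4, Pi.smul_apply]
    refine abs_inner_sub_inner_le hη h1 (hC s hs _) ha fun h7 => h2 s hs _ ?_
    have : ‖s • h ω‖ ≤ ‖h ω‖ := by
      rw [norm_smul, Real.norm_of_nonneg hs.1]
      exact mul_le_of_le_one_left (norm_nonneg _) hs.2
    have h8 : ‖h ω‖ ≤ ‖a‖ + ‖h ω - a‖ := by simpa using norm_add_le a (h ω - a)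
    rw [add_sub_cancel_left]
    linarith
  have hbound : ∀ s ∈ Icc (0 : ℝ) 1,
      ‖(∫ ω, ⟪g (law (X + s • h)) ((X + s • h : L2 d P) ω), h ω⟫_ℝ ∂P)
        - ∫ ω, ⟪g₀ (X ω), a⟫_ℝ ∂P‖ ≤ η * ‖a‖ + (η + 5 * C) * ‖h - cst P a‖ := by
    intro s hs
    rw [← integral_sub (integrable_inner_lift hu _ h) hint₀]
    have hi := (integrable_norm_coe (h - cst P a)).const_mul (η + 5 * C)
    refine (norm_integral_le_of_norm_le ((integrable_const (η * ‖a‖)).add hi) (hpt s hs)).trans ?_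
    have h1 : ∫ ω, (η + 5 * C) * ‖(h - cst P a : L2 d P) ω‖ ∂P
        = (η + 5 * C) * ∫ ω, ‖(h - cst P a : L2 d P) ω‖ ∂P := integral_const_mul _ _
    rw [integral_add' (integrable_const _) hi, h1]
    have := integral_norm_le_norm (h - cst P a)
    simp only [integral_const, probReal_univ, smul_eq_mul, one_mul]
    gcongr
  have hderiv : ∀ s ∈ Icc (0 : ℝ) 1, HasDerivWithinAt
      (fun s : ℝ => u (law (X + s • h)) - s * ∫ ω, ⟪g₀ (X ω), a⟫_ℝ ∂P)
      ((∫ ω, ⟪g (law (X + s • h)) ((X + s • h : L2 d P) ω), h ω⟫_ℝ ∂P)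
        - ∫ ω, ⟪g₀ (X ω), a⟫_ℝ ∂P) (Icc 0 1) s := by
    intro s _
    have := (hasDerivAt_lift hu X h s).sub
      ((hasDerivAt_id s).mul_const (∫ ω, ⟪g₀ (X ω), a⟫_ℝ ∂P))
    rw [one_mul] at this
    exact this.hasDerivWithinAt
  have := norm_image_sub_le_of_norm_deriv_le_segment' hderiv
    (fun t ht => hbound t (Ico_subset_Icc_self ht)) s hs
  have h0 : 0 ≤ η * ‖a‖ + (η + 5 * C) * ‖h - cst P a‖ := by positivity
  simp only [zero_smul, add_zero, zero_mul, sub_zero, Real.norm_eq_abs] at this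
  rw [show u (law (X + s • h)) - u (law X) - s * ∫ ω, ⟪g₀ (X ω), a⟫_ℝ ∂P =
    u (law (X + s • h)) - s * ∫ ω, ⟪g₀ (X ω), a⟫_ℝ ∂P - u (law X) by ring]
  exact this.trans (mul_le_of_le_one_right h0 hs.2)

/-- First-order expansion of `s ↦ f(y + s k)`, with the increment `k` replaced by `a` in the main
term. -/
lemma norm_add_smul_sub_le {G : Type*} [NormedAddCommGroup G] [NormedSpace ℝ G] {f : E d → G}
    {f' : E d → E d →L[ℝ] G} (hf : ∀ z, HasFDerivAt f (f' z) z) {A : E d →L[ℝ] G} {C η δ : ℝ}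
    (hη : 0 ≤ η) (hC : ∀ z, ‖f' z‖ ≤ C) (hA : ‖A‖ ≤ C) {y k a : E d} (ha : ‖a‖ < δ)
    (hclose : ∀ z, ‖z - y‖ < 2 * δ → ‖f' z - A‖ ≤ η) {s : ℝ} (hs : s ∈ Icc (0 : ℝ) 1) :
    ‖f (y + s • k) - f y - s • A a‖ ≤ η * ‖a‖ + (η + 5 * C) * ‖k - a‖ := by
  have hC0 : 0 ≤ C := (norm_nonneg A).trans hA
  have hk : ‖k‖ ≤ ‖a‖ + ‖k - a‖ := by simpa using norm_add_le a (k - a)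
  have hsk : ∀ v : E d, ‖s • v‖ ≤ ‖v‖ := fun v => by
    rw [norm_smul, Real.norm_of_nonneg hs.1]
    exact mul_le_of_le_one_left (norm_nonneg _) hs.2
  have h0 := norm_nonneg (k - a)
  rcases lt_or_ge ‖k - a‖ δ with h | h
  · have hball : y + s • k ∈ Metric.ball y (2 * δ) := by
      rw [mem_ball_iff_norm, add_sub_cancel_left]
      linarith [hsk k]
    have h1 := (convex_ball y (2 * δ)).norm_image_sub_le_of_norm_hasFDerivWithin_le'
      (fun z _ => (hf z).hasFDerivWithinAt)
      (fun z hz => hclose z (mem_ball_iff_norm.1 hz))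
      (Metric.mem_ball_self (by linarith [norm_nonneg a])) hball
    rw [add_sub_cancel_left] at h1
    have h2 : f (y + s • k) - f y - s • A a = (f (y + s • k) - f y - A (s • k)) + A (s • (k - a)) := by
      simp only [map_smul, map_sub, smul_sub]; abel
    rw [h2]
    refine (norm_add_le _ _).trans ?_
    have h3 : ‖A (s • (k - a))‖ ≤ C * ‖k - a‖ := (A.le_opNorm _).trans (by gcongr; exact hsk _)
    have h4 : η * ‖s • k‖ ≤ η * (‖a‖ + ‖k - a‖) := by gcongr; exact (hsk k).trans hk
    nlinarith [mul_nonneg hC0 h0]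
  · have h1 := convex_univ.norm_image_sub_le_of_norm_hasFDerivWithin_le
      (fun z _ => (hf z).hasFDerivWithinAt) (fun z _ => hC z) (mem_univ y) (mem_univ (y + s • k))
    rw [add_sub_cancel_left] at h1
    have h2 : ‖s • A a‖ ≤ C * ‖a‖ := by
      rw [← map_smul]
      exact (A.le_opNorm _).trans (by gcongr; exact hsk _)
    refine (norm_sub_le _ _).trans ?_
    have h3 : C * ‖s • k‖ ≤ C * (‖a‖ + ‖k - a‖) := by gcongr; exact (hsk k).trans hk
    have h4 : C * ‖a‖ ≤ C * ‖k - a‖ := by gcongr; linarith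
    nlinarith [mul_nonneg hη h0, mul_nonneg hη (norm_nonneg a), mul_nonneg hC0 h0]

/-- A continuous function is uniformly continuous at the points of a compact set. -/
lemma exists_uniform_of_isCompact {M G : Type*} [PseudoMetricSpace M] [PseudoMetricSpace G]
    {f : M → G} (hf : Continuous f) {K : Set M} (hK : IsCompact K) {η : ℝ} (hη : 0 < η) :
    ∃ δ > 0, ∀ p ∈ K, ∀ q, dist q p < δ → dist (f q) (f p) < η := by
  have := hK.uniformContinuousAt_of_continuousAt f (fun a _ => hf.continuousAt)
    (Metric.dist_mem_uniformity hη)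
  obtain ⟨δ, hδ, h⟩ := Metric.mem_uniformity_dist.1 this
  refine ⟨δ, hδ, fun p hp q hq => ?_⟩
  rw [dist_comm]
  exact h (by rwa [dist_comm]) hp

variable {W : E d → P2 d → E d} {DxW : E d → P2 d → E d →L[ℝ] E d}
  {DmW : Fin d → E d → P2 d → E d → E d} {DymW DxmW : Fin d → E d → P2 d → E d → E d →L[ℝ] E d}
  {DmmW : Fin d → Fin d → E d → P2 d → E d → E d → E d}

/-- The second-order derivatives are bounded in `y, y'`, uniformly for `x` in a ball and `Z` close
to a given `X`. -/
lemma HasContinuousDerivatives.exists_bound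
    (hD : HasContinuousDerivatives P W DxW DmW DymW DxmW DmmW) (X : L2 d P) (R : ℝ) :
    ∃ C, 0 ≤ C ∧ ∃ δ > 0, ∀ i j, ∀ Z : L2 d P, ‖Z - X‖ < δ → ∀ x, ‖x‖ ≤ R → ∀ y y',
      ‖DymW i x (law Z) y‖ ≤ C ∧ ‖DxmW i x (law Z) y‖ ≤ C ∧ ‖DmmW i j x (law Z) y y'‖ ≤ C := by
  have h1 : ∀ i j, ∃ C : ℝ, ∀ᶠ Z in 𝓝 X, ∀ x ∈ Metric.closedBall (0 : E d) R, ∀ y y',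
      ‖DymW i x (law Z) y‖ ≤ C ∧ ‖DxmW i x (law Z) y‖ ≤ C ∧ ‖DmmW i j x (law Z) y y'‖ ≤ C := by
    intro i j
    refine (isCompact_closedBall (0 : E d) R).induction_on
      (p := fun s => ∃ C : ℝ, ∀ᶠ Z in 𝓝 X, ∀ x ∈ s, ∀ y y', ‖DymW i x (law Z) y‖ ≤ C ∧
        ‖DxmW i x (law Z) y‖ ≤ C ∧ ‖DmmW i j x (law Z) y y'‖ ≤ C) ⟨0, by simp⟩ ?_ ?_ ?_
    · rintro s t hst ⟨C, hC⟩
      exact ⟨C, hC.mono fun Z h x hx => h x (hst hx)⟩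
    · rintro s t ⟨C, hC⟩ ⟨C', hC'⟩
      refine ⟨max C C', ?_⟩
      filter_upwards [hC, hC'] with Z h h' x hx y y'
      rcases hx with hx | hx
      · obtain ⟨a, b, c⟩ := h x hx y y'
        exact ⟨a.trans (le_max_left _ _), b.trans (le_max_left _ _), c.trans (le_max_left _ _)⟩
      · obtain ⟨a, b, c⟩ := h' x hx y y'
        exact ⟨a.trans (le_max_right _ _), b.trans (le_max_right _ _), c.trans (le_max_right _ _)⟩
    · intro x _
      obtain ⟨C, hC⟩ := hD.locally_bounded i j x (law X)
      rw [nhds_prod_eq] at hC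
      obtain ⟨pa, ha, pb, hb, hab⟩ := eventually_prod_iff.1 hC
      exact ⟨{z | pa z}, mem_nhdsWithin_of_mem_nhds ha, C,
        (continuous_law.continuousAt.eventually hb).mono fun Z hZ x hx => hab hx hZ⟩
  choose C hC using h1
  have h2 := eventually_all.2 fun i => eventually_all.2 fun j => hC i j
  obtain ⟨δ, hδ, h3⟩ := Metric.eventually_nhds_iff.1 h2
  refine ⟨∑ i, ∑ j, |C i j|, by positivity, δ, hδ, fun i j Z hZ x hx y y' => ?_⟩
  obtain ⟨a, b, c⟩ := h3 (by rwa [dist_eq_norm]) i j x (by simpa using hx) y y'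
  have hle : C i j ≤ ∑ i, ∑ j, |C i j| :=
    ((le_abs_self _).trans (Finset.single_le_sum (f := fun j => |C i j|)
      (fun _ _ => abs_nonneg _) (Finset.mem_univ j))).trans
      (Finset.single_le_sum (f := fun i => ∑ j, |C i j|)
        (fun _ _ => Finset.sum_nonneg fun _ _ => abs_nonneg _) (Finset.mem_univ i))
  exact ⟨a.trans hle, b.trans hle, c.trans hle⟩

/-- A family of continuous functions of `(x, m, y)` is uniformly continuous at `ℒ(X)` and at the
points `x, y` of a ball. -/
lemma exists_uniform_law {G M : Type*} [NormedAddCommGroup G] [NormedAddCommGroup M]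
    [ProperSpace M] {f : E d × P2 d × M → G}
    (hf : Continuous f) (X : L2 d P) (R : ℝ) {η : ℝ} (hη : 0 < η) :
    ∃ δ > 0, ∀ (x : E d) (y : M), ‖x‖ ≤ R → ‖y‖ ≤ R → ∀ x' y', ∀ Z : L2 d P, ‖x' - x‖ < δ → ‖y' - y‖ < δ →
      ‖Z - X‖ < δ → ‖f (x', law Z, y') - f (x, law X, y)‖ ≤ η := by
  have hc : Continuous fun q : E d × L2 d P × M => f (q.1, law q.2.1, q.2.2) :=
    hf.comp (continuous_fst.prodMk ((continuous_law.comp (continuous_fst.comp continuous_snd)).prodMk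
      (continuous_snd.comp continuous_snd)))
  obtain ⟨δ, hδ, h⟩ := exists_uniform_of_isCompact hc ((isCompact_closedBall (0 : E d) R).prod
    ((isCompact_singleton (x := X)).prod (isCompact_closedBall (0 : M) R))) hη
  refine ⟨δ, hδ, fun x y hx hy x' y' Z h1 h2 h3 => ?_⟩
  rw [← dist_eq_norm]
  refine (h (x, X, y) ⟨by simpa using hx, rfl, by simpa using hy⟩ (x', Z, y') ?_).le
  rw [Prod.dist_eq, Prod.dist_eq]
  simp only [dist_eq_norm]
  exact max_lt h1 (max_lt h3 h2)

end Expansion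

/-! ### The second-order operator of the measure variable -/

section SecondOrder

variable {Ω : Type*} [MeasurableSpace Ω] {P : Measure Ω} [IsProbabilityMeasure P] {d : ℕ}

/-- The matrix `D²_{mm} W_i(x, m, y, y')` as an operator: its `j`-th row is `DmmW i j x m y y'`. -/
noncomputable def DmmOp (DmmW : Fin d → Fin d → E d → P2 d → E d → E d → E d)
    (i : Fin d) (x : E d) (m : P2 d) (y y' : E d) : E d →L[ℝ] E d :=
  ∑ j, (innerSL ℝ (DmmW i j x m y y')).smulRight (e j)

/-- The operator whose trace is
`∫ Tr D²_{ym} W_i dm + 2 ∫ Tr D²_{xm} W_i dm + ∫∫ Tr D²_{mm} W_i dm dm`. It represents the second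
derivative at `a = 0` of `W_i(x + a, m_a) - W_i(x + a, m)`, where `m_a` is `m` translated by `a`. -/
noncomputable def secondOp (DymW DxmW : Fin d → E d → P2 d → E d → E d →L[ℝ] E d)
    (DmmW : Fin d → Fin d → E d → P2 d → E d → E d → E d)
    (i : Fin d) (x : E d) (m : P2 d) : E d →L[ℝ] E d :=
  (∫ y, DymW i x m y ∂m.meas) + (2 : ℝ) • (∫ y, DxmW i x m y ∂m.meas)
    + ∫ q, DmmOp DmmW i x m q.1 q.2 ∂(m.meas.prod m.meas)

/-- The trace as a continuous linear form. -/
noncomputable def trL : (E d →L[ℝ] E d) →L[ℝ] ℝ :=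
  ∑ k, (EuclideanSpace.proj k).comp (ContinuousLinearMap.apply ℝ (E d) (e k))

lemma trL_apply (A : E d →L[ℝ] E d) : trL A = tr A := by
  simp [trL, tr]

lemma e_apply (j k : Fin d) : (e j : E d) k = if k = j then 1 else 0 := by
  simp [e]

variable {W : E d → P2 d → E d} {DxW : E d → P2 d → E d →L[ℝ] E d}
  {DmW : Fin d → E d → P2 d → E d → E d} {DymW DxmW : Fin d → E d → P2 d → E d → E d →L[ℝ] E d}
  {DmmW : Fin d → Fin d → E d → P2 d → E d → E d → E d}

lemma DmmOp_apply (i : Fin d) (x : E d) (m : P2 d) (y y' a : E d) (j : Fin d) :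
    DmmOp DmmW i x m y y' a j = ⟪DmmW i j x m y y', a⟫_ℝ := by
  simp [DmmOp, e_apply]

lemma tr_DmmOp (i : Fin d) (x : E d) (m : P2 d) (y y' : E d) :
    tr (DmmOp DmmW i x m y y') = ∑ j, DmmW i j x m y y' j := by
  simp only [tr, DmmOp_apply, inner_e]

namespace HasContinuousDerivatives

lemma continuous_DmmOp (hD : HasContinuousDerivatives P W DxW DmW DymW DxmW DmmW) (i : Fin d) :
    Continuous fun q : E d × P2 d × E d × E d => DmmOp DmmW i q.1 q.2.1 q.2.2.1 q.2.2.2 := by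
  unfold DmmOp
  refine continuous_finsetSum _ fun j _ => ?_
  have h := (innerSL ℝ (E := E d)).continuous.comp (hD.cont_mm i j)
  exact ((ContinuousLinearMap.smulRightL ℝ (E d) (E d)).flip (e j)).continuous.comp h

lemma exists_bound_DmmOp (hD : HasContinuousDerivatives P W DxW DmW DymW DxmW DmmW)
    (X : L2 d P) (R : ℝ) :
    ∃ C, 0 ≤ C ∧ ∃ δ > 0, ∀ i, ∀ Z : L2 d P, ‖Z - X‖ < δ → ∀ x, ‖x‖ ≤ R → ∀ y y',
      ‖DymW i x (law Z) y‖ ≤ C ∧ ‖DxmW i x (law Z) y‖ ≤ C ∧ ‖DmmOp DmmW i x (law Z) y y'‖ ≤ C ∧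
      ∀ j, ‖DmmW i j x (law Z) y y'‖ ≤ C := by
  obtain ⟨C, hC, δ, hδ, h⟩ := hD.exists_bound X R
  refine ⟨(d + 1) * C, by positivity, δ, hδ, fun i Z hZ x hx y y' => ?_⟩
  have hle : C ≤ (d + 1) * C := by nlinarith [(Nat.cast_nonneg d : (0 : ℝ) ≤ d)]
  refine ⟨((h i i Z hZ x hx y y').1).trans hle, ((h i i Z hZ x hx y y').2.1).trans hle, ?_,
    fun j => ((h i j Z hZ x hx y y').2.2).trans hle⟩
  refine (norm_sum_le _ _).trans ?_
  have : ∀ j ∈ Finset.univ, ‖(innerSL ℝ (DmmW i j x (law Z) y y')).smulRight (e j)‖ ≤ C := by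
    intro j _
    rw [ContinuousLinearMap.norm_smulRight_apply, innerSL_apply_norm]
    simpa [e] using (h i j Z hZ x hx y y').2.2
  refine (Finset.sum_le_card_nsmul _ _ _ this).trans ?_
  simp; nlinarith

lemma continuous_ym (hD : HasContinuousDerivatives P W DxW DmW DymW DxmW DmmW) (i : Fin d)
    (x : E d) (m : P2 d) : Continuous (DymW i x m) :=
  (hD.cont_ym i).comp (by fun_prop : Continuous fun y : E d => (x, m, y))

lemma continuous_xm (hD : HasContinuousDerivatives P W DxW DmW DymW DxmW DmmW) (i : Fin d)
    (x : E d) (m : P2 d) : Continuous (DxmW i x m) :=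
  (hD.cont_xm i).comp (by fun_prop : Continuous fun y : E d => (x, m, y))

lemma continuous_mm (hD : HasContinuousDerivatives P W DxW DmW DymW DxmW DmmW) (i : Fin d)
    (x : E d) (m : P2 d) : Continuous fun q : E d × E d => DmmOp DmmW i x m q.1 q.2 :=
  Continuous.comp (g := fun q : E d × P2 d × E d × E d => DmmOp DmmW i q.1 q.2.1 q.2.2.1 q.2.2.2)
    (f := fun q : E d × E d => (x, m, q)) (hD.continuous_DmmOp i) (by fun_prop)

lemma integrable_second (hD : HasContinuousDerivatives P W DxW DmW DymW DxmW DmmW) (i : Fin d)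
    (x : E d) (X : L2 d P) :
    Integrable (DymW i x (law X)) (law X).meas ∧ Integrable (DxmW i x (law X)) (law X).meas ∧
    Integrable (fun q : E d × E d => DmmOp DmmW i x (law X) q.1 q.2)
      ((law X).meas.prod (law X).meas) := by
  obtain ⟨C, -, δ, hδ, h⟩ := hD.exists_bound_DmmOp X ‖x‖
  have h' := fun y y' => h i X (by simpa using hδ) x le_rfl y y'
  exact ⟨.of_bound (hD.continuous_ym i x _).aestronglyMeasurable C
      (ae_of_all _ fun y => (h' y 0).1),
    .of_bound (hD.continuous_xm i x _).aestronglyMeasurable C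
      (ae_of_all _ fun y => (h' y 0).2.1),
    .of_bound (hD.continuous_mm i x _).aestronglyMeasurable C
      (ae_of_all _ fun q => (h' q.1 q.2).2.2.1)⟩

lemma tr_secondOp (hD : HasContinuousDerivatives P W DxW DmW DymW DxmW DmmW) (i : Fin d)
    (x : E d) (X : L2 d P) :
    tr (secondOp DymW DxmW DmmW i x (law X)) = ∫ y, tr (DymW i x (law X) y) ∂(law X).meas
      + 2 * ∫ y, tr (DxmW i x (law X) y) ∂(law X).meas
      + ∫ q, (∑ j, DmmW i j x (law X) q.1 q.2 j) ∂((law X).meas.prod (law X).meas) := by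
  obtain ⟨h1, h2, h3⟩ := hD.integrable_second i x X
  rw [← trL_apply, secondOp, map_add, map_add, map_smul, ← trL.integral_comp_comm h1,
    ← trL.integral_comp_comm h2, ← trL.integral_comp_comm h3]
  simp only [trL_apply, tr_DmmOp, smul_eq_mul]

/-- First-order expansion of `D_m W_i(x + a, ℒ(X + s h), y + s k)` for `h`, `k` close to `a`. -/
lemma DmW_expansion (hD : HasContinuousDerivatives P W DxW DmW DymW DxmW DmmW) (i : Fin d)
    (X : L2 d P) {R : ℝ} (hX : ∀ᵐ ω ∂P, ‖X ω‖ ≤ R) {η : ℝ} (hη : 0 < η) :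
    ∃ C, 0 ≤ C ∧ ∃ δ > 0, ∀ (h : L2 d P) (a : E d), ‖h‖ < δ → ‖a‖ < δ → ∀ x, ‖x‖ ≤ R →
      ∀ s ∈ Icc (0 : ℝ) 1, ∀ y k : E d, ‖y‖ ≤ R →
      ‖DmW i (x + a) (law (X + s • h)) (y + s • k) - DmW i x (law X) y
        - (DxmW i x (law X) y a + s • (DymW i x (law X) y a
          + (∫ y', DmmOp DmmW i x (law X) y y' ∂(law X).meas) a))‖
        ≤ η * ‖a‖ + C * (‖k - a‖ + ‖h - cst P a‖) := by
  obtain ⟨C, hC, δ₀, hδ₀, hbd⟩ := hD.exists_bound_DmmOp X (R + 1)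
  set θ := η / (d + 2) with hθ
  have hθ0 : 0 < θ := by positivity
  obtain ⟨δ₁, hδ₁, h1⟩ := exists_uniform_law (hD.cont_ym i) X R hθ0
  obtain ⟨δ₂, hδ₂, h2⟩ := exists_uniform_law (hD.cont_xm i) X R hθ0
  have h3' : ∀ j, ∃ δ > 0, ∀ (x : E d) (y : E d × E d), ‖x‖ ≤ R → ‖y‖ ≤ R → ∀ x' y',
      ∀ Z : L2 d P, ‖x' - x‖ < δ → ‖y' - y‖ < δ → ‖Z - X‖ < δ →
      ‖DmmW i j x' (law Z) y'.1 y'.2 - DmmW i j x (law X) y.1 y.2‖ ≤ θ := fun j =>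
    exists_uniform_law (M := E d × E d) (hD.cont_mm i j) X R hθ0
  choose δ₃ hδ₃ h3 using h3'
  obtain ⟨δ₄, hδ₄, h4⟩ : ∃ δ > 0, ∀ j, δ ≤ δ₃ j := by
    rcases isEmpty_or_nonempty (Fin d) with hemp | hne
    · exact ⟨1, one_pos, fun j => hemp.elim j⟩
    · exact ⟨Finset.univ.inf' Finset.univ_nonempty δ₃, by simpa using hδ₃,
        fun j => Finset.inf'_le _ (Finset.mem_univ j)⟩
  obtain ⟨δ, hδ, hδ'⟩ : ∃ δ > 0, 2 * δ ≤ 1 ∧ 2 * δ ≤ δ₀ ∧ 2 * δ ≤ δ₁ ∧ 2 * δ ≤ δ₂ ∧ 2 * δ ≤ δ₄ := by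
    refine ⟨min 1 (min δ₀ (min δ₁ (min δ₂ δ₄))) / 2, by positivity, ?_⟩
    rw [mul_div_cancel₀ _ two_ne_zero]
    refine ⟨min_le_left _ _, ?_, ?_, ?_, ?_⟩ <;> simp
  obtain ⟨e0, e1, e2, e3, e4⟩ := hδ'
  refine ⟨(d + 1) * (θ + 5 * C), by positivity, δ, hδ, fun h a hh ha x hx s hs y k hy => ?_⟩
  have hxa : ‖x + a‖ ≤ R + 1 := (norm_add_le _ _).trans (by linarith)
  have hZ : ∀ t ∈ Icc (0 : ℝ) 1, ‖X + t • h - X‖ < δ := fun t ht => by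
    rw [add_sub_cancel_left, norm_smul, Real.norm_of_nonneg ht.1]
    exact (mul_le_of_le_one_left (norm_nonneg _) ht.2).trans_lt hh
  have hXX : ‖X - X‖ < δ₀ := by simpa using hδ₀
  have hxax : ‖x + a - x‖ < δ := by rwa [add_sub_cancel_left]
  -- the variation in `x`
  have px : ‖DmW i (x + a) (law X) y - DmW i x (law X) y - DxmW i x (law X) y a‖ ≤ θ * ‖a‖ := by
    have := (convex_ball x δ).norm_image_sub_le_of_norm_hasFDerivWithin_le'
      (f := fun z => DmW i z (law X) y) (f' := fun z => DxmW i z (law X) y)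
      (φ := DxmW i x (law X) y) (C := θ)
      (fun z _ => (hD.deriv_xm i z (law X) y).hasFDerivWithinAt)
      (fun z hz => h2 x y hx hy z y X (by linarith [mem_ball_iff_norm.1 hz]) (by simpa using hδ₂)
        (by simpa using hδ₂)) (Metric.mem_ball_self hδ) (mem_ball_iff_norm.2 hxax)
    rwa [add_sub_cancel_left] at this
  -- the variation in `y`
  have py : ‖DmW i (x + a) (law (X + s • h)) (y + s • k) - DmW i (x + a) (law (X + s • h)) y
      - s • DymW i x (law X) y a‖ ≤ θ * ‖a‖ + (θ + 5 * C) * ‖k - a‖ :=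
    norm_add_smul_sub_le (fun z => hD.deriv_ym i (x + a) (law (X + s • h)) z) hθ0.le
      (fun z => (hbd i _ (by linarith [hZ s hs]) _ hxa z z).1)
      (hbd i _ hXX x (by linarith) y y).1 ha
      (fun z hz => h1 x y hx hy _ _ _ (by linarith) (by linarith) (by linarith [hZ s hs])) hs
  -- the variation in `m`, for each coordinate
  have hmm := (hD.integrable_second i x X).2.2
  have hmmy : Integrable (fun y' => DmmOp DmmW i x (law X) y y') (law X).meas :=
    .of_bound ((hD.continuous_mm i x _).comp
      (by fun_prop : Continuous fun y' : E d => (y, y'))).aestronglyMeasurable C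
      (ae_of_all _ fun y' => (hbd i _ hXX x (by linarith) y y').2.2.1)
  have pm : ∀ j, |(DmW i (x + a) (law (X + s • h)) y - DmW i (x + a) (law X) y
      - s • (∫ y', DmmOp DmmW i x (law X) y y' ∂(law X).meas) a) j|
      ≤ θ * ‖a‖ + (θ + 5 * C) * ‖h - cst P a‖ := by
    intro j
    have hcj : Continuous fun y' => DmmW i j x (law X) y y' :=
      (hD.cont_mm i j).comp (by fun_prop : Continuous fun y' : E d => (x, law X, y, y'))
    have := abs_lift_sub_le (fun m => hD.deriv_mm i j (x + a) m y) X h (a := a)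
      (g₀ := fun y' => DmmW i j x (law X) y y') (C := C) (η := θ) (δ := δ)
      (hcj.comp_aestronglyMeasurable (Lp.aestronglyMeasurable X)) hθ0.le
      (fun t ht y' => (hbd i _ (by linarith [hZ t ht]) _ hxa y y').2.2.2 j)
      (ae_of_all _ fun ω => (hbd i _ hXX x (by linarith) y _).2.2.2 j) ha
      (by
        filter_upwards [hX] with ω hω t ht y' hy'
        refine h3 j x (y, X ω) hx (by simp [Prod.norm_def, hy, hω]) _ (y, y') _
          (by linarith [h4 j]) ?_ (by linarith [hZ t ht, h4 j])
        simp only [Prod.mk_sub_mk, sub_self, Prod.norm_def, norm_zero]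
        exact max_lt (hδ₃ j) (by linarith [h4 j])) hs
    have hval : ((∫ y', DmmOp DmmW i x (law X) y y' ∂(law X).meas) a) j
        = ∫ ω, ⟪DmmW i j x (law X) y (X ω), a⟫_ℝ ∂P := by
      rw [ContinuousLinearMap.integral_apply hmmy]
      have h5 := (EuclideanSpace.proj (𝕜 := ℝ) j).integral_comp_comm
        (hmmy.apply_continuousLinearMap a)
      change (EuclideanSpace.proj (𝕜 := ℝ) j) _ = _
      have h6 : ∀ y', EuclideanSpace.proj (𝕜 := ℝ) j (DmmOp DmmW i x (law X) y y' a)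
          = ⟪DmmW i j x (law X) y y', a⟫_ℝ := fun y' => DmmOp_apply i x (law X) y y' a j
      rw [← h5, law_meas, integral_map (aemeasurable_coe X)]
      · simp only [h6]
      · refine Continuous.aestronglyMeasurable ?_
        simp only [h6]
        fun_prop
    rw [PiLp.sub_apply, PiLp.sub_apply, PiLp.smul_apply, hval]
    exact this
  have pm' : ‖DmW i (x + a) (law (X + s • h)) y - DmW i (x + a) (law X) y
      - s • (∫ y', DmmOp DmmW i x (law X) y y' ∂(law X).meas) a‖
      ≤ d * (θ * ‖a‖ + (θ + 5 * C) * ‖h - cst P a‖) := by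
    set v := DmW i (x + a) (law (X + s • h)) y - DmW i (x + a) (law X) y
      - s • (∫ y', DmmOp DmmW i x (law X) y y' ∂(law X).meas) a
    rw [← sum_smul_e v]
    refine (norm_sum_le _ _).trans ?_
    refine (Finset.sum_le_card_nsmul _ _ (θ * ‖a‖ + (θ + 5 * C) * ‖h - cst P a‖)
      fun j _ => ?_).trans (by simp [mul_add])
    rw [norm_smul]
    simpa [e] using pm j
  have hsplit : DmW i (x + a) (law (X + s • h)) (y + s • k) - DmW i x (law X) y
        - (DxmW i x (law X) y a + s • (DymW i x (law X) y a
          + (∫ y', DmmOp DmmW i x (law X) y y' ∂(law X).meas) a))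
      = (DmW i (x + a) (law (X + s • h)) (y + s • k) - DmW i (x + a) (law (X + s • h)) y
      - s • DymW i x (law X) y a) + (DmW i (x + a) (law (X + s • h)) y - DmW i (x + a) (law X) y
      - s • (∫ y', DmmOp DmmW i x (law X) y y' ∂(law X).meas) a)
      + (DmW i (x + a) (law X) y - DmW i x (law X) y - DxmW i x (law X) y a) := by
    rw [smul_add]; abel
  rw [hsplit]
  refine (norm_add₃_le).trans ((add_le_add (add_le_add py pm') px).trans ?_)
  have hη' : η = (d + 2) * θ := by rw [hθ]; field_simp
  rw [hη']
  have n1 := norm_nonneg (k - a)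
  have n2 := norm_nonneg (h - cst P a)
  have n3 : 0 ≤ θ + 5 * C := by positivity
  have n4 : (0 : ℝ) ≤ d := Nat.cast_nonneg d
  nlinarith [mul_nonneg n3 n1, mul_nonneg n3 n2, mul_nonneg n4 (mul_nonneg n3 n1)]

end HasContinuousDerivatives

end SecondOrder

/-! ### Second-order expansion of the field in the law -/

section SecondOrderLaw

variable {Ω : Type*} [MeasurableSpace Ω] {P : Measure Ω} [IsProbabilityMeasure P] {d : ℕ}
  {W : E d → P2 d → E d} {DxW : E d → P2 d → E d →L[ℝ] E d}
  {DmW : Fin d → E d → P2 d → E d → E d} {DymW DxmW : Fin d → E d → P2 d → E d → E d →L[ℝ] E d}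
  {DmmW : Fin d → Fin d → E d → P2 d → E d → E d → E d}

/-- A quadratic function of `‖h‖` is integrated by means of the `L²`-norm of `h`. -/
lemma abs_integral_le_quadratic {f : Ω → ℝ} {A B C : ℝ} (hB : 0 ≤ B) (h : L2 d P)
    (hf : ∀ᵐ ω ∂P, |f ω| ≤ A + B * ‖h ω‖ + C * ‖h ω‖ ^ 2) :
    |∫ ω, f ω ∂P| ≤ A + B * ‖h‖ + C * ‖h‖ ^ 2 := by
  have i1 : Integrable (fun ω => B * ‖h ω‖) P := (integrable_norm_coe h).const_mul B
  have i2 : Integrable (fun ω => C * ‖h ω‖ ^ 2) P := (integrable_norm_sq_coe h).const_mul C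
  have i3 : Integrable (fun ω => A + B * ‖h ω‖) P := (integrable_const A).add i1
  have i4 : Integrable (fun ω => A + B * ‖h ω‖ + C * ‖h ω‖ ^ 2) P := i3.add i2
  refine (norm_integral_le_of_norm_le (f := f) i4 hf).trans ?_
  rw [integral_add i3 i2, integral_add (integrable_const A) i1, integral_const_mul,
    integral_const_mul, ← norm_sq_eq_integral]
  have := integral_norm_le_norm h
  simp only [integral_const, probReal_univ, smul_eq_mul, one_mul]
  gcongr

namespace HasContinuousDerivatives

/-- Second-order expansion of `h ↦ W_i(x + a, ℒ(X + h))` at `h = 0`, uniformly for `x` in a ball.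
The remainder is of second order with a small constant only along the constants `a`; in the
directions `h - a` it is merely quadratic, because the lift of a function of the law need not be
twice differentiable in `L²`. -/
lemma W_expansion (hD : HasContinuousDerivatives P W DxW DmW DymW DxmW DmmW) (i : Fin d)
    (X : L2 d P) {R : ℝ} (hX : ∀ᵐ ω ∂P, ‖X ω‖ ≤ R) {η : ℝ} (hη : 0 < η) :
    ∃ C, 0 ≤ C ∧ ∃ δ > 0, ∀ (h : L2 d P) (a : E d), ‖h‖ < δ → ‖a‖ < δ → ∀ x, ‖x‖ ≤ R →
      |W (x + a) (law (X + h)) i - W (x + a) (law X) i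
        - ∫ ω, ⟪DmW i x (law X) (X ω), h ω⟫_ℝ ∂P
        - (1 / 2) * ⟪secondOp DymW DxmW DmmW i x (law X) a, a⟫_ℝ|
        ≤ η * ‖a‖ ^ 2 + C * ‖h - cst P a‖ ^ 2 := by
  obtain ⟨C₃, hC₃, δ₁, hδ₁, hbd⟩ := hD.exists_bound_DmmOp X R
  set θ := η / 2 with hθ
  have hθ0 : 0 < θ := by positivity
  obtain ⟨C, hC, δ, hδ, hexp⟩ := hD.DmW_expansion i X hX hθ0
  set c := θ + 2 * C + 3 * C₃ with hc
  refine ⟨c ^ 2 / (4 * θ) + 2 * C, by positivity, δ, hδ, fun h a hh ha x hx => ?_⟩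
  have hXX : ‖X - X‖ < δ₁ := by simpa using hδ₁
  have hb := fun y y' => hbd i X hXX x hx y y'
  obtain ⟨hi1, hi2, hi3⟩ := hD.integrable_second i x X
  set m := law X with hm
  let L1 : E d → E d →L[ℝ] E d := fun y => DymW i x m y + ∫ y', DmmOp DmmW i x m y y' ∂m.meas
  have hL1 : Integrable L1 m.meas := hi1.add hi3.integral_prod_left
  have hL1b : ∀ y, ‖L1 y‖ ≤ 2 * C₃ := fun y => by
    have h1 := norm_integral_le_of_norm_le_const (μ := m.meas)
      (f := fun y' => DmmOp DmmW i x m y y') (C := C₃) (ae_of_all _ fun y' => (hb y y').2.2.1)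
    simp only [probReal_univ, mul_one] at h1
    exact (norm_add_le _ _).trans (by linarith [(hb y y).1])
  have hint : ∀ f : E d → E d →L[ℝ] E d, Integrable f m.meas →
      Integrable (fun ω => ⟪f (X ω) a, a⟫_ℝ) P ∧
      ∫ ω, ⟪f (X ω) a, a⟫_ℝ ∂P = ⟪(∫ y, f y ∂m.meas) a, a⟫_ℝ := by
    intro f hf
    have h1 : Integrable (fun y => ⟪f y a, a⟫_ℝ) m.meas :=
      (hf.apply_continuousLinearMap a).inner_const a
    have h2 := (integrable_map_measure h1.1 (aemeasurable_coe X)).1 h1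
    refine ⟨h2, ?_⟩
    rw [ContinuousLinearMap.integral_apply hf, real_inner_comm,
      ← integral_inner (hf.apply_continuousLinearMap a)]
    simp only [fun v : E d => real_inner_comm v a]
    exact (integral_map (aemeasurable_coe X) h1.1).symm
  obtain ⟨in1, en1⟩ := hint _ hi2
  obtain ⟨ip1, ep1⟩ := hint _ hL1
  have hsec : (1 / 2) * ⟪secondOp DymW DxmW DmmW i x m a, a⟫_ℝ
      = ∫ ω, ⟪DxmW i x m (X ω) a, a⟫_ℝ ∂P + (1 / 2) * ∫ ω, ⟪L1 (X ω) a, a⟫_ℝ ∂P := by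
    rw [en1, ep1, secondOp, integral_add hi1 hi3.integral_prod_left, integral_prod _ hi3]
    simp only [add_apply, smul_apply, inner_add_left, inner_smul_left]
    simp; ring
  have hpt : ∀ s ∈ Icc (0 : ℝ) 1, ∀ᵐ ω ∂P,
      |⟪DmW i (x + a) (law (X + s • h)) ((X + s • h : L2 d P) ω), h ω⟫_ℝ
        - ⟪DmW i x m (X ω), h ω⟫_ℝ - (⟪DxmW i x m (X ω) a, a⟫_ℝ + s * ⟪L1 (X ω) a, a⟫_ℝ)|
      ≤ (θ * ‖a‖ ^ 2 + C * ‖a‖ * ‖h - cst P a‖)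
        + ((θ + C + 3 * C₃) * ‖a‖ + C * ‖h - cst P a‖) * ‖(h - cst P a : L2 d P) ω‖
        + C * ‖(h - cst P a : L2 d P) ω‖ ^ 2 := by
    intro s hs
    filter_upwards [hX, Lp.coeFn_add X (s • h), Lp.coeFn_smul s h,
      Lp.coeFn_sub h (cst P a), coe_cst (P := P) a] with ω h1 h3 h4 h5 h6
    rw [h5, Pi.sub_apply, h6, h3, Pi.add_apply, h4, Pi.smul_apply]
    have hV := hexp h a hh ha x hx s hs (X ω) (h ω) h1
    set V := DmW i (x + a) (law (X + s • h)) (X ω + s • h ω)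
    set V₀ := DmW i x m (X ω)
    change ‖V - V₀ - (DxmW i x m (X ω) a + s • L1 (X ω) a)‖ ≤ _ at hV
    set l := DxmW i x m (X ω) a + s • L1 (X ω) a with hl
    set ρ := ‖h - cst P a‖
    have hlb : ‖l‖ ≤ 3 * C₃ * ‖a‖ := by
      have b1 := (DxmW i x m (X ω)).le_of_opNorm_le ((hb (X ω) (X ω)).2.1) a
      have b2 := (L1 (X ω)).le_of_opNorm_le (hL1b (X ω)) a
      have b3 : ‖s • L1 (X ω) a‖ ≤ ‖L1 (X ω) a‖ := by
        rw [norm_smul, Real.norm_of_nonneg hs.1]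
        exact mul_le_of_le_one_left (norm_nonneg _) hs.2
      exact (norm_add_le _ _).trans (by linarith)
    have hk : ‖h ω‖ ≤ ‖a‖ + ‖h ω - a‖ := by simpa using norm_add_le a (h ω - a)
    have hsplit : ⟪V, h ω⟫_ℝ - ⟪V₀, h ω⟫_ℝ
        - (⟪DxmW i x m (X ω) a, a⟫_ℝ + s * ⟪L1 (X ω) a, a⟫_ℝ)
        = ⟪V - V₀ - l, h ω⟫_ℝ + ⟪l, h ω - a⟫_ℝ := by
      have : ⟪l, a⟫_ℝ = ⟪DxmW i x m (X ω) a, a⟫_ℝ + s * ⟪L1 (X ω) a, a⟫_ℝ := by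
        rw [hl, inner_add_left, inner_smul_left]; simp
      rw [← this]
      simp only [inner_sub_left, inner_sub_right]; ring
    rw [hsplit]
    refine (abs_add_le _ _).trans ((add_le_add (abs_real_inner_le_norm _ _)
      (abs_real_inner_le_norm _ _)).trans ?_)
    have t1 := mul_le_mul hV hk (norm_nonneg _) ((norm_nonneg _).trans hV)
    have t2 := mul_le_mul_of_nonneg_right hlb (norm_nonneg (h ω - a))
    refine (add_le_add t1 t2).trans (le_of_eq ?_)
    ring
  have hm1 : ∀ s ∈ Icc (0 : ℝ) 1, |(∫ ω, ⟪DmW i (x + a) (law (X + s • h))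
      ((X + s • h : L2 d P) ω), h ω⟫_ℝ ∂P) - (∫ ω, ⟪DmW i x m (X ω), h ω⟫_ℝ ∂P)
        - (∫ ω, ⟪DxmW i x m (X ω) a, a⟫_ℝ ∂P + s * ∫ ω, ⟪L1 (X ω) a, a⟫_ℝ ∂P)|
      ≤ η * ‖a‖ ^ 2 + (c ^ 2 / (4 * θ) + 2 * C) * ‖h - cst P a‖ ^ 2 := by
    intro s hs
    have j1 := integrable_inner_lift (fun m => hD.deriv_m i (x + a) m) (X + s • h) h
    have j2 := integrable_inner_lift (fun m => hD.deriv_m i x m) X h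
    have j3 : Integrable (fun ω => s * ⟪L1 (X ω) a, a⟫_ℝ) P := ip1.const_mul s
    have j4 : Integrable (fun ω => ⟪DxmW i x m (X ω) a, a⟫_ℝ + s * ⟪L1 (X ω) a, a⟫_ℝ) P :=
      in1.add j3
    have j5 : Integrable (fun ω => ⟪DmW i (x + a) (law (X + s • h)) ((X + s • h : L2 d P) ω),
      h ω⟫_ℝ - ⟪DmW i x m (X ω), h ω⟫_ℝ) P := j1.sub j2
    rw [← integral_const_mul, ← integral_add in1 j3, ← integral_sub j1 j2, ← integral_sub j5 j4]
    refine (abs_integral_le_quadratic (by positivity) _ (hpt s hs)).trans ?_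
    set ρ := ‖h - cst P a‖
    have hy : c * ‖a‖ * ρ ≤ θ * ‖a‖ ^ 2 + c ^ 2 / (4 * θ) * ρ ^ 2 := by
      have : 0 ≤ (2 * θ * ‖a‖ - c * ρ) ^ 2 / (4 * θ) := by positivity
      have e : (2 * θ * ‖a‖ - c * ρ) ^ 2 / (4 * θ)
        = θ * ‖a‖ ^ 2 + c ^ 2 / (4 * θ) * ρ ^ 2 - c * ‖a‖ * ρ := by field_simp; ring
      linarith
    have hη2 : η = 2 * θ := by rw [hθ]; ring
    rw [hη2]
    rw [hc] at hy
    rw [hc]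
    nlinarith
  have hderiv : ∀ s ∈ Icc (0 : ℝ) 1, HasDerivWithinAt
      (fun s : ℝ => W (x + a) (law (X + s • h)) i - s * (∫ ω, ⟪DmW i x m (X ω), h ω⟫_ℝ ∂P)
        - (s * (∫ ω, ⟪DxmW i x m (X ω) a, a⟫_ℝ ∂P)
          + s ^ 2 / 2 * ∫ ω, ⟪L1 (X ω) a, a⟫_ℝ ∂P))
      ((∫ ω, ⟪DmW i (x + a) (law (X + s • h)) ((X + s • h : L2 d P) ω), h ω⟫_ℝ ∂P)
        - (∫ ω, ⟪DmW i x m (X ω), h ω⟫_ℝ ∂P)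
        - (∫ ω, ⟪DxmW i x m (X ω) a, a⟫_ℝ ∂P + s * ∫ ω, ⟪L1 (X ω) a, a⟫_ℝ ∂P))
      (Icc 0 1) s := by
    intro s _
    have h1 := hasDerivAt_lift (fun m => hD.deriv_m i (x + a) m) X h s
    have h2 := (hasDerivAt_id s).mul_const (∫ ω, ⟪DmW i x m (X ω), h ω⟫_ℝ ∂P)
    have h3 := (hasDerivAt_id s).mul_const (∫ ω, ⟪DxmW i x m (X ω) a, a⟫_ℝ ∂P)
    have h4 := (((hasDerivAt_id s).pow 2).div_const 2).mul_const (∫ ω, ⟪L1 (X ω) a, a⟫_ℝ ∂P)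
    have h5 := ((h1.sub h2).sub (h3.add h4)).hasDerivWithinAt (s := Icc 0 1)
    convert! h5 using 1
    simp
  have := norm_image_sub_le_of_norm_deriv_le_segment' hderiv
    (fun t ht => hm1 t (Ico_subset_Icc_self ht)) 1 (by simp)
  rw [hsec]
  simp only [one_smul, zero_smul, add_zero, one_mul, zero_mul, Real.norm_eq_abs, sub_zero,
    mul_one, one_pow, ne_eq, OfNat.ofNat_ne_zero, not_false_eq_true, zero_pow, zero_div] at this
  refine le_trans (le_of_eq ?_) this
  congr 1
  ring

end HasContinuousDerivatives

end SecondOrderLaw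

/-! ### Continuity and local bounds of the derivatives -/

section Continuity

variable {Ω : Type*} [MeasurableSpace Ω] {P : Measure Ω} [IsProbabilityMeasure P] {d : ℕ}
  {W : E d → P2 d → E d} {DxW : E d → P2 d → E d →L[ℝ] E d}
  {DmW : Fin d → E d → P2 d → E d → E d} {DymW DxmW : Fin d → E d → P2 d → E d → E d →L[ℝ] E d}
  {DmmW : Fin d → Fin d → E d → P2 d → E d → E d → E d}

/-- To prove the continuity of a function of `(x, X) ∈ ℝ^d × L²` it is enough to consider sequences
`X_n` that converge almost surely. -/
lemma continuousOn_of_tendsto_ae {G : Type*} [TopologicalSpace G] {F : E d × L2 d P → G}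
    {S : Set (L2 d P)}
    (hF : ∀ (xn : ℕ → E d) (Xn : ℕ → L2 d P) (x : E d) (X : L2 d P), (∀ n, Xn n ∈ S) → X ∈ S →
      Tendsto xn atTop (𝓝 x) → Tendsto Xn atTop (𝓝 X) →
      (∀ᵐ ω ∂P, Tendsto (fun n => Xn n ω) atTop (𝓝 (X ω))) →
      Tendsto (fun n => F (xn n, Xn n)) atTop (𝓝 (F (x, X)))) :
    ContinuousOn F (univ ×ˢ S) := by
  rintro ⟨x, X⟩ ⟨-, hX⟩
  refine tendsto_of_seq_tendsto fun u hu => ?_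
  rw [tendsto_nhdsWithin_iff] at hu
  obtain ⟨hu, huS⟩ := hu
  refine tendsto_of_subseq_tendsto fun ns hns => ?_
  obtain ⟨N, hN⟩ := eventually_atTop.1 (hns.eventually huS)
  have h1 : Tendsto (fun n => u (ns (n + N))) atTop (𝓝 (x, X)) :=
    hu.comp (hns.comp (tendsto_add_atTop_nat N))
  have h2 : Tendsto (fun n => (u (ns (n + N))).2) atTop (𝓝 X) :=
    (continuous_snd.tendsto _).comp h1
  have h3 : Tendsto (fun n => (u (ns (n + N))).1) atTop (𝓝 x) :=
    (continuous_fst.tendsto _).comp h1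
  obtain ⟨ms, hms, hae⟩ := (tendstoInMeasure_of_tendsto_Lp h2).exists_seq_tendsto_ae
  refine ⟨fun n => ms n + N, ?_⟩
  exact hF (fun n => (u (ns (ms n + N))).1) (fun n => (u (ns (ms n + N))).2) x X
    (fun n => (hN (ms n + N) (Nat.le_add_left _ _)).2) hX (h3.comp hms.tendsto_atTop)
    (h2.comp hms.tendsto_atTop) hae

namespace HasContinuousDerivatives

lemma continuous_secondOp (hD : HasContinuousDerivatives P W DxW DmW DymW DxmW DmmW) (i : Fin d) :
    Continuous fun p : E d × L2 d P => secondOp DymW DxmW DmmW i p.1 (law p.2) := by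
  rw [← continuousOn_univ, ← univ_prod_univ]
  refine continuousOn_of_tendsto_ae fun xn Xn x X _ _ hx hX hae => ?_
  obtain ⟨C, -, δ, hδ, hbd⟩ := hD.exists_bound_DmmOp X (‖x‖ + 1)
  have hlaw : Tendsto (fun n => law (Xn n)) atTop (𝓝 (law X)) := (continuous_law.tendsto X).comp hX
  have hev : ∀ᶠ n in atTop, ∀ y y', ‖DymW i (xn n) (law (Xn n)) y‖ ≤ C ∧
      ‖DxmW i (xn n) (law (Xn n)) y‖ ≤ C ∧ ‖DmmOp DmmW i (xn n) (law (Xn n)) y y'‖ ≤ C := by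
    have e1 : ∀ᶠ n in atTop, ‖Xn n - X‖ < δ := by
      have := Metric.tendsto_nhds.1 hX δ hδ
      simpa only [dist_eq_norm] using this
    have e2 : ∀ᶠ n in atTop, ‖xn n‖ ≤ ‖x‖ + 1 := by
      have := (continuous_norm.tendsto x).comp hx
      exact this.eventually (eventually_le_nhds (by linarith))
    filter_upwards [e1, e2] with n h1 h2 y y'
    have := hbd i (Xn n) h1 (xn n) h2 y y'
    exact ⟨this.1, this.2.1, this.2.2.1⟩
  have single : ∀ f : E d → P2 d → E d → E d →L[ℝ] E d,
      Continuous (fun q : E d × P2 d × E d => f q.1 q.2.1 q.2.2) →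
      (∀ᶠ n in atTop, ∀ y, ‖f (xn n) (law (Xn n)) y‖ ≤ C) →
      Tendsto (fun n => ∫ y, f (xn n) (law (Xn n)) y ∂(law (Xn n)).meas) atTop
        (𝓝 (∫ y, f x (law X) y ∂(law X).meas)) := by
    intro f hf hb
    have hc : ∀ x m, Continuous (f x m) := fun x m =>
      hf.comp (by fun_prop : Continuous fun y : E d => (x, m, y))
    simp only [law_meas, integral_map (aemeasurable_coe _) (hc _ _).aestronglyMeasurable]
    refine tendsto_integral_filter_of_dominated_convergence (fun _ => C)
      (Eventually.of_forall fun n => (hc _ _).comp_aestronglyMeasurable (Lp.aestronglyMeasurable _))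
      (hb.mono fun n hn => ae_of_all _ fun ω => hn _) (integrable_const _) ?_
    filter_upwards [hae] with ω hω
    exact (hf.tendsto (x, law X, X ω)).comp (hx.prodMk_nhds (hlaw.prodMk_nhds hω))
  have t1 := single _ (hD.cont_ym i) (hev.mono fun n h y => (h y y).1)
  have t2 := single _ (hD.cont_xm i) (hev.mono fun n h y => (h y y).2.1)
  have t3 : Tendsto (fun n => ∫ q, DmmOp DmmW i (xn n) (law (Xn n)) q.1 q.2
      ∂((law (Xn n)).meas.prod (law (Xn n)).meas)) atTop
      (𝓝 (∫ q, DmmOp DmmW i x (law X) q.1 q.2 ∂((law X).meas.prod (law X).meas))) := by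
    have hmap : ∀ Z : L2 d P, (law Z).meas.prod (law Z).meas
        = (P.prod P).map (Prod.map Z Z) := fun Z => by
      rw [law_meas, Measure.map_prod_map _ _ (Lp.stronglyMeasurable Z).measurable
        (Lp.stronglyMeasurable Z).measurable]
    have hmeas : ∀ Z : L2 d P, Measurable (Prod.map Z Z) := fun Z =>
      (Lp.stronglyMeasurable Z).measurable.prodMap (Lp.stronglyMeasurable Z).measurable
    simp only [hmap, integral_map (hmeas _).aemeasurable
      (hD.continuous_mm i _ _).aestronglyMeasurable]
    refine tendsto_integral_filter_of_dominated_convergence (fun _ => C)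
      (Eventually.of_forall fun n =>
        (hD.continuous_mm i _ _).comp_aestronglyMeasurable (hmeas _).aestronglyMeasurable)
      (hev.mono fun n hn => ae_of_all _ fun ω => (hn _ _).2.2) (integrable_const _) ?_
    filter_upwards [Measure.quasiMeasurePreserving_fst.ae hae,
      Measure.quasiMeasurePreserving_snd.ae hae] with q h1 h2
    have hq : Tendsto (fun n => (xn n, law (Xn n), Xn n q.1, Xn n q.2)) atTop
        (𝓝 (x, law X, X q.1, X q.2)) :=
      hx.prodMk_nhds (hlaw.prodMk_nhds (h1.prodMk_nhds h2))
    have hf := (hD.continuous_DmmOp i).tendsto (x, law X, X q.1, X q.2)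
    have := hf.comp hq
    simp only [Function.comp_def] at this
    simp only [Prod.map_fst, Prod.map_snd]
    exact this
  exact (t1.add (t2.const_smul (2 : ℝ))).add t3

lemma exists_bound_secondOp (hD : HasContinuousDerivatives P W DxW DmW DymW DxmW DmmW)
    (X : L2 d P) (R : ℝ) :
    ∃ C, 0 ≤ C ∧ ∀ i x, ‖x‖ ≤ R → ‖secondOp DymW DxmW DmmW i x (law X)‖ ≤ C := by
  have : ∀ i, ∃ C, ∀ x ∈ Metric.closedBall (0 : E d) R,
      ‖secondOp DymW DxmW DmmW i x (law X)‖ ≤ C := fun i =>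
    (isCompact_closedBall _ _).exists_bound_of_continuousOn
      ((hD.continuous_secondOp i).comp (by fun_prop : Continuous fun x : E d => (x, X))).continuousOn
  choose C hC using this
  refine ⟨∑ i, |C i|, by positivity, fun i x hx => (hC i x (by simpa using hx)).trans ?_⟩
  exact (le_abs_self _).trans (Finset.single_le_sum (f := fun i => |C i|)
    (fun _ _ => abs_nonneg _) (Finset.mem_univ i))

lemma exists_bound_DmW (hD : HasContinuousDerivatives P W DxW DmW DymW DxmW DmmW)
    (m : P2 d) (R : ℝ) :
    ∃ C, 0 ≤ C ∧ ∀ i x y, ‖x‖ ≤ R → ‖y‖ ≤ R → ‖DmW i x m y‖ ≤ C := by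
  have : ∀ i, ∃ C, ∀ q ∈ Metric.closedBall (0 : E d) R ×ˢ Metric.closedBall (0 : E d) R,
      ‖DmW i q.1 m q.2‖ ≤ C := fun i =>
    ((isCompact_closedBall _ _).prod (isCompact_closedBall _ _)).exists_bound_of_continuousOn
      ((hD.cont_m i).comp (by fun_prop : Continuous fun q : E d × E d => (q.1, m, q.2))).continuousOn
  choose C hC using this
  refine ⟨∑ i, |C i|, by positivity, fun i x y hx hy =>
    (hC i (x, y) ⟨by simpa using hx, by simpa using hy⟩).trans ?_⟩
  exact (le_abs_self _).trans (Finset.single_le_sum (f := fun i => |C i|)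
    (fun _ _ => abs_nonneg _) (Finset.mem_univ i))

lemma continuous_W (hD : HasContinuousDerivatives P W DxW DmW DymW DxmW DmmW) (m : P2 d) :
    Continuous fun x => W x m :=
  hD.cont_W.comp (by fun_prop : Continuous fun x : E d => (x, m))

lemma continuous_DxW (hD : HasContinuousDerivatives P W DxW DmW DymW DxmW DmmW) (m : P2 d) :
    Continuous fun x => DxW x m :=
  hD.cont_x.comp (by fun_prop : Continuous fun x : E d => (x, m))

/-- `D_x W` is bounded for `x` in a ball and `Z` close to a given `X`. -/
lemma exists_bound_DxW (hD : HasContinuousDerivatives P W DxW DmW DymW DxmW DmmW)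
    (X : L2 d P) (R : ℝ) :
    ∃ C, 0 ≤ C ∧ ∃ δ > 0, ∀ Z : L2 d P, ‖Z - X‖ < δ → ∀ x, ‖x‖ ≤ R → ‖DxW x (law Z)‖ ≤ C := by
  obtain ⟨C, hC⟩ := (isCompact_closedBall (0 : E d) R).exists_bound_of_continuousOn
    (hD.continuous_DxW (law X)).continuousOn
  obtain ⟨δ, hδ, h⟩ := exists_uniform_law (M := ℝ)
    (f := fun q : E d × P2 d × ℝ => DxW q.1 q.2.1)
    (hD.cont_x.comp (by fun_prop : Continuous fun q : E d × P2 d × ℝ => (q.1, q.2.1)))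
    X (max R 0) one_pos
  refine ⟨|C| + 1, by positivity, δ, hδ, fun Z hZ x hx => ?_⟩
  have h1 := h x 0 (hx.trans (le_max_left _ _)) (by simp) x 0 Z (by simpa) (by simpa) hZ
  have h2 := hC x (by simpa using hx)
  have h3 := norm_add_le (DxW x (law Z) - DxW x (law X)) (DxW x (law X))
  rw [sub_add_cancel] at h3
  have h4 := le_abs_self C
  dsimp only at h1
  linarith

lemma norm_le_sum_abs (v : E d) : ‖v‖ ≤ ∑ i, |v i| := by
  conv_lhs => rw [← sum_smul_e v]
  refine (norm_sum_le _ _).trans (Finset.sum_le_sum fun j _ => ?_)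
  rw [norm_smul]
  simp [e]

/-- `(x, X) ↦ W(x, ℒ(X))` is Lipschitz continuous at `X`, uniformly for `x` in a ball. -/
lemma W_lipschitz (hD : HasContinuousDerivatives P W DxW DmW DymW DxmW DmmW)
    (X : L2 d P) {R : ℝ} (hX : ∀ᵐ ω ∂P, ‖X ω‖ ≤ R) :
    ∃ C, 0 ≤ C ∧ ∃ δ > 0, ∀ (h : L2 d P) (a : E d), ‖h‖ < δ → ‖a‖ < δ → ∀ x, ‖x‖ ≤ R →
      ‖W (x + a) (law (X + h)) - W x (law X)‖ ≤ C * (‖a‖ + ‖h - cst P a‖) := by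
  have h1 := fun i => hD.W_expansion i X hX one_pos
  choose C hC δ hδ hexp using h1
  obtain ⟨δ₁, hδ₁, hδ₁'⟩ : ∃ δ₁ > 0, ∀ i, δ₁ ≤ δ i := by
    rcases isEmpty_or_nonempty (Fin d) with hemp | hne
    · exact ⟨1, one_pos, fun j => hemp.elim j⟩
    · exact ⟨Finset.univ.inf' Finset.univ_nonempty δ, by simpa using hδ,
        fun j => Finset.inf'_le _ (Finset.mem_univ j)⟩
  obtain ⟨B₁, hB₁, hDm⟩ := hD.exists_bound_DmW (law X) R
  obtain ⟨B₂, hB₂, hsec⟩ := hD.exists_bound_secondOp X R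
  obtain ⟨B₃, hB₃, δ₃, hδ₃, hDx⟩ := hD.exists_bound_DxW X (R + 1)
  refine ⟨B₃ + ∑ i, (B₁ + B₂ + 1 + 2 * C i), add_nonneg hB₃ (Finset.sum_nonneg fun i _ => by
    linarith [hC i]), min δ₁ 1, by positivity, fun h a hh ha x hx => ?_⟩
  have ha1 : ‖a‖ < 1 := ha.trans_le (min_le_right _ _)
  have hh1 : ‖h‖ < 1 := hh.trans_le (min_le_right _ _)
  set ρ := ‖h - cst P a‖ with hρ
  have hρ0 : 0 ≤ ρ := norm_nonneg _
  have hρ2 : ρ ≤ 2 := (norm_sub_le _ _).trans (by rw [norm_cst]; linarith)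
  have hhρ : ‖h‖ ≤ ‖a‖ + ρ := by
    have := norm_add_le (cst P a) (h - cst P a)
    rwa [add_sub_cancel, norm_cst] at this
  have e1 : ‖W (x + a) (law X) - W x (law X)‖ ≤ B₃ * ‖a‖ := by
    have := (convex_closedBall (0 : E d) (R + 1)).norm_image_sub_le_of_norm_hasFDerivWithin_le
      (f := fun z => W z (law X)) (fun z _ => (hD.deriv_x z (law X)).hasFDerivWithinAt)
      (fun z hz => hDx X (by simpa using hδ₃) z (by simpa using hz)) (x := x) (y := x + a)
      (by simp; linarith) (by simpa using (norm_add_le _ _).trans (by linarith))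
    simpa using this
  have e2 : ∀ i, |(W (x + a) (law (X + h)) - W (x + a) (law X)) i|
      ≤ (B₁ + B₂ + 1 + 2 * C i) * (‖a‖ + ρ) := by
    intro i
    have h2 := hexp i h a (hh.trans_le ((min_le_left _ _).trans (hδ₁' i)))
      (ha.trans_le ((min_le_left _ _).trans (hδ₁' i))) x hx
    have h3 : |∫ ω, ⟪DmW i x (law X) (X ω), h ω⟫_ℝ ∂P| ≤ B₁ * ‖h‖ := by
      have := abs_integral_le_quadratic (f := fun ω => ⟪DmW i x (law X) (X ω), h ω⟫_ℝ)
        (A := 0) (B := B₁) (C := 0) hB₁ h (by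
          filter_upwards [hX] with ω hω
          have := (abs_real_inner_le_norm (DmW i x (law X) (X ω)) (h ω)).trans
            (mul_le_mul_of_nonneg_right (hDm i x (X ω) hx hω) (norm_nonneg _))
          linarith)
      linarith
    have h4 : |⟪secondOp DymW DxmW DmmW i x (law X) a, a⟫_ℝ| ≤ B₂ * ‖a‖ * ‖a‖ :=
      (abs_real_inner_le_norm _ _).trans (by gcongr; exact ContinuousLinearMap.le_of_opNorm_le _ (hsec i x hx) a)
    have h5 : B₂ * ‖a‖ * ‖a‖ ≤ B₂ * ‖a‖ := mul_le_of_le_one_right (by positivity) ha1.le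
    have h6 : C i * ρ ^ 2 ≤ 2 * C i * ρ := by nlinarith [mul_nonneg (hC i) hρ0]
    have h7 : B₁ * ‖h‖ ≤ B₁ * (‖a‖ + ρ) := by gcongr
    rw [PiLp.sub_apply]
    have h8 := norm_nonneg a
    have h9 := abs_le.1 h2
    have h10 := abs_le.1 h3
    have h11 := abs_le.1 h4
    have k1 := mul_nonneg hB₂ hρ0
    have k2 := mul_nonneg (hC i) h8
    have k3 := mul_nonneg hB₂ h8
    have k4 : ‖a‖ ^ 2 ≤ ‖a‖ := by nlinarith
    rw [abs_le]
    constructor <;> nlinarith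
  have e3 : ‖W (x + a) (law (X + h)) - W (x + a) (law X)‖
      ≤ (∑ i, (B₁ + B₂ + 1 + 2 * C i)) * (‖a‖ + ρ) := by
    refine (norm_le_sum_abs _).trans ?_
    rw [Finset.sum_mul]
    exact Finset.sum_le_sum fun i _ => e2 i
  have e4 := norm_add_le (W (x + a) (law (X + h)) - W (x + a) (law X))
    (W (x + a) (law X) - W x (law X))
  rw [sub_add_sub_cancel] at e4
  have e5 : 0 ≤ B₃ * ρ := by positivity
  nlinarith

end HasContinuousDerivatives

/-- Quadratic bound for the first-order remainder of a potential of a bounded field that is locally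
Lipschitz continuous. -/
lemma abs_potential_sub_le {U : E d → ℝ} {w : E d → E d} (hU : ∀ x, HasGradientAt U (w x) x)
    {x v : E d} {B C : ℝ} (hB : 0 ≤ B) (hx : ∀ z, ‖z - x‖ ≤ 1 → ‖w z - w x‖ ≤ B * ‖z - x‖)
    (hC : ∀ z, ‖w z‖ ≤ C) :
    |U (x + v) - U x - ⟪w x, v⟫_ℝ| ≤ (B + 2 * C) * ‖v‖ ^ 2 := by
  have hC0 : 0 ≤ C := (norm_nonneg _).trans (hC 0)
  have hd : ∀ t ∈ Icc (0 : ℝ) 1, HasDerivWithinAt (fun t : ℝ => U (x + t • v) - t * ⟪w x, v⟫_ℝ)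
      ⟪w (x + t • v) - w x, v⟫_ℝ (Icc 0 1) t := by
    intro t _
    have h1 : HasDerivAt (fun t : ℝ => x + t • v) v t := by
      simpa using ((hasDerivAt_id t).smul_const v).const_add x
    have h2 := (hU (x + t • v)).hasFDerivAt.comp_hasDerivAt t h1
    have h3 := (h2.sub ((hasDerivAt_id t).mul_const ⟪w x, v⟫_ℝ)).hasDerivWithinAt (s := Icc 0 1)
    convert! h3 using 1
    simp [inner_sub_left]
  have hb : ∀ t ∈ Ico (0 : ℝ) 1, ‖⟪w (x + t • v) - w x, v⟫_ℝ‖ ≤ (B + 2 * C) * ‖v‖ ^ 2 := by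
    intro t ht
    have htv : ‖t • v‖ ≤ ‖v‖ := by
      rw [norm_smul, Real.norm_of_nonneg ht.1]
      exact mul_le_of_le_one_left (norm_nonneg _) ht.2.le
    refine (norm_inner_le_norm _ _).trans ?_
    have hv0 := norm_nonneg v
    rcases le_total ‖v‖ 1 with hv | hv
    · have h1 := hx (x + t • v) (by rw [add_sub_cancel_left]; linarith)
      rw [add_sub_cancel_left] at h1
      have h2 : ‖w (x + t • v) - w x‖ * ‖v‖ ≤ (B * ‖v‖) * ‖v‖ := by
        gcongr; exact h1.trans (by gcongr)
      nlinarith [mul_nonneg hC0 (mul_nonneg hv0 hv0)]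
    · have h1 : ‖w (x + t • v) - w x‖ ≤ 2 * C := (norm_sub_le _ _).trans (by linarith [hC (x + t • v), hC x])
      have h2 : ‖w (x + t • v) - w x‖ * ‖v‖ ≤ (2 * C) * (‖v‖ * ‖v‖) := by
        gcongr; nlinarith
      nlinarith [mul_nonneg hB (mul_nonneg hv0 hv0)]
  have := norm_image_sub_le_of_norm_deriv_le_segment' hd hb 1 (by simp)
  simp only [one_smul, zero_smul, add_zero, one_mul, zero_mul, Real.norm_eq_abs, sub_zero,
    mul_one] at this
  rwa [sub_right_comm]

/-- Second-order expansion of a potential of a `C¹` field. -/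
lemma abs_potential_sub_sub_le {U : E d → ℝ} {w : E d → E d} {w' : E d → E d →L[ℝ] E d}
    (hU : ∀ x, HasGradientAt U (w x) x) (hw : ∀ x, HasFDerivAt w (w' x) x) {x a : E d} {η δ : ℝ}
    (hη : 0 ≤ η) (hx : ∀ z, ‖z - x‖ < δ → ‖w' z - w' x‖ ≤ η) (ha : ‖a‖ < δ) :
    |U (x + a) - U x - ⟪w x, a⟫_ℝ - (1 / 2) * ⟪w' x a, a⟫_ℝ| ≤ η * ‖a‖ ^ 2 := by
  have hd : ∀ t ∈ Icc (0 : ℝ) 1, HasDerivWithinAt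
      (fun t : ℝ => U (x + t • a) - t * ⟪w x, a⟫_ℝ - t ^ 2 / 2 * ⟪w' x a, a⟫_ℝ)
      ⟪w (x + t • a) - w x - w' x (t • a), a⟫_ℝ (Icc 0 1) t := by
    intro t _
    have h1 : HasDerivAt (fun t : ℝ => x + t • a) a t := by
      simpa using ((hasDerivAt_id t).smul_const a).const_add x
    have h2 := (hU (x + t • a)).hasFDerivAt.comp_hasDerivAt t h1
    have h4 := (((hasDerivAt_id t).pow 2).div_const 2).mul_const ⟪w' x a, a⟫_ℝ
    have h3 := ((h2.sub ((hasDerivAt_id t).mul_const ⟪w x, a⟫_ℝ)).sub h4).hasDerivWithinAt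
      (s := Icc 0 1)
    convert! h3 using 1
    simp [inner_sub_left, inner_smul_left]
  have hb : ∀ t ∈ Ico (0 : ℝ) 1, ‖⟪w (x + t • a) - w x - w' x (t • a), a⟫_ℝ‖ ≤ η * ‖a‖ ^ 2 := by
    intro t ht
    have hta : ‖t • a‖ ≤ ‖a‖ := by
      rw [norm_smul, Real.norm_of_nonneg ht.1]
      exact mul_le_of_le_one_left (norm_nonneg _) ht.2.le
    have h1 := (convex_ball x δ).norm_image_sub_le_of_norm_hasFDerivWithin_le'
      (fun z _ => (hw z).hasFDerivWithinAt)
      (fun z hz => hx z (mem_ball_iff_norm.1 hz))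
      (Metric.mem_ball_self ((norm_nonneg a).trans_lt ha))
      (show x + t • a ∈ Metric.ball x δ by
        rw [mem_ball_iff_norm, add_sub_cancel_left]; exact hta.trans_lt ha)
    rw [add_sub_cancel_left] at h1
    refine (norm_inner_le_norm _ _).trans ?_
    calc _ ≤ (η * ‖a‖) * ‖a‖ := by gcongr; exact h1.trans (by gcongr)
      _ = η * ‖a‖ ^ 2 := by ring
  have := norm_image_sub_le_of_norm_deriv_le_segment' hd hb 1 (by simp)
  simp only [one_smul, zero_smul, add_zero, one_mul, zero_mul, Real.norm_eq_abs, sub_zero,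
    mul_one, one_pow, ne_eq, OfNat.ofNat_ne_zero, not_false_eq_true, zero_pow, zero_div] at this
  refine le_trans (le_of_eq ?_) this
  congr 1
  ring

end Continuity

/-! ### Integrals over random segments -/

section Segment

variable {Ω : Type*} [MeasurableSpace Ω] {P : Measure Ω} [IsProbabilityMeasure P] {d : ℕ}
  {W : E d → P2 d → E d} {DxW : E d → P2 d → E d →L[ℝ] E d}
  {DmW : Fin d → E d → P2 d → E d → E d} {DymW DxmW : Fin d → E d → P2 d → E d → E d →L[ℝ] E d}
  {DmmW : Fin d → Fin d → E d → P2 d → E d → E d → E d}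

/-- The product of `P` and of the Lebesgue measure on `(0, 1]`. -/
noncomputable def segMeas (P : Measure Ω) : Measure (Ω × ℝ) :=
  P.prod (volume.restrict (Ioc (0 : ℝ) 1))

/-- The point `(1 - t) X + t Y` of the random segment from `X` to `Y`. -/
noncomputable def seg (X Y : L2 d P) (q : Ω × ℝ) : E d := (1 - q.2) • X q.1 + q.2 • Y q.1

instance : IsProbabilityMeasure (volume.restrict (Ioc (0 : ℝ) 1)) := ⟨by simp⟩

instance : IsProbabilityMeasure (segMeas P) := by unfold segMeas; infer_instance

lemma measurable_coe (X : L2 d P) : Measurable X := (Lp.stronglyMeasurable X).measurable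

lemma measurable_seg (X Y : L2 d P) : Measurable (seg X Y) := by
  have h1 : Measurable fun q : Ω × ℝ => X q.1 := (measurable_coe X).comp measurable_fst
  have h2 : Measurable fun q : Ω × ℝ => Y q.1 := (measurable_coe Y).comp measurable_fst
  exact ((measurable_const.sub measurable_snd).smul h1).add (measurable_snd.smul h2)

lemma ae_segMeas_bound {X Y : L2 d P} {R : ℝ} (hX : ∀ᵐ ω ∂P, ‖X ω‖ ≤ R)
    (hY : ∀ᵐ ω ∂P, ‖Y ω‖ ≤ R) :
    ∀ᵐ q ∂segMeas P, ‖seg X Y q‖ ≤ R ∧ ∀ i, |(X q.1 - Y q.1) i| ≤ 2 * R := by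
  filter_upwards [Measure.quasiMeasurePreserving_fst.ae hX,
    Measure.quasiMeasurePreserving_fst.ae hY,
    Measure.quasiMeasurePreserving_snd.ae (ae_restrict_mem measurableSet_Ioc)] with q h1 h2 h3
  constructor
  · have := (convex_closedBall (0 : E d) R) (by simpa using h1) (by simpa using h2)
      (sub_nonneg.2 h3.2) h3.1.le (by ring)
    simpa [seg] using this
  · intro i
    have := PiLp.norm_apply_le (X q.1 - Y q.1) i
    rw [Real.norm_eq_abs] at this
    exact this.trans ((norm_sub_le _ _).trans (by linarith))

/-- `y ↦ 𝔼[∫₀¹ ∑_i (X - Y)_i D_m W_i((1 - t) X + t Y, m, y) dt]`: evaluated at `X`, it is the part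
of the gradient of `Ŵ` with respect to `X` that comes from the law of `X`. -/
noncomputable def crossGrad (DmW : Fin d → E d → P2 d → E d → E d) (X Y : L2 d P) (m : P2 d)
    (y : E d) : E d :=
  ∫ q, ∑ i, (X q.1 - Y q.1) i • DmW i (seg X Y q) m y ∂segMeas P

/-- `𝔼[∫₀¹ ∑_i (X - Y)_i S_i((1 - t) X + t Y) dt]` where `S_i` is `secondOp`: the part of the
second derivative of `a ↦ Ŵ(X + a, Y + a)` that comes from the law of `X`. -/
noncomputable def segHess (DymW DxmW : Fin d → E d → P2 d → E d → E d →L[ℝ] E d)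
    (DmmW : Fin d → Fin d → E d → P2 d → E d → E d → E d) (X Y : L2 d P) (m : P2 d) :
    E d →L[ℝ] E d :=
  ∫ q, ∑ i, (X q.1 - Y q.1) i • secondOp DymW DxmW DmmW i (seg X Y q) m ∂segMeas P

lemma measurable_sub_apply (X Y : L2 d P) (i : Fin d) :
    Measurable fun q : Ω × ℝ => (X q.1 - Y q.1) i := by
  have h1 : Measurable fun q : Ω × ℝ => X q.1 := (measurable_coe X).comp measurable_fst
  have h2 : Measurable fun q : Ω × ℝ => Y q.1 := (measurable_coe Y).comp measurable_fst
  exact (EuclideanSpace.proj (𝕜 := ℝ) i).continuous.measurable.comp (h1.sub h2)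

lemma real_inner_eq_sum (v w : E d) : ⟪v, w⟫_ℝ = ∑ i, w i * v i := by
  conv_lhs => rw [← sum_smul_e w]
  simp only [inner_sum, inner_smul_right, inner_e]

lemma integral_sum_smul_clm {α ι V : Type*} [Fintype ι] [MeasurableSpace α] {μ : Measure α}
    [NormedAddCommGroup V] [NormedSpace ℝ V] [CompleteSpace V] {c : ι → α → ℝ} {A : ι → α → V}
    (hA : ∀ i, Integrable (fun q => c i q • A i q) μ) (l : V →L[ℝ] ℝ) :
    Integrable (fun q => ∑ i, c i q * l (A i q)) μ ∧
      l (∫ q, ∑ i, c i q • A i q ∂μ) = ∫ q, ∑ i, c i q * l (A i q) ∂μ := by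
  have hs : Integrable (fun q => ∑ i, c i q • A i q) μ := integrable_finsetSum _ fun i _ => hA i
  have hl : ∀ q, l (∑ i, c i q • A i q) = ∑ i, c i q * l (A i q) := fun q => by simp
  refine ⟨(l.integrable_comp hs).congr (ae_of_all _ hl), ?_⟩
  rw [← l.integral_comp_comm hs]
  exact integral_congr_ae (ae_of_all _ hl)

/-- The linear form `A ↦ ⟪A a, a⟫` on operators. -/
noncomputable def quadL (a : E d) : (E d →L[ℝ] E d) →L[ℝ] ℝ :=
  (innerSL ℝ a).comp (ContinuousLinearMap.apply ℝ (E d) a)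

lemma quadL_apply (a : E d) (A : E d →L[ℝ] E d) : quadL a A = ⟪A a, a⟫_ℝ := by
  simp [quadL, real_inner_comm]

namespace HasContinuousDerivatives

lemma continuous_secondOp_left (hD : HasContinuousDerivatives P W DxW DmW DymW DxmW DmmW)
    (i : Fin d) (Z : L2 d P) : Continuous fun x => secondOp DymW DxmW DmmW i x (law Z) := by
  have h := (hD.continuous_secondOp i).comp (by fun_prop : Continuous fun x : E d => (x, Z))
  simpa only [Function.comp_def] using h

lemma integrable_segHess (hD : HasContinuousDerivatives P W DxW DmW DymW DxmW DmmW)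
    (Z : L2 d P) {X Y : L2 d P} {R : ℝ} (hX : ∀ᵐ ω ∂P, ‖X ω‖ ≤ R) (hY : ∀ᵐ ω ∂P, ‖Y ω‖ ≤ R)
    (i : Fin d) :
    Integrable (fun q => (X q.1 - Y q.1) i • secondOp DymW DxmW DmmW i (seg X Y q) (law Z))
      (segMeas P) := by
  obtain ⟨C, hC, hb⟩ := hD.exists_bound_secondOp Z R
  have hc := hD.continuous_secondOp_left i Z
  have hm : AEStronglyMeasurable
      (fun q => secondOp DymW DxmW DmmW i (seg X Y q) (law Z)) (segMeas P) :=
    hc.comp_aestronglyMeasurable (measurable_seg X Y).aestronglyMeasurable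
  have hm' := (measurable_sub_apply X Y i).aestronglyMeasurable (μ := segMeas P)
  refine Integrable.of_bound (hm'.smul hm) (2 * R * C) ?_
  filter_upwards [ae_segMeas_bound hX hY] with q hq
  rw [norm_smul]
  exact mul_le_mul (hq.2 i) (hb i _ hq.1) (norm_nonneg _) ((abs_nonneg _).trans (hq.2 i))

lemma aestronglyMeasurable_crossGrad_integrand
    (hD : HasContinuousDerivatives P W DxW DmW DymW DxmW DmmW)
    (m : P2 d) (X Y Z : L2 d P) (i : Fin d) :
    AEStronglyMeasurable (fun p : (Ω × ℝ) × Ω => (X p.1.1 - Y p.1.1) i •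
      DmW i (seg X Y p.1) m (Z p.2)) ((segMeas P).prod P) := by
  have h1 : Continuous fun p : E d × E d => DmW i p.1 m p.2 :=
    (hD.cont_m i).comp (by fun_prop : Continuous fun q : E d × E d => (q.1, m, q.2))
  have h2 : Measurable fun p : (Ω × ℝ) × Ω => (seg X Y p.1, Z p.2) :=
    ((measurable_seg X Y).comp measurable_fst).prodMk ((measurable_coe Z).comp measurable_snd)
  exact (((measurable_sub_apply X Y i).comp measurable_fst).smul
    (h1.measurable.comp h2)).aestronglyMeasurable

/-- Fubini's theorem for the pairing of `crossGrad` with a random variable. -/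
lemma integral_inner_crossGrad (hD : HasContinuousDerivatives P W DxW DmW DymW DxmW DmmW)
    (m : P2 d) {X Y : L2 d P} {R : ℝ} (hX : ∀ᵐ ω ∂P, ‖X ω‖ ≤ R) (hY : ∀ᵐ ω ∂P, ‖Y ω‖ ≤ R)
    {h : Ω → E d} (hh : Integrable h P) :
    Integrable (fun q => ∑ i, (X q.1 - Y q.1) i *
        ∫ ω, ⟪DmW i (seg X Y q) m (X ω), h ω⟫_ℝ ∂P) (segMeas P) ∧
    ∫ ω, ⟪crossGrad DmW X Y m (X ω), h ω⟫_ℝ ∂P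
      = ∫ q, ∑ i, (X q.1 - Y q.1) i * ∫ ω, ⟪DmW i (seg X Y q) m (X ω), h ω⟫_ℝ ∂P ∂segMeas P := by
  obtain ⟨B, hB, hb⟩ := hD.exists_bound_DmW m R
  have hint : ∀ i, Integrable (fun p : (Ω × ℝ) × Ω =>
      (X p.1.1 - Y p.1.1) i * ⟪DmW i (seg X Y p.1) m (X p.2), h p.2⟫_ℝ) ((segMeas P).prod P) := by
    intro i
    have hm := (hD.aestronglyMeasurable_crossGrad_integrand m X Y X i).inner (𝕜 := ℝ)
      (hh.1.comp_snd (μ := segMeas P))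
    simp only [inner_smul_left] at hm
    refine Integrable.mono' ((hh.norm.comp_snd (segMeas P)).const_mul (2 * R * B)) hm ?_
    filter_upwards [Measure.quasiMeasurePreserving_fst.ae (ae_segMeas_bound hX hY),
      Measure.quasiMeasurePreserving_snd.ae hX] with p h1 h2
    rw [norm_mul, mul_assoc]
    refine mul_le_mul (h1.2 i) ((norm_inner_le_norm _ _).trans ?_) (norm_nonneg _)
      ((abs_nonneg _).trans (h1.2 i))
    exact mul_le_mul_of_nonneg_right (hb i _ _ h1.1 h2) (norm_nonneg _)
  have hsum := integrable_finsetSum Finset.univ fun i _ => hint i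
  have hfst : ∀ᵐ q ∂segMeas P, ∑ i, (X q.1 - Y q.1) i * ∫ ω, ⟪DmW i (seg X Y q) m (X ω), h ω⟫_ℝ ∂P
      = ∫ ω, ∑ i, (X q.1 - Y q.1) i * ⟪DmW i (seg X Y q) m (X ω), h ω⟫_ℝ ∂P := by
    filter_upwards [eventually_all.2 fun i => (hint i).prod_right_ae] with q hq
    rw [integral_finsetSum _ fun i _ => hq i]
    exact Finset.sum_congr rfl fun i _ => (integral_const_mul _ _).symm
  refine ⟨(hsum.integral_prod_left).congr (hfst.mono fun q hq => hq.symm), ?_⟩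
  rw [integral_congr_ae hfst, integral_integral_swap hsum]
  refine integral_congr_ae ?_
  filter_upwards [hX] with ω hω
  have hi : Integrable (fun q => ∑ i, (X q.1 - Y q.1) i • DmW i (seg X Y q) m (X ω))
      (segMeas P) := by
    refine integrable_finsetSum _ fun i _ => ?_
    have hc : Continuous fun x => DmW i x m (X ω) :=
      (hD.cont_m i).comp (by fun_prop : Continuous fun x : E d => (x, m, X ω))
    refine .of_bound ((measurable_sub_apply X Y i).aestronglyMeasurable.smul
      (hc.comp_aestronglyMeasurable (measurable_seg X Y).aestronglyMeasurable)) (2 * R * B) ?_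
    filter_upwards [ae_segMeas_bound hX hY] with q hq
    rw [norm_smul]
    exact mul_le_mul (hq.2 i) (hb i _ _ hq.1 hω) (norm_nonneg _) ((abs_nonneg _).trans (hq.2 i))
  rw [crossGrad, real_inner_comm, ← integral_inner hi]
  refine integral_congr_ae (ae_of_all _ fun q => ?_)
  simp only [inner_sum, inner_smul_right, real_inner_comm]

/-- Version of `W_expansion` with the same constants for all the coordinates. -/
lemma W_expansion_all (hD : HasContinuousDerivatives P W DxW DmW DymW DxmW DmmW)
    (X : L2 d P) {R : ℝ} (hX : ∀ᵐ ω ∂P, ‖X ω‖ ≤ R) {η : ℝ} (hη : 0 < η) :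
    ∃ C, 0 ≤ C ∧ ∃ δ > 0, ∀ i (h : L2 d P) (a : E d), ‖h‖ < δ → ‖a‖ < δ → ∀ x, ‖x‖ ≤ R →
      |W (x + a) (law (X + h)) i - W (x + a) (law X) i
        - ∫ ω, ⟪DmW i x (law X) (X ω), h ω⟫_ℝ ∂P
        - (1 / 2) * ⟪secondOp DymW DxmW DmmW i x (law X) a, a⟫_ℝ|
        ≤ η * ‖a‖ ^ 2 + C * ‖h - cst P a‖ ^ 2 := by
  have h1 := fun i => hD.W_expansion i X hX hη
  choose C hC δ hδ hexp using h1
  obtain ⟨δ₁, hδ₁, hδ₁'⟩ : ∃ δ₁ > 0, ∀ i, δ₁ ≤ δ i := by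
    rcases isEmpty_or_nonempty (Fin d) with hemp | hne
    · exact ⟨1, one_pos, fun j => hemp.elim j⟩
    · exact ⟨Finset.univ.inf' Finset.univ_nonempty δ, by simpa using hδ,
        fun j => Finset.inf'_le _ (Finset.mem_univ j)⟩
  refine ⟨∑ i, C i, Finset.sum_nonneg fun i _ => hC i, δ₁, hδ₁, fun i h a hh ha x hx => ?_⟩
  refine (hexp i h a (hh.trans_le (hδ₁' i)) (ha.trans_le (hδ₁' i)) x hx).trans ?_
  gcongr
  exact Finset.single_le_sum (fun i _ => hC i) (Finset.mem_univ i)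

/-- Second-order expansion of the part of `Ŵ` that depends on the law of `X`. -/
lemma seg_expansion (hD : HasContinuousDerivatives P W DxW DmW DymW DxmW DmmW)
    {X Y : L2 d P} {R : ℝ} (hX : ∀ᵐ ω ∂P, ‖X ω‖ ≤ R) (hY : ∀ᵐ ω ∂P, ‖Y ω‖ ≤ R) {η : ℝ}
    (hη : 0 < η) :
    ∃ C, 0 ≤ C ∧ ∃ δ > 0, ∀ (h : L2 d P) (a : E d), ‖h‖ < δ → ‖a‖ < δ →
      |∫ q, ⟪W (seg X Y q + a) (law (X + h)) - W (seg X Y q + a) (law X), X q.1 - Y q.1⟫_ℝ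
          ∂segMeas P - ∫ ω, ⟪crossGrad DmW X Y (law X) (X ω), h ω⟫_ℝ ∂P
        - (1 / 2) * ⟪segHess DymW DxmW DmmW X Y (law X) a, a⟫_ℝ|
        ≤ η * ‖a‖ ^ 2 + C * ‖h - cst P a‖ ^ 2 := by
  have hR : 0 ≤ R := by
    obtain ⟨ω, hω⟩ := hX.exists
    exact (norm_nonneg _).trans hω
  set θ := η / (d * (2 * R) + 1) with hθ
  have hθ0 : 0 < θ := by positivity
  obtain ⟨C, hC, δ, hδ, hexp⟩ := hD.W_expansion_all X hX hθ0
  refine ⟨d * (2 * R) * C, by positivity, δ, hδ, fun h a hh ha => ?_⟩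
  obtain ⟨i1, e1⟩ := hD.integral_inner_crossGrad (law X) hX hY (integrable_coe h)
  obtain ⟨i3, e2⟩ := integral_sum_smul_clm (fun i => hD.integrable_segHess X hX hY i) (quadL a)
  simp only [quadL_apply] at i3 e2
  rw [← segHess] at e2
  have i4 : Integrable (fun q => ⟪W (seg X Y q + a) (law (X + h)) - W (seg X Y q + a) (law X),
      X q.1 - Y q.1⟫_ℝ) (segMeas P) := by
    have hc : Continuous fun x => W (x + a) (law (X + h)) - W (x + a) (law X) :=
      ((hD.continuous_W _).comp (continuous_add_const a)).sub
        ((hD.continuous_W _).comp (continuous_add_const a))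
    obtain ⟨B, hB⟩ := (isCompact_closedBall (0 : E d) R).exists_bound_of_continuousOn hc.continuousOn
    have hm : Measurable fun q : Ω × ℝ => X q.1 - Y q.1 :=
      ((measurable_coe X).comp measurable_fst).sub ((measurable_coe Y).comp measurable_fst)
    refine .of_bound (((hc.measurable.comp (measurable_seg X Y)).inner hm).aestronglyMeasurable)
      (B * (2 * R)) ?_
    filter_upwards [ae_segMeas_bound hX hY, Measure.quasiMeasurePreserving_fst.ae hX,
      Measure.quasiMeasurePreserving_fst.ae hY] with q hq h1 h2
    have hB' := hB (seg X Y q) (by simpa using hq.1)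
    exact (norm_inner_le_norm _ _).trans (mul_le_mul hB' ((norm_sub_le _ _).trans (by linarith))
      (norm_nonneg _) ((norm_nonneg _).trans hB'))
  have i5 := i4.sub i1
  simp only [Pi.sub_def] at i5
  rw [e1, e2, ← integral_const_mul, ← integral_sub i4 i1, ← integral_sub i5 (i3.const_mul _)]
  have hbound : ∀ᵐ q ∂segMeas P,
      ‖⟪W (seg X Y q + a) (law (X + h)) - W (seg X Y q + a) (law X), X q.1 - Y q.1⟫_ℝ
      - ∑ i, (X q.1 - Y q.1) i * ∫ ω, ⟪DmW i (seg X Y q) (law X) (X ω), h ω⟫_ℝ ∂P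
      - (1 / 2) * ∑ i, (X q.1 - Y q.1) i * ⟪secondOp DymW DxmW DmmW i (seg X Y q) (law X) a, a⟫_ℝ‖
      ≤ d * (2 * R) * (θ * ‖a‖ ^ 2 + C * ‖h - cst P a‖ ^ 2) := by
    filter_upwards [ae_segMeas_bound hX hY] with q hq
    have : ⟪W (seg X Y q + a) (law (X + h)) - W (seg X Y q + a) (law X), X q.1 - Y q.1⟫_ℝ
      - ∑ i, (X q.1 - Y q.1) i * ∫ ω, ⟪DmW i (seg X Y q) (law X) (X ω), h ω⟫_ℝ ∂P
      - (1 / 2) * ∑ i, (X q.1 - Y q.1) i * ⟪secondOp DymW DxmW DmmW i (seg X Y q) (law X) a, a⟫_ℝ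
      = ∑ i, (X q.1 - Y q.1) i * (W (seg X Y q + a) (law (X + h)) i
        - W (seg X Y q + a) (law X) i - ∫ ω, ⟪DmW i (seg X Y q) (law X) (X ω), h ω⟫_ℝ ∂P
        - (1 / 2) * ⟪secondOp DymW DxmW DmmW i (seg X Y q) (law X) a, a⟫_ℝ) := by
      rw [real_inner_eq_sum, Finset.mul_sum, ← Finset.sum_sub_distrib, ← Finset.sum_sub_distrib]
      refine Finset.sum_congr rfl fun i _ => ?_
      simp only [PiLp.sub_apply]; ring
    rw [this]
    refine (norm_sum_le _ _).trans ?_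
    refine (Finset.sum_le_card_nsmul _ _ (2 * R * (θ * ‖a‖ ^ 2 + C * ‖h - cst P a‖ ^ 2))
      fun i _ => ?_).trans (by simp; linarith)
    rw [norm_mul]
    exact mul_le_mul (hq.2 i) (hexp i h a hh ha _ hq.1) (norm_nonneg _) (by positivity)
  refine (norm_integral_le_of_norm_le_const hbound).trans ?_
  have hθ' : d * (2 * R) * θ ≤ η := by
    rw [hθ, mul_div_assoc', div_le_iff₀ (by positivity)]
    nlinarith
  rw [probReal_univ, mul_one]
  nlinarith [mul_le_mul_of_nonneg_right hθ' (sq_nonneg ‖a‖)]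

end HasContinuousDerivatives

end Segment

/-! ### Second-order expansion of `Ŵ` -/

section Expansion

variable {Ω : Type*} [MeasurableSpace Ω] {P : Measure Ω} [IsProbabilityMeasure P] {d : ℕ}
  {W : E d → P2 d → E d} {DxW : E d → P2 d → E d →L[ℝ] E d}
  {DmW : Fin d → E d → P2 d → E d → E d} {DymW DxmW : Fin d → E d → P2 d → E d → E d →L[ℝ] E d}
  {DmmW : Fin d → Fin d → E d → P2 d → E d → E d → E d}

/-- `𝔼[D_x W(X, m) - D_x W(Y, m)]`: the part of the second derivative of `a ↦ Ŵ(X + a, Y + a)` that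
comes from the space variable. -/
noncomputable def diagHess (DxW : E d → P2 d → E d →L[ℝ] E d) (X Y : L2 d P) (m : P2 d) :
    E d →L[ℝ] E d :=
  ∫ ω, (DxW (X ω) m - DxW (Y ω) m) ∂P

/-- `Ŵ` in terms of a potential of `W`. -/
lemma What_eq_integral_potential {X Y : L2 d P} {U : E d → ℝ}
    (hU : ∀ x, HasGradientAt U (W x (law X)) x) (hW : Continuous fun x => W x (law X)) :
    What W (WithLp.toLp 2 (X, Y)) = ∫ ω, (U (X ω) - U (Y ω)) ∂P := by
  simp only [What]
  exact integral_congr_ae (ae_of_all _ fun ω => integral_segment_eq_sub hU hW _ _)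

lemma abs_potential_sub_le_of_bound {U : E d → ℝ} {w : E d → E d}
    (hU : ∀ x, HasGradientAt U (w x) x) {C : ℝ} (hC : ∀ x, ‖w x‖ ≤ C) (x y : E d) :
    |U x - U y| ≤ C * ‖x - y‖ := by
  have := Convex.norm_image_sub_le_of_norm_hasFDerivWithin_le (𝕜 := ℝ) (f := U) (s := univ) (C := C)
    (fun z _ => (hU z).hasFDerivAt.hasFDerivWithinAt) (fun z _ => by simpa using hC z) convex_univ
    (mem_univ y) (mem_univ x)
  simpa using this

lemma continuous_potential {U : E d → ℝ} {w : E d → E d} (hU : ∀ x, HasGradientAt U (w x) x) :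
    Continuous U := continuous_iff_continuousAt.2 fun x => (hU x).continuousAt

lemma integrable_potential_sub {U : E d → ℝ} {w : E d → E d} (hU : ∀ x, HasGradientAt U (w x) x)
    {C : ℝ} (hC : ∀ x, ‖w x‖ ≤ C) {f g : Ω → E d} (hf : AEStronglyMeasurable f P)
    (hg : AEStronglyMeasurable g P) (hfg : Integrable (fun ω => f ω - g ω) P) :
    Integrable (fun ω => U (f ω) - U (g ω)) P := by
  have hc := continuous_potential hU
  refine (hfg.norm.const_mul C).mono' ((hc.comp_aestronglyMeasurable hf).sub
    (hc.comp_aestronglyMeasurable hg)) (ae_of_all _ fun ω => ?_)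
  exact abs_potential_sub_le_of_bound hU hC _ _

/-- The integral over segments of a bounded gradient field. -/
lemma integral_segMeas_eq {w : E d → E d} {U : E d → ℝ} (hU : ∀ x, HasGradientAt U (w x) x)
    (hw : Continuous w) {C : ℝ} (hC : ∀ x, ‖w x‖ ≤ C) (X Y : L2 d P) (a : E d) :
    Integrable (fun q => ⟪w (seg X Y q + a), X q.1 - Y q.1⟫_ℝ) (segMeas P) ∧
    ∫ q, ⟪w (seg X Y q + a), X q.1 - Y q.1⟫_ℝ ∂segMeas P
      = ∫ ω, (U (X ω + a) - U (Y ω + a)) ∂P := by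
  have hm : Measurable fun q : Ω × ℝ => X q.1 - Y q.1 :=
    ((measurable_coe X).comp measurable_fst).sub ((measurable_coe Y).comp measurable_fst)
  have hi : Integrable (fun q => ⟪w (seg X Y q + a), X q.1 - Y q.1⟫_ℝ) (segMeas P) := by
    have hXY : Integrable (fun ω => X ω - Y ω) P := (integrable_coe X).sub (integrable_coe Y)
    refine ((hXY.norm.const_mul C).comp_fst (volume.restrict (Ioc (0 : ℝ) 1))).mono'
      ((hw.measurable.comp ((measurable_seg X Y).add_const a)).inner hm).aestronglyMeasurable
      (ae_of_all _ fun q => ?_)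
    exact (norm_inner_le_norm _ _).trans (mul_le_mul_of_nonneg_right (hC _) (norm_nonneg _))
  refine ⟨hi, ?_⟩
  rw [segMeas, integral_prod _ hi]
  refine integral_congr_ae (ae_of_all _ fun ω => ?_)
  have := integral_segment_eq_sub hU hw (X ω + a) (Y ω + a)
  rw [intervalIntegral.integral_of_le zero_le_one] at this
  refine Eq.trans (integral_congr_ae (ae_of_all _ fun t => ?_)) this
  have e1 : (1 - t) • (X ω + a) + t • (Y ω + a) = seg X Y (ω, t) + a := by
    simp only [seg]; module
  simp only [e1, add_sub_add_right_eq_sub]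

namespace HasContinuousDerivatives

/-- Replacing an increment `v` of the space variable by a deterministic `a`. -/
lemma potential_shift (hD : HasContinuousDerivatives P W DxW DmW DymW DxmW DmmW)
    {Cw : ℝ} (hCw : ∀ x m, ‖W x m‖ ≤ Cw) (X : L2 d P) {R : ℝ} (hX : ∀ᵐ ω ∂P, ‖X ω‖ ≤ R)
    {η : ℝ} (hη : 0 < η) :
    ∃ C, 0 ≤ C ∧ ∃ δ > 0, ∀ (h : L2 d P) (a : E d) (U : E d → ℝ), ‖h‖ < δ → ‖a‖ < δ →
      (∀ x, HasGradientAt U (W x (law (X + h))) x) → ∀ x v, ‖x‖ ≤ R →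
      |U (x + v) - U (x + a) - ⟪W x (law X), v - a⟫_ℝ|
        ≤ η * ‖a‖ ^ 2 + C * (‖v - a‖ ^ 2 + ‖h - cst P a‖ ^ 2) := by
  obtain ⟨L, hL, δ₁, hδ₁, hlip⟩ := hD.W_lipschitz X hX
  obtain ⟨B, hB, δ₂, hδ₂, hbd⟩ := hD.exists_bound_DxW X (R + 2)
  have hCw0 : 0 ≤ Cw := (norm_nonneg _).trans (hCw 0 (law X))
  refine ⟨B + 2 * Cw + L ^ 2 / η + L, by positivity, min 1 (min δ₁ δ₂), by positivity,
    fun h a U hh ha hU x v hx => ?_⟩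
  simp only [lt_min_iff] at hh ha
  have h1 : |U (x + a + (v - a)) - U (x + a) - ⟪W (x + a) (law (X + h)), v - a⟫_ℝ|
      ≤ (B + 2 * Cw) * ‖v - a‖ ^ 2 := by
    refine abs_potential_sub_le hU hB (fun z hz => ?_) fun z => hCw z _
    refine (convex_closedBall (0 : E d) (R + 2)).norm_image_sub_le_of_norm_hasFDerivWithin_le
      (𝕜 := ℝ) (fun y _ => (hD.deriv_x y (law (X + h))).hasFDerivWithinAt)
      (fun y hy => hbd (X + h) (by simpa using hh.2.2) y (by simpa using hy)) ?_ ?_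
    · rw [mem_closedBall_zero_iff]
      linarith [norm_add_le x a, hh.1, ha.1]
    · rw [mem_closedBall_zero_iff]
      have : ‖z‖ ≤ ‖z - (x + a)‖ + ‖x + a‖ := by simpa using norm_add_le (z - (x + a)) (x + a)
      linarith [norm_add_le x a, hh.1, ha.1]
  rw [add_add_sub_cancel] at h1
  have h2 : |⟪W (x + a) (law (X + h)) - W x (law X), v - a⟫_ℝ|
      ≤ L * (‖a‖ + ‖h - cst P a‖) * ‖v - a‖ :=
    (abs_real_inner_le_norm _ _).trans
      (mul_le_mul_of_nonneg_right (hlip h a hh.2.1 ha.2.1 x hx) (norm_nonneg _))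
  have h3 : L * (‖a‖ + ‖h - cst P a‖) * ‖v - a‖ ≤ η * ‖a‖ ^ 2 + (L ^ 2 / η) * ‖v - a‖ ^ 2
      + L * (‖v - a‖ ^ 2 + ‖h - cst P a‖ ^ 2) := by
    have e1 : L * ‖a‖ * ‖v - a‖ ≤ η * ‖a‖ ^ 2 + (L ^ 2 / η) * ‖v - a‖ ^ 2 := by
      have : 0 ≤ (2 * η * ‖a‖ - L * ‖v - a‖) ^ 2 / (4 * η) := by positivity
      have e : (2 * η * ‖a‖ - L * ‖v - a‖) ^ 2 / (4 * η) = η * ‖a‖ ^ 2 - L * ‖a‖ * ‖v - a‖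
          + (L ^ 2 / η) * ‖v - a‖ ^ 2 / 4 := by field_simp; ring
      have : 0 ≤ (L ^ 2 / η) * ‖v - a‖ ^ 2 := by positivity
      linarith
    have e2 : ‖h - cst P a‖ * ‖v - a‖ ≤ ‖v - a‖ ^ 2 + ‖h - cst P a‖ ^ 2 := by
      nlinarith [sq_nonneg (‖v - a‖ - ‖h - cst P a‖), sq_nonneg ‖v - a‖,
        sq_nonneg ‖h - cst P a‖]
    nlinarith
  have h4 : U (x + v) - U (x + a) - ⟪W x (law X), v - a⟫_ℝ
      = (U (x + v) - U (x + a) - ⟪W (x + a) (law (X + h)), v - a⟫_ℝ)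
        + ⟪W (x + a) (law (X + h)) - W x (law X), v - a⟫_ℝ := by
    rw [inner_sub_left]; ring
  rw [h4]
  refine (abs_add_le _ _).trans ?_
  have : 0 ≤ (B + 2 * Cw + L ^ 2 / η) * ‖h - cst P a‖ ^ 2 := by positivity
  linarith

/-- Second-order expansion of a potential of `W(·, m)`, uniformly on balls. -/
lemma potential_expansion (hD : HasContinuousDerivatives P W DxW DmW DymW DxmW DmmW)
    (m : P2 d) (R : ℝ) {U : E d → ℝ} (hU : ∀ x, HasGradientAt U (W x m) x)
    {η : ℝ} (hη : 0 < η) :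
    ∃ δ > 0, ∀ a x, ‖a‖ < δ → ‖x‖ ≤ R →
      |U (x + a) - U x - ⟪W x m, a⟫_ℝ - (1 / 2) * ⟪DxW x m a, a⟫_ℝ| ≤ η * ‖a‖ ^ 2 := by
  have huc := (isCompact_closedBall (0 : E d) (R + 1)).uniformContinuousOn_of_continuous
    (hD.continuous_DxW m).continuousOn
  obtain ⟨δ, hδ, huc⟩ := Metric.uniformContinuousOn_iff_le.1 huc η hη
  refine ⟨min 1 δ, by positivity, fun a x ha hx => ?_⟩
  refine abs_potential_sub_sub_le hU (fun z => hD.deriv_x z m) hη.le (fun z hz => ?_) ha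
  rw [← dist_eq_norm] at hz ⊢
  rw [lt_min_iff] at hz
  refine huc z ?_ x ?_ hz.2.le
  · rw [mem_closedBall_zero_iff]
    have : ‖z‖ ≤ ‖z - x‖ + ‖x‖ := by simpa using norm_add_le (z - x) x
    rw [← dist_eq_norm] at this
    linarith [hz.1]
  · rw [mem_closedBall_zero_iff]; linarith

lemma integrable_inner_W (hD : HasContinuousDerivatives P W DxW DmW DymW DxmW DmmW)
    {Cw : ℝ} (hCw : ∀ x m, ‖W x m‖ ≤ Cw) (m : P2 d) (X h : L2 d P) :
    Integrable (fun ω => ⟪W (X ω) m, h ω⟫_ℝ) P := by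
  refine ((integrable_norm_coe h).const_mul Cw).mono'
    ((hD.continuous_W m).comp_aestronglyMeasurable (Lp.aestronglyMeasurable X) |>.inner
      (Lp.aestronglyMeasurable h)) (ae_of_all _ fun ω => ?_)
  exact (norm_inner_le_norm _ _).trans (mul_le_mul_of_nonneg_right (hCw _ _) (norm_nonneg _))

lemma integrable_DxW_comp (hD : HasContinuousDerivatives P W DxW DmW DymW DxmW DmmW) (m : P2 d)
    {X : L2 d P} {R : ℝ} (hX : ∀ᵐ ω ∂P, ‖X ω‖ ≤ R) : Integrable (fun ω => DxW (X ω) m) P := by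
  obtain ⟨B, hB⟩ := (isCompact_closedBall (0 : E d) R).exists_bound_of_continuousOn
    (hD.continuous_DxW m).continuousOn
  refine .of_bound ((hD.continuous_DxW m).comp_aestronglyMeasurable (Lp.aestronglyMeasurable X)) B ?_
  filter_upwards [hX] with ω hω using hB _ (by simpa using hω)

/-- Second-order expansion of `Ŵ` from below at a pair of bounded random variables. The increments
are measured by a vector `a`, up to errors that are quadratic in their distance to `a`. -/
lemma What_expansion (hD : HasContinuousDerivatives P W DxW DmW DymW DxmW DmmW)
    {Cw : ℝ} (hCw : ∀ x m, ‖W x m‖ ≤ Cw) (hirr : ∀ m, Irrotational fun x => W x m)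
    {X Y : L2 d P} {R : ℝ} (hX : ∀ᵐ ω ∂P, ‖X ω‖ ≤ R) (hY : ∀ᵐ ω ∂P, ‖Y ω‖ ≤ R) {η : ℝ}
    (hη : 0 < η) :
    ∃ C, 0 ≤ C ∧ ∃ δ > 0, ∀ (h k : L2 d P) (a : E d), ‖h‖ < δ → ‖a‖ < δ →
      What W (WithLp.toLp 2 (X, Y)) + ∫ ω, ⟪W (X ω) (law X), h ω⟫_ℝ ∂P
        - ∫ ω, ⟪W (Y ω) (law X), k ω⟫_ℝ ∂P + ∫ ω, ⟪crossGrad DmW X Y (law X) (X ω), h ω⟫_ℝ ∂P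
        + (1 / 2) * (⟪diagHess DxW X Y (law X) a, a⟫_ℝ
          + ⟪segHess DymW DxmW DmmW X Y (law X) a, a⟫_ℝ)
        - η * ‖a‖ ^ 2 - C * (‖h - cst P a‖ ^ 2 + ‖k - cst P a‖ ^ 2)
        ≤ What W (WithLp.toLp 2 (X + h, Y + k)) := by
  have hη5 : 0 < η / 5 := by positivity
  set m := law X with hm
  have hWc := hD.continuous_W
  have hpot : ∀ m, ∃ U : E d → ℝ, ∀ x, HasGradientAt U (W x m) x := fun m =>
    (hirr m).exists_potential (fun x => hD.deriv_x x m) (hD.continuous_DxW m)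
  obtain ⟨U, hU⟩ := hpot m
  obtain ⟨C₁, hC₁, δ₁, hδ₁, hsh⟩ := hD.potential_shift hCw X hX hη5
  obtain ⟨C₂, hC₂, δ₂, hδ₂, hse⟩ := hD.seg_expansion hX hY hη5
  obtain ⟨δ₃, hδ₃, hex⟩ := hD.potential_expansion m R hU hη5
  refine ⟨3 * C₁ + C₂, by positivity, min δ₁ (min δ₂ δ₃), by positivity,
    fun h k a hh ha => ?_⟩
  simp only [lt_min_iff] at hh ha
  obtain ⟨U', hU'⟩ := hpot (law (X + h))
  rw [What_eq_integral_potential hU (hWc _), What_eq_integral_potential hU' (hWc _)]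
  obtain ⟨i1, e1⟩ := integral_segMeas_eq hU' (hWc _) (hCw · _) X Y a
  obtain ⟨i2, e2⟩ := integral_segMeas_eq hU (hWc _) (hCw · _) X Y a
  have hseg := hse h a hh.2.1 ha.2.1
  simp only [inner_sub_left] at hseg
  rw [integral_sub i1 i2, e1, e2] at hseg
  -- replace the increments `h`, `k` by `a`
  have sX := Lp.aestronglyMeasurable X
  have sY := Lp.aestronglyMeasurable Y
  have sXh := Lp.aestronglyMeasurable (X + h)
  have sYk := Lp.aestronglyMeasurable (Y + k)
  have iXY : Integrable (fun ω => X ω - Y ω) P := (integrable_coe X).sub (integrable_coe Y)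
  have iXYa : Integrable (fun ω => (X ω + a) - (Y ω + a)) P := by simpa using iXY
  have j1 : Integrable (fun ω => U' ((X + h) ω) - U' ((Y + k) ω)) P :=
    integrable_potential_sub hU' (hCw · _) sXh sYk ((integrable_coe _).sub (integrable_coe _))
  have j2 : Integrable (fun ω => U' (X ω + a) - U' (Y ω + a)) P :=
    integrable_potential_sub hU' (hCw · _) (sX.add_const a) (sY.add_const a) iXYa
  have j3 : Integrable (fun ω => U (X ω + a) - U (Y ω + a)) P :=
    integrable_potential_sub hU (hCw · _) (sX.add_const a) (sY.add_const a) iXYa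
  have j4 : Integrable (fun ω => U (X ω) - U (Y ω)) P :=
    integrable_potential_sub hU (hCw · _) sX sY iXY
  have k1 := hD.integrable_inner_W hCw m X h
  have k2 := hD.integrable_inner_W hCw m Y k
  have k3 := hD.integrable_inner_W hCw m X (cst P a)
  have k4 := hD.integrable_inner_W hCw m Y (cst P a)
  have l1 := hD.integrable_DxW_comp m hX
  have l2 := hD.integrable_DxW_comp m hY
  have l3 := (quadL a).integrable_comp (l1.sub l2)
  have el : ⟪diagHess DxW X Y m a, a⟫_ℝ = ∫ ω, quadL a (DxW (X ω) m - DxW (Y ω) m) ∂P := by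
    rw [← quadL_apply, diagHess]
    exact ((quadL a).integral_comp_comm (l1.sub l2)).symm
  simp only [Pi.sub_def] at l3
  have b1 : |∫ ω, ((U' ((X + h) ω) - U' ((Y + k) ω) - (U' (X ω + a) - U' (Y ω + a)))
      - ((⟪W (X ω) m, h ω⟫_ℝ - ⟪W (Y ω) m, k ω⟫_ℝ)
        - (⟪W (X ω) m, cst P a ω⟫_ℝ - ⟪W (Y ω) m, cst P a ω⟫_ℝ))) ∂P|
      ≤ 2 * (η / 5) * ‖a‖ ^ 2 + C₁ * (‖h - cst P a‖ ^ 2 + ‖k - cst P a‖ ^ 2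
        + 2 * ‖h - cst P a‖ ^ 2) := by
    have ib1 := integrable_norm_sq_coe (h - cst P a)
    have ib2 := integrable_norm_sq_coe (k - cst P a)
    have ib3 : Integrable (fun ω => ‖(h - cst P a) ω‖ ^ 2 + ‖(k - cst P a) ω‖ ^ 2) P := ib1.add ib2
    have ib4 : Integrable (fun ω => C₁ * (‖(h - cst P a) ω‖ ^ 2 + ‖(k - cst P a) ω‖ ^ 2
      + 2 * ‖h - cst P a‖ ^ 2)) P := (ib3.add (integrable_const _)).const_mul _
    have : ∫ ω, (2 * (η / 5) * ‖a‖ ^ 2 + C₁ * (‖(h - cst P a) ω‖ ^ 2 + ‖(k - cst P a) ω‖ ^ 2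
        + 2 * ‖h - cst P a‖ ^ 2)) ∂P = 2 * (η / 5) * ‖a‖ ^ 2 + C₁ * (‖h - cst P a‖ ^ 2
        + ‖k - cst P a‖ ^ 2 + 2 * ‖h - cst P a‖ ^ 2) := by
      rw [integral_add (integrable_const _) ib4, integral_const_mul C₁,
        integral_add ib3 (integrable_const _), integral_add ib1 ib2,
        ← norm_sq_eq_integral, ← norm_sq_eq_integral]
      simp
    rw [← this]
    have ib5 : Integrable (fun ω => 2 * (η / 5) * ‖a‖ ^ 2 + C₁ * (‖(h - cst P a) ω‖ ^ 2
      + ‖(k - cst P a) ω‖ ^ 2 + 2 * ‖h - cst P a‖ ^ 2)) P := (integrable_const _).add ib4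
    rw [← Real.norm_eq_abs]
    refine norm_integral_le_of_norm_le ib5 ?_
    filter_upwards [hX, hY, Lp.coeFn_add X h, Lp.coeFn_add Y k, Lp.coeFn_sub h (cst P a),
      Lp.coeFn_sub k (cst P a), coe_cst (P := P) a] with ω h1 h2 h3 h4 h5 h6 h7
    have q1 := hsh h a U' hh.1 ha.1 hU' (X ω) (h ω) h1
    have q2 := hsh h a U' hh.1 ha.1 hU' (Y ω) (k ω) h2
    simp only [h3, h4, h5, h6, h7, Pi.add_apply, Pi.sub_apply, Real.norm_eq_abs]
    simp only [inner_sub_right] at q1 q2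
    rw [abs_le] at q1 q2 ⊢
    constructor <;> linarith [q1.1, q1.2, q2.1, q2.2]
  -- expand the potential at deterministic increments
  have b2 : |∫ ω, ((U (X ω + a) - U (Y ω + a)) - (U (X ω) - U (Y ω))
      - (⟪W (X ω) m, cst P a ω⟫_ℝ - ⟪W (Y ω) m, cst P a ω⟫_ℝ)
      - (1 / 2) * quadL a (DxW (X ω) m - DxW (Y ω) m)) ∂P| ≤ 2 * (η / 5) * ‖a‖ ^ 2 := by
    rw [← Real.norm_eq_abs]
    refine (norm_integral_le_of_norm_le_const (C := 2 * (η / 5) * ‖a‖ ^ 2) ?_).trans_eq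
      (by rw [probReal_univ, mul_one])
    filter_upwards [hX, hY, coe_cst (P := P) a] with ω h1 h2 h7
    have q1 := hex a (X ω) ha.2.2 h1
    have q2 := hex a (Y ω) ha.2.2 h2
    rw [h7, map_sub, quadL_apply, quadL_apply, Real.norm_eq_abs]
    rw [abs_le] at q1 q2 ⊢
    constructor <;> linarith [q1.1, q1.2, q2.1, q2.2]
  have j12 := j1.sub j2
  have j34 := j3.sub j4
  have k12 := k1.sub k2
  have k34 := k3.sub k4
  have kk := k12.sub k34
  have jk := j34.sub k34
  simp only [Pi.sub_def] at j12 j34 k12 k34 kk jk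
  rw [integral_sub j12 kk, integral_sub j1 j2, integral_sub k12 k34, integral_sub k1 k2] at b1
  rw [integral_sub jk (l3.const_mul _), integral_sub j34 k34, integral_sub j3 j4,
    integral_const_mul, ← el] at b2
  rw [abs_le] at b1 b2 hseg
  have p1 := mul_nonneg hC₁ (sq_nonneg ‖k - cst P a‖)
  have p2 := mul_nonneg hC₂ (sq_nonneg ‖k - cst P a‖)
  linarith [b1.1, b2.1, hseg.1]

end HasContinuousDerivatives
end Expansion

/-! ### The second-order subdifferential of `Ŵ^ε` -/

section Subjet

variable {Ω : Type*} [MeasurableSpace Ω] {P : Measure Ω} [IsProbabilityMeasure P] {d : ℕ}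
  {W : E d → P2 d → E d} {DxW : E d → P2 d → E d →L[ℝ] E d}
  {DmW : Fin d → E d → P2 d → E d → E d} {DymW DxmW : Fin d → E d → P2 d → E d → E d →L[ℝ] E d}
  {DmmW : Fin d → Fin d → E d → P2 d → E d → E d → E d}

/-- The expectation as a bounded linear map on `L²`. -/
noncomputable def meanL : L2 d P →L[ℝ] E d :=
  LinearMap.mkContinuous
    { toFun := fun h => ∫ ω, h ω ∂P
      map_add' := fun h k => by
        rw [integral_congr_ae (Lp.coeFn_add h k)]
        exact integral_add (integrable_coe h) (integrable_coe k)
      map_smul' := fun c h => by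
        rw [integral_congr_ae (Lp.coeFn_smul c h)]
        exact integral_smul c _ } 1
    fun h => by
      rw [one_mul]
      exact (norm_integral_le_integral_norm _).trans (integral_norm_le_norm h)

lemma norm_meanL_le (h : L2 d P) : ‖meanL h‖ ≤ ‖h‖ :=
  (norm_integral_le_integral_norm _).trans (integral_norm_le_norm h)

lemma meanL_cst (a : E d) : meanL (cst P a) = a := by
  change ∫ ω, cst P a ω ∂P = a
  rw [integral_congr_ae (coe_cst a)]
  simp

/-- The embedding of `ℝ^d` in `L²` as constants. -/
noncomputable def cstL : E d →L[ℝ] L2 d P :=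
  LinearMap.mkContinuous
    { toFun := fun a => cst P a
      map_add' := fun _ _ => rfl
      map_smul' := fun _ _ => rfl } 1 fun a => (norm_cst a).le.trans_eq (one_mul _).symm

/-- The inner product as a bounded bilinear form. -/
noncomputable def innerB (V : Type*) [NormedAddCommGroup V] [InnerProductSpace ℝ V] :
    V →L[ℝ] V →L[ℝ] ℝ := innerSL ℝ

lemma innerB_apply {V : Type*} [NormedAddCommGroup V] [InnerProductSpace ℝ V] (v w : V) :
    innerB V v w = ⟪v, w⟫_ℝ := rfl

/-- The mean of the first component of an increment. -/
noncomputable def fstMean : L2L2 d P →L[ℝ] E d :=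
  meanL.comp ((ContinuousLinearMap.fst ℝ _ _).comp
    (WithLp.prodContinuousLinearEquiv 2 ℝ (L2 d P) (L2 d P)).toContinuousLinearMap)

/-- The first component of an increment minus the mean of the first component. -/
noncomputable def fstDev : L2L2 d P →L[ℝ] L2 d P :=
  (ContinuousLinearMap.fst ℝ _ _).comp
    (WithLp.prodContinuousLinearEquiv 2 ℝ (L2 d P) (L2 d P)).toContinuousLinearMap
  - cstL.comp fstMean

/-- The second component of an increment minus the mean of the first component. -/
noncomputable def sndDev : L2L2 d P →L[ℝ] L2 d P :=
  (ContinuousLinearMap.snd ℝ _ _).comp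
    (WithLp.prodContinuousLinearEquiv 2 ℝ (L2 d P) (L2 d P)).toContinuousLinearMap
  - cstL.comp fstMean

lemma fstMean_apply (z : L2L2 d P) : fstMean z = meanL z.fst := rfl
lemma fstDev_apply (z : L2L2 d P) : fstDev z = z.fst - cst P (meanL z.fst) := rfl
lemma sndDev_apply (z : L2L2 d P) : sndDev z = z.snd - cst P (meanL z.fst) := rfl

/-- The bilinear form on `L² × L²` whose quadratic form is
`(h, k) ↦ (Q a, a) - 2 θ |a|² - 2 C (‖h - a‖² + ‖k - a‖²)`, where `a` is the mean of `h`. -/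
noncomputable def meanForm (Q : E d →L[ℝ] E d) (θ C : ℝ) : L2L2 d P →L[ℝ] L2L2 d P →L[ℝ] ℝ :=
  (innerB (E d)).bilinearComp (Q.comp fstMean) fstMean
    - (2 * θ) • (innerB (E d)).bilinearComp fstMean fstMean
    - (2 * C) • ((innerB (L2 d P)).bilinearComp fstDev fstDev
      + (innerB (L2 d P)).bilinearComp sndDev sndDev)

lemma meanForm_apply_self (Q : E d →L[ℝ] E d) (θ C : ℝ) (z : L2L2 d P) :
    meanForm Q θ C z z = ⟪Q (meanL z.fst), meanL z.fst⟫_ℝ - 2 * θ * ‖meanL z.fst‖ ^ 2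
      - 2 * C * (‖z.fst - cst P (meanL z.fst)‖ ^ 2 + ‖z.snd - cst P (meanL z.fst)‖ ^ 2) := by
  simp only [meanForm, sub_apply, smul_apply, add_apply, ContinuousLinearMap.bilinearComp_apply,
    ContinuousLinearMap.comp_apply, innerB_apply, fstMean_apply, fstDev_apply, sndDev_apply,
    real_inner_self_eq_norm_sq, smul_eq_mul]

lemma Lam_meanForm (Q : E d →L[ℝ] E d) (θ C : ℝ) :
    Lam (meanForm (P := P) Q θ C) = tr Q - 2 * θ * d := by
  have h : ∀ k : Fin d, meanForm Q θ C (WithLp.toLp 2 (cst P (e k), cst P (e k)))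
      (WithLp.toLp 2 (cst P (e k), cst P (e k))) = (Q (e k)) k - 2 * θ := by
    intro k
    have hf : (WithLp.toLp 2 (cst P (e k), cst P (e k)) : L2L2 d P).fst = cst P (e k) := rfl
    have hs : (WithLp.toLp 2 (cst P (e k), cst P (e k)) : L2L2 d P).snd = cst P (e k) := rfl
    rw [meanForm_apply_self, hf, hs]
    simp only [meanL_cst, sub_self, norm_zero]
    rw [inner_e]
    simp [e]
  unfold Lam
  rw [Finset.sum_congr rfl fun k _ => h k, Finset.sum_sub_distrib, tr]
  simp [mul_comm]

lemma memLp_W_comp (hD : HasContinuousDerivatives P W DxW DmW DymW DxmW DmmW)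
    {Cw : ℝ} (hCw : ∀ x m, ‖W x m‖ ≤ Cw) (m : P2 d) (X : L2 d P) :
    MemLp (fun ω => W (X ω) m) 2 P :=
  .of_bound ((hD.continuous_W m).comp_aestronglyMeasurable (Lp.aestronglyMeasurable X)) Cw
    (ae_of_all _ fun _ => hCw _ _)

lemma memLp_crossGrad (hD : HasContinuousDerivatives P W DxW DmW DymW DxmW DmmW)
    (m : P2 d) {X Y : L2 d P} {R : ℝ} (hX : ∀ᵐ ω ∂P, ‖X ω‖ ≤ R) (hY : ∀ᵐ ω ∂P, ‖Y ω‖ ≤ R) :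
    MemLp (fun ω => crossGrad DmW X Y m (X ω)) 2 P := by
  obtain ⟨B, hB, hb⟩ := hD.exists_bound_DmW m R
  have hm : AEStronglyMeasurable (fun p : (Ω × ℝ) × Ω => ∑ i, (X p.1.1 - Y p.1.1) i •
      DmW i (seg X Y p.1) m (X p.2)) ((segMeas P).prod P) :=
    Finset.aestronglyMeasurable_fun_sum _ fun i _ =>
      hD.aestronglyMeasurable_crossGrad_integrand m X Y X i
  refine .of_bound (hm.prod_swap.integral_prod_right') (d * (2 * R * B)) ?_
  filter_upwards [hX] with ω hω
  refine (norm_integral_le_of_norm_le_const (C := d * (2 * R * B)) ?_).trans_eq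
    (by rw [probReal_univ, mul_one])
  filter_upwards [ae_segMeas_bound hX hY] with q hq
  refine (norm_sum_le _ _).trans ((Finset.sum_le_card_nsmul _ _ (2 * R * B) fun i _ => ?_).trans
    (by simp))
  rw [norm_smul]
  exact mul_le_mul (hq.2 i) (hb i _ _ hq.1 hω) (norm_nonneg _) ((abs_nonneg _).trans (hq.2 i))

/-- An element of the second-order subdifferential of `Ŵ^ε` at a pair of bounded random variables,
given a lower bound, quadratic at `X`, of the density term. -/
lemma mem_subjet_WhatEps (hD : HasContinuousDerivatives P W DxW DmW DymW DxmW DmmW)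
    {Cw : ℝ} (hCw : ∀ x m, ‖W x m‖ ≤ Cw) (hirr : ∀ m, Irrotational fun x => W x m)
    {X Y : L2 d P} {R : ℝ} (hX : ∀ᵐ ω ∂P, ‖X ω‖ ≤ R) (hY : ∀ᵐ ω ∂P, ‖Y ω‖ ≤ R)
    {g : L2 d P} {Cg : ℝ} (hCg : 0 ≤ Cg)
    (hg : ∀ X' ∈ Linfac d P, ⟪g, X' - X⟫_ℝ - Cg * ‖X' - X‖ ^ 2
      ≤ (densSup (law X')).toReal - (densSup (law X)).toReal)
    {ε η : ℝ} (hε : 0 < ε) (hη : 0 < η) :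
    ∃ C, (meanForm (diagHess DxW X Y (law X) + segHess DymW DxmW DmmW X Y (law X))
        (η + 2 * ε * Cg) C,
      WithLp.toLp 2 ((memLp_W_comp hD hCw (law X) X).toLp + (memLp_crossGrad hD (law X) hX hY).toLp
        + ε • g, -(memLp_W_comp hD hCw (law X) Y).toLp)) ∈
      subjet (dom d P) (WhatEps W ε) (WithLp.toLp 2 (X, Y)) := by
  obtain ⟨C, hC, δ, hδ, hexp⟩ := hD.What_expansion hCw hirr hX hY hη
  refine ⟨C + 2 * ε * Cg, fun η' hη' => ?_⟩
  have hnhds : ∀ᶠ z in 𝓝[dom d P] (WithLp.toLp 2 (X, Y)), ‖z - WithLp.toLp 2 (X, Y)‖ < δ := by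
    refine mem_nhdsWithin_of_mem_nhds ?_
    filter_upwards [Metric.ball_mem_nhds (WithLp.toLp 2 (X, Y) : L2L2 d P) hδ] with z hz
    rwa [← dist_eq_norm]
  filter_upwards [hnhds, self_mem_nhdsWithin] with z hz hzd
  refine le_trans (b := 0) (by nlinarith [sq_nonneg ‖z - WithLp.toLp 2 (X, Y)‖]) ?_
  set h : L2 d P := z.fst - X with hh
  set k : L2 d P := z.snd - Y with hk
  have hfst : (z - WithLp.toLp 2 (X, Y)).fst = h := rfl
  have hsnd : (z - WithLp.toLp 2 (X, Y)).snd = k := rfl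
  have hfst' : (z - WithLp.toLp 2 (X, Y)).ofLp.1 = h := rfl
  have hsnd' : (z - WithLp.toLp 2 (X, Y)).ofLp.2 = k := rfl
  have hXY : (WithLp.toLp 2 (X, Y) : L2L2 d P).fst = X := rfl
  have hzhk : z = WithLp.toLp 2 (X + h, Y + k) := by
    simp only [hh, hk, add_sub_cancel]; rfl
  have hhn : ‖h‖ < δ := by
    refine lt_of_le_of_lt ?_ hz
    rw [← hfst]
    exact WithLp.norm_fst_le _ _
  have hexp' := hexp h k (meanL h) hhn ((norm_meanL_le h).trans_lt hhn)
  have hg' := hg z.fst hzd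
  rw [← hh] at hg'
  rw [meanForm_apply_self, WithLp.prod_inner_apply, hfst, hsnd, hfst', hsnd']
  simp only [inner_add_left, inner_neg_left, real_inner_smul_left]
  have i1 : ∀ {f : Ω → E d} (hf : MemLp f 2 P) (u : L2 d P),
      ⟪hf.toLp, u⟫_ℝ = ∫ ω, ⟪f ω, u ω⟫_ℝ ∂P := by
    intro f hf u
    rw [L2.inner_def]
    refine integral_congr_ae ?_
    filter_upwards [hf.coeFn_toLp] with ω hω
    rw [hω]
  rw [i1, i1, i1]
  simp only [WhatEps, hXY]
  rw [← hzhk] at hexp'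
  have hsq : ‖h‖ ^ 2 ≤ 2 * ‖meanL h‖ ^ 2 + 2 * ‖h - cst P (meanL h)‖ ^ 2 := by
    have h1 : ‖h‖ ≤ ‖h - cst P (meanL h)‖ + ‖meanL h‖ := by
      rw [← norm_cst (P := P) (meanL h)]
      simpa using norm_add_le (h - cst P (meanL h)) (cst P (meanL h))
    nlinarith [norm_nonneg h, sq_nonneg (‖h - cst P (meanL h)‖ - ‖meanL h‖)]
  have hεg := mul_le_mul_of_nonneg_left hg' hε.le
  have hεs := mul_le_mul_of_nonneg_left hsq (mul_nonneg hε.le hCg)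
  have hpos : 0 ≤ ε * Cg * ‖k - cst P (meanL h)‖ ^ 2 := by positivity
  simp only [add_apply, inner_add_left]
  linarith

end Subjet

/-! ### The density term and the derivatives of the Hamiltonian -/

section Density

variable {Ω : Type*} [MeasurableSpace Ω] {P : Measure Ω} [IsProbabilityMeasure P] {d : ℕ}

lemma densSup_le {m : P2 d} {M : ℝ≥0∞} (h : m.meas ≤ M • volume) :
    m.meas ≪ volume ∧ densSup m ≤ M := by
  refine ⟨Measure.absolutelyContinuous_of_le_smul h, ?_⟩
  refine essSup_le_of_ae_le _ ?_
  refine ae_le_of_forall_setLIntegral_le_of_sigmaFinite (Measure.measurable_rnDeriv _ _)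
    fun s hs _ => ?_
  refine (Measure.setLIntegral_rnDeriv_le s).trans ((h s).trans ?_)
  simp

/-- Integrals of nonnegative test functions are controlled by `densSup`. -/
lemma integral_le_densSup_mul {m : P2 d} (hm : m.meas ≪ volume) (hd : densSup m < ⊤)
    {ψ : E d → ℝ} (hψ : Continuous ψ) (hc : HasCompactSupport ψ) (h0 : ∀ x, 0 ≤ ψ x) :
    ∫ x, ψ x ∂m.meas ≤ (densSup m).toReal * ∫ x, ψ x := by
  rw [← integral_rnDeriv_smul hm, ← integral_const_mul]
  have hint : Integrable ψ := hψ.integrable_of_hasCompactSupport hc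
  have hle : ∀ᵐ x, (m.meas.rnDeriv volume x).toReal • ψ x ≤ (densSup m).toReal * ψ x := by
    filter_upwards [ENNReal.ae_le_essSup (m.meas.rnDeriv volume)] with x hx
    exact mul_le_mul_of_nonneg_right (ENNReal.toReal_mono hd.ne hx) (h0 x)
  refine integral_mono_ae ((hint.const_mul (densSup m).toReal).mono' ?_ ?_) (hint.const_mul _) hle
  · exact ((Measure.measurable_rnDeriv _ _).ennreal_toReal.mul hψ.measurable).aestronglyMeasurable
  · filter_upwards [hle] with x hx
    rwa [Real.norm_of_nonneg (smul_nonneg ENNReal.toReal_nonneg (h0 x))]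

/-- First-order expansion of a test function with quadratic error. -/
lemma exists_gradient_expansion {ψ : E d → ℝ} (hψ : ContDiff ℝ 2 ψ) (hc : HasCompactSupport ψ) :
    ∃ (w : E d → E d) (C : ℝ), Continuous w ∧ (∀ x, ‖w x‖ ≤ C) ∧
      ∃ B, 0 ≤ B ∧ ∀ x v, |ψ (x + v) - ψ x - ⟪w x, v⟫_ℝ| ≤ B * ‖v‖ ^ 2 := by
  have hf : ContDiff ℝ 1 (fderiv ℝ ψ) := hψ.fderiv_right (by norm_num)
  have hfc : HasCompactSupport (fderiv ℝ ψ) := hc.fderiv ℝ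
  obtain ⟨K, hK⟩ := hf.lipschitzWith_of_hasCompactSupport hfc one_ne_zero
  obtain ⟨C, hC⟩ := hfc.exists_bound_of_continuous hf.continuous
  refine ⟨gradient ψ, C, ?_, fun x => by simpa [gradient] using hC x, K + 2 * C, ?_, fun x v => ?_⟩
  · exact (InnerProductSpace.toDual ℝ (E d)).symm.continuous.comp hf.continuous
  · have := (norm_nonneg _).trans (hC 0)
    positivity
  · refine abs_potential_sub_le
      (fun z => ((hψ.differentiable (by norm_num)) z).hasGradientAt) K.2 (fun z _ => ?_)
      fun z => by simpa [gradient] using hC z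
    have := hK.norm_sub_le z x
    rwa [gradient, gradient, ← map_sub, LinearIsometryEquiv.norm_map]

/-- If the law of `X` has a density that is at most `M`, and equal to `M` on a ball, then `densSup`
has at `X` a lower bound that is quadratic in the increment: the density has to reach the value `M`
in the mean over the ball, against a smooth weight. -/
lemma exists_densSup_lower_bound {X : L2 d P} {M : ℝ≥0∞} (hM : M ≠ ⊤)
    (hX : (law X).meas ≤ M • volume) {v : E d} {r : ℝ} (hr : 0 < r)
    (hball : (law X).meas.restrict (Metric.ball v r) = M • volume.restrict (Metric.ball v r)) :
    ∃ (g : L2 d P) (C : ℝ), 0 ≤ C ∧ ∀ X' ∈ Linfac d P, ⟪g, X' - X⟫_ℝ - C * ‖X' - X‖ ^ 2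
      ≤ (densSup (law X')).toReal - (densSup (law X)).toReal := by
  let ψ : ContDiffBump v := ⟨r / 2, r, by positivity, by linarith⟩
  have hψ2 : ContDiff ℝ 2 ψ := ψ.contDiff
  have hψc : Continuous ψ := ψ.continuous
  have hψs : HasCompactSupport ψ := ψ.hasCompactSupport
  obtain ⟨w, C, hw, hC, B, hB, hexp⟩ := exists_gradient_expansion hψ2 hψs
  have hI : 0 < ∫ x, ψ x := ψ.integral_pos
  set I := ∫ x, ψ x with hIdef
  have hXeq : ∫ x, ψ x ∂(law X).meas = M.toReal * I := by
    have hz : ∀ x, x ∉ Metric.ball v r → ψ x = 0 := fun x hx => by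
      rw [← Function.notMem_support, ψ.support_eq]; exact hx
    rw [hIdef, ← setIntegral_eq_integral_of_forall_compl_eq_zero (μ := (law X).meas) hz,
      ← setIntegral_eq_integral_of_forall_compl_eq_zero (μ := volume) hz, hball,
      integral_smul_measure, smul_eq_mul]
  have hle : (densSup (law X)).toReal ≤ M.toReal := ENNReal.toReal_mono hM (densSup_le hX).2
  have hwX : MemLp (fun ω => I⁻¹ • w (X ω)) 2 P := by
    refine .of_bound ((hw.const_smul I⁻¹).comp_aestronglyMeasurable (Lp.aestronglyMeasurable X))
      (I⁻¹ * C) (ae_of_all _ fun ω => ?_)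
    rw [norm_smul, Real.norm_of_nonneg (by positivity)]
    exact mul_le_mul_of_nonneg_left (hC _) (by positivity)
  refine ⟨hwX.toLp, I⁻¹ * B, by positivity, fun X' hX' => ?_⟩
  set h := X' - X with hh
  have hψint : ∀ Z : L2 d P, Integrable (fun ω => ψ (Z ω)) P := fun Z =>
    .of_bound (hψc.comp_aestronglyMeasurable (Lp.aestronglyMeasurable Z)) 1
      (ae_of_all _ fun ω => by
        rw [Real.norm_of_nonneg ψ.nonneg]; exact ψ.le_one)
  have hmap : ∀ Z : L2 d P, ∫ x, ψ x ∂(law Z).meas = ∫ ω, ψ (Z ω) ∂P := fun Z => by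
    rw [law_meas, integral_map (aemeasurable_coe Z) hψc.aestronglyMeasurable]
  have h1 := integral_le_densSup_mul hX'.1 hX'.2 hψc hψs fun x => ψ.nonneg
  rw [hmap, ← hIdef] at h1
  rw [hmap] at hXeq
  have hin : ⟪hwX.toLp, h⟫_ℝ = ∫ ω, I⁻¹ * ⟪w (X ω), h ω⟫_ℝ ∂P := by
    rw [L2.inner_def]
    refine integral_congr_ae ?_
    filter_upwards [hwX.coeFn_toLp] with ω hω
    rw [hω, real_inner_smul_left]
  have iw : Integrable (fun ω => ⟪w (X ω), h ω⟫_ℝ) P := by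
    refine ((integrable_norm_coe h).const_mul C).mono'
      ((hw.comp_aestronglyMeasurable (Lp.aestronglyMeasurable X)).inner
        (Lp.aestronglyMeasurable h)) (ae_of_all _ fun ω => ?_)
    exact (norm_inner_le_norm _ _).trans (mul_le_mul_of_nonneg_right (hC _) (norm_nonneg _))
  have h2 : ∫ ω, ⟪w (X ω), h ω⟫_ℝ ∂P - B * ‖h‖ ^ 2
      ≤ ∫ ω, ψ (X' ω) ∂P - ∫ ω, ψ (X ω) ∂P := by
    rw [norm_sq_eq_integral, ← integral_const_mul, ← integral_sub iw
      ((integrable_norm_sq_coe h).const_mul B), ← integral_sub (hψint X') (hψint X)]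
    refine integral_mono_ae (iw.sub ((integrable_norm_sq_coe h).const_mul B))
      ((hψint X').sub (hψint X)) ?_
    filter_upwards [Lp.coeFn_sub X' X] with ω hω
    have := (abs_le.1 (hexp (X ω) (h ω))).1
    have e : X ω + h ω = X' ω := by rw [hh, hω, Pi.sub_apply, add_sub_cancel]
    rw [e] at this
    linarith
  rw [hin, integral_const_mul]
  have h3 : I⁻¹ * (∫ ω, ⟪w (X ω), h ω⟫_ℝ ∂P - B * ‖h‖ ^ 2)
      ≤ I⁻¹ * (((densSup (law X')).toReal - M.toReal) * I) :=
    mul_le_mul_of_nonneg_left (by linarith) (by positivity)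
  rw [mul_comm _ I, inv_mul_cancel_left₀ hI.ne'] at h3
  linarith

end Density

section Hamiltonian

variable {d : ℕ} {H : E d → E d → ℝ}

lemma hasGradientAt_left (hH : ContDiff ℝ 1 fun q : E d × E d => H q.1 q.2) (p x : E d) :
    HasGradientAt (fun q => H q x) (DpH H p x) p := by
  have : DifferentiableAt ℝ (fun q => H q x) p :=
    (hH.comp (by fun_prop : ContDiff ℝ 1 fun q : E d => (q, x))).differentiable one_ne_zero p
  exact this.hasGradientAt

lemma hasGradientAt_right (hH : ContDiff ℝ 1 fun q : E d × E d => H q.1 q.2) (p x : E d) :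
    HasGradientAt (fun z => H p z) (DxH H p x) x := by
  have : DifferentiableAt ℝ (fun z => H p z) x :=
    (hH.comp (by fun_prop : ContDiff ℝ 1 fun z : E d => (p, z))).differentiable one_ne_zero x
  exact this.hasGradientAt

/-- The derivative of `H` in terms of its partial gradients. -/
lemma fderiv_hamiltonian (hH : ContDiff ℝ 1 fun q : E d × E d => H q.1 q.2) (p x u v : E d) :
    fderiv ℝ (fun q : E d × E d => H q.1 q.2) (p, x) (u, v)
      = ⟪DpH H p x, u⟫_ℝ + ⟪DxH H p x, v⟫_ℝ := by
  have hd := (hH.differentiable one_ne_zero (p, x)).hasFDerivAt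
  have h1 := HasFDerivAt.comp (f := fun q => (q, x)) p hd (hasFDerivAt_prodMk_left p x)
  have h2 := HasFDerivAt.comp (f := fun z => (p, z)) x hd (hasFDerivAt_prodMk_right p x)
  have e1 := (hasGradientAt_left hH p x).hasFDerivAt.unique h1
  have e2 := (hasGradientAt_right hH p x).hasFDerivAt.unique h2
  have e1' := congrArg (fun l => l u) e1
  have e2' := congrArg (fun l => l v) e2
  simp only [InnerProductSpace.toDual_apply_apply, ContinuousLinearMap.comp_apply,
    ContinuousLinearMap.inl_apply, ContinuousLinearMap.inr_apply] at e1' e2'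
  rw [e1', e2', ← map_add]
  simp

lemma continuous_DpH (hH : ContDiff ℝ 1 fun q : E d × E d => H q.1 q.2) :
    Continuous fun q : E d × E d => DpH H q.1 q.2 := by
  have h : (fun q : E d × E d => DpH H q.1 q.2) = fun q => ∑ i,
      (fderiv ℝ (fun q : E d × E d => H q.1 q.2) q (e i, 0)) • (e i : E d) := by
    funext q
    conv_lhs => rw [← sum_smul_e (DpH H q.1 q.2)]
    refine Finset.sum_congr rfl fun i _ => ?_
    have := fderiv_hamiltonian hH q.1 q.2 (e i) 0
    rw [inner_zero_right, add_zero, inner_e] at this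
    rw [← this]
  rw [h]
  have := hH.continuous_fderiv one_ne_zero
  fun_prop

lemma continuous_DxH (hH : ContDiff ℝ 1 fun q : E d × E d => H q.1 q.2) :
    Continuous fun q : E d × E d => DxH H q.1 q.2 := by
  have h : (fun q : E d × E d => DxH H q.1 q.2) = fun q => ∑ i,
      (fderiv ℝ (fun q : E d × E d => H q.1 q.2) q (0, e i)) • (e i : E d) := by
    funext q
    conv_lhs => rw [← sum_smul_e (DxH H q.1 q.2)]
    refine Finset.sum_congr rfl fun i _ => ?_
    have := fderiv_hamiltonian hH q.1 q.2 0 (e i)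
    rw [inner_zero_right, zero_add, inner_e] at this
    rw [← this]
  rw [h]
  have := hH.continuous_fderiv one_ne_zero
  fun_prop

end Hamiltonian

/-! ### The weak inequality without the density term -/

section Inequality

variable {Ω : Type*} [MeasurableSpace Ω] {P : Measure Ω} [IsProbabilityMeasure P] {d : ℕ}
  {W : E d → P2 d → E d} {DxW : E d → P2 d → E d →L[ℝ] E d}
  {DmW : Fin d → E d → P2 d → E d → E d} {DymW DxmW : Fin d → E d → P2 d → E d → E d →L[ℝ] E d}
  {DmmW : Fin d → Fin d → E d → P2 d → E d → E d → E d}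
  {β : ℝ} {H : E d → E d → ℝ} {F : E d → P1 d → ℝ}

lemma subjet_subset_subjetClosure {K : Type*} [NormedAddCommGroup K] [InnerProductSpace ℝ K]
    {S : Set K} {φ : K → ℝ} {x₀ : K} (h : x₀ ∈ S) : subjet S φ x₀ ⊆ subjetClosure S φ x₀ :=
  fun J hJ => ⟨fun _ => J, fun _ => x₀, fun _ => ⟨h, hJ⟩, tendsto_const_nhds, tendsto_const_nhds,
    tendsto_const_nhds⟩

/-- A continuous function of a bounded random variable is integrable. -/
lemma integrable_comp_of_bound {G : Type*} [NormedAddCommGroup G] {f : E d → G} (hf : Continuous f)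
    {X : L2 d P} {R : ℝ} (hX : ∀ᵐ ω ∂P, ‖X ω‖ ≤ R) : Integrable (fun ω => f (X ω)) P := by
  obtain ⟨B, hB⟩ := (isCompact_closedBall (0 : E d) R).exists_bound_of_continuousOn hf.continuousOn
  refine .of_bound (hf.comp_aestronglyMeasurable (Lp.aestronglyMeasurable X)) B ?_
  filter_upwards [hX] with ω hω using hB _ (by simpa using hω)

lemma continuous_DpH_W (hD : HasContinuousDerivatives P W DxW DmW DymW DxmW DmmW)
    (hH : ContDiff ℝ 1 fun q : E d × E d => H q.1 q.2) (m : P2 d) :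
    Continuous fun x => DpH H (W x m) x :=
  (continuous_DpH hH).comp ((hD.continuous_W m).prodMk continuous_id)

lemma continuous_H_W (hD : HasContinuousDerivatives P W DxW DmW DymW DxmW DmmW)
    (hH : ContDiff ℝ 1 fun q : E d × E d => H q.1 q.2) (m : P2 d) :
    Continuous fun x => H (W x m) x :=
  hH.continuous.comp ((hD.continuous_W m).prodMk continuous_id)

lemma continuous_F_left (hF : Continuous fun q : E d × P1 d => F q.1 q.2) (m : P1 d) :
    Continuous fun x => F x m :=
  hF.comp (by fun_prop : Continuous fun x : E d => (x, m))

/-- The inequality that defines weak solutions, tested with the regular subdifferential of `Ŵ` and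
freed from the density term. -/
lemma IsWeakSolution.inequality_of_bounded (hW : IsWeakSolution P β H F W)
    (hH : ContDiff ℝ 1 fun q : E d × E d => H q.1 q.2)
    (hF : Continuous fun q : E d × P1 d => F q.1 q.2)
    (hD : HasContinuousDerivatives P W DxW DmW DymW DxmW DmmW)
    {X Y : L2 d P} {R : ℝ} (hX : ∀ᵐ ω ∂P, ‖X ω‖ ≤ R) (hY : ∀ᵐ ω ∂P, ‖Y ω‖ ≤ R)
    (hac : X ∈ Linfac d P) {g : L2 d P} {Cg : ℝ} (hCg : 0 ≤ Cg)
    (hg : ∀ X' ∈ Linfac d P, ⟪g, X' - X⟫_ℝ - Cg * ‖X' - X‖ ^ 2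
      ≤ (densSup (law X')).toReal - (densSup (law X)).toReal) :
    0 ≤ What W (WithLp.toLp 2 (X, Y))
      - β * tr (diagHess DxW X Y (law X) + segHess DymW DxmW DmmW X Y (law X))
      - ∫ ω, (F (X ω) (law X).toP1 - F (Y ω) (law X).toP1) ∂P
      + ∫ ω, (H (W (X ω) (law X)) (X ω) - H (W (Y ω) (law X)) (Y ω)) ∂P
      + ∫ ω, ⟪crossGrad DmW X Y (law X) (X ω), DpH H (W (X ω) (law X)) (X ω)⟫_ℝ ∂P := by
  obtain ⟨Cw, hCw⟩ := hW.bounded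
  obtain ⟨C, hC, hineq⟩ := hW.inequality
  set m := law X with hm
  have iF : Integrable (fun ω => F (X ω) m.toP1 - F (Y ω) m.toP1) P :=
    (integrable_comp_of_bound (continuous_F_left hF _) hX).sub
      (integrable_comp_of_bound (continuous_F_left hF _) hY)
  have iH : Integrable (fun ω => H (W (X ω) m) (X ω) - H (W (Y ω) m) (Y ω)) P :=
    (integrable_comp_of_bound (continuous_H_W hD hH m) hX).sub
      (integrable_comp_of_bound (continuous_H_W hD hH m) hY)
  -- the drift, as an element of `L²`
  have hDp : MemLp (fun ω => DpH H (W (X ω) m) (X ω)) 2 P := by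
    have hc := continuous_DpH_W hD hH m
    obtain ⟨B, hB⟩ :=
      (isCompact_closedBall (0 : E d) R).exists_bound_of_continuousOn hc.continuousOn
    refine .of_bound (hc.comp_aestronglyMeasurable (Lp.aestronglyMeasurable X)) B ?_
    filter_upwards [hX] with ω hω using hB _ (by simpa using hω)
  have hinner : ∀ u : L2 d P, Integrable (fun ω => ⟪u ω, DpH H (W (X ω) m) (X ω)⟫_ℝ) P := by
    intro u
    refine (L2.integrable_inner (𝕜 := ℝ) u hDp.toLp).congr ?_
    filter_upwards [hDp.coeFn_toLp] with ω hω
    rw [hω]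
  have hcr := memLp_crossGrad hD m hX hY
  have icr : Integrable (fun ω => ⟪crossGrad DmW X Y m (X ω), DpH H (W (X ω) m) (X ω)⟫_ℝ) P := by
    refine (hinner hcr.toLp).congr ?_
    filter_upwards [hcr.coeFn_toLp] with ω hω
    rw [hω]
  have main : ∀ ε η : ℝ, 0 < ε → ε < 1 → 0 < η →
      0 ≤ (What W (WithLp.toLp 2 (X, Y))
      - β * tr (diagHess DxW X Y m + segHess DymW DxmW DmmW X Y m)
      - ∫ ω, (F (X ω) m.toP1 - F (Y ω) m.toP1) ∂P
      + ∫ ω, (H (W (X ω) m) (X ω) - H (W (Y ω) m) (Y ω)) ∂P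
      + ∫ ω, ⟪crossGrad DmW X Y m (X ω), DpH H (W (X ω) m) (X ω)⟫_ℝ ∂P)
      + η * (2 * d * β) + ε * (4 * Cg * d * β + ∫ ω, ⟪g ω, DpH H (W (X ω) m) (X ω)⟫_ℝ ∂P
        + C * (1 + (densSup m).toReal)) := by
    intro ε η hε hε1 hη
    obtain ⟨C', hJ⟩ := mem_subjet_WhatEps hD hCw hW.irrotational hX hY hCg hg hε hη
    have hWX := memLp_W_comp hD hCw m X
    have hWY := memLp_W_comp hD hCw m Y
    have eH : (fun ω => H (W (X ω) m) (X ω) - H (-(-hWY.toLp : L2 d P) ω) (Y ω))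
        =ᵐ[P] fun ω => H (W (X ω) m) (X ω) - H (W (Y ω) m) (Y ω) := by
      filter_upwards [Lp.coeFn_neg hWY.toLp, hWY.coeFn_toLp] with ω h1 h2
      rw [h1, Pi.neg_apply, h2, neg_neg]
    have eI : (fun ω => ⟪W (X ω) m - (hWX.toLp + hcr.toLp + ε • g : L2 d P) ω,
        DpH H (W (X ω) m) (X ω)⟫_ℝ) =ᵐ[P] fun ω =>
        -(⟪crossGrad DmW X Y m (X ω), DpH H (W (X ω) m) (X ω)⟫_ℝ
          + ε * ⟪g ω, DpH H (W (X ω) m) (X ω)⟫_ℝ) := by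
      filter_upwards [Lp.coeFn_add (hWX.toLp + hcr.toLp) (ε • g), Lp.coeFn_add hWX.toLp hcr.toLp,
        Lp.coeFn_smul ε g, hWX.coeFn_toLp, hcr.coeFn_toLp] with ω h1 h2 h3 h4 h5
      rw [h1, Pi.add_apply, h2, Pi.add_apply, h3, Pi.smul_apply, h4, h5, ← real_inner_smul_left,
        ← inner_add_left, ← inner_neg_left]
      congr 1
      abel
    have iI : Integrable (fun ω => ⟪crossGrad DmW X Y m (X ω), DpH H (W (X ω) m) (X ω)⟫_ℝ
          + ε * ⟪g ω, DpH H (W (X ω) m) (X ω)⟫_ℝ) P := icr.add ((hinner g).const_mul ε)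
    have hdom : (WithLp.toLp 2 (X, Y) : L2L2 d P) ∈ dom d P := hac
    have := hineq X hac Y ε ⟨hε, hε1⟩ _ _ _ (subjet_subset_subjetClosure hdom hJ) iF
      (iH.congr eH.symm) (iI.neg.congr eI.symm)
    rw [integral_congr_ae eH, integral_congr_ae eI, integral_neg, integral_add icr
      ((hinner g).const_mul ε), integral_const_mul, Lam_meanForm, ← hm] at this
    linarith
  set A := What W (WithLp.toLp 2 (X, Y))
      - β * tr (diagHess DxW X Y m + segHess DymW DxmW DmmW X Y m)
      - ∫ ω, (F (X ω) m.toP1 - F (Y ω) m.toP1) ∂P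
      + ∫ ω, (H (W (X ω) m) (X ω) - H (W (Y ω) m) (Y ω)) ∂P
      + ∫ ω, ⟪crossGrad DmW X Y m (X ω), DpH H (W (X ω) m) (X ω)⟫_ℝ ∂P
  set B₁ := 2 * d * β
  set B₂ := 4 * Cg * d * β + ∫ ω, ⟪g ω, DpH H (W (X ω) m) (X ω)⟫_ℝ ∂P
        + C * (1 + (densSup m).toReal)
  have hlim : Tendsto (fun ε : ℝ => A + ε * B₁ + ε * B₂) (𝓝[>] 0) (𝓝 A) := by
    have : Tendsto (fun ε : ℝ => A + ε * B₁ + ε * B₂) (𝓝 0) (𝓝 (A + 0 * B₁ + 0 * B₂)) := by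
      refine Continuous.tendsto ?_ 0
      fun_prop
    simp only [zero_mul, add_zero] at this
    exact this.mono_left nhdsWithin_le_nhds
  refine ge_of_tendsto hlim ?_
  filter_upwards [Ioo_mem_nhdsGT one_pos] with ε hε using main ε ε hε.1 hε.2 hε.1

end Inequality

/-! ### The defect of the master equation and its continuity -/

section Flux

variable {Ω : Type*} [MeasurableSpace Ω] {P : Measure Ω} [IsProbabilityMeasure P] {d : ℕ}
  {W : E d → P2 d → E d} {DxW : E d → P2 d → E d →L[ℝ] E d}
  {DmW : Fin d → E d → P2 d → E d → E d} {DymW DxmW : Fin d → E d → P2 d → E d → E d →L[ℝ] E d}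
  {DmmW : Fin d → Fin d → E d → P2 d → E d → E d → E d}
  {β : ℝ} {H : E d → E d → ℝ} {F : E d → P1 d → ℝ}

/-- Dominated convergence, with dominating functions that converge in `L¹`. -/
lemma tendsto_integral_of_dominated_add {f : ℕ → Ω → ℝ} {f₀ G : Ω → ℝ} {r : ℕ → Ω → ℝ}
    (hf : ∀ n, AEStronglyMeasurable (f n) P) (hG : Integrable G P) (hr : ∀ n, Integrable (r n) P)
    (hb : ∀ n, ∀ᵐ ω ∂P, |f n ω| ≤ G ω + r n ω) (hr0 : ∀ n ω, 0 ≤ r n ω)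
    (hr1 : Tendsto (fun n => ∫ ω, r n ω ∂P) atTop (𝓝 0))
    (hlim : ∀ᵐ ω ∂P, Tendsto (fun n => f n ω) atTop (𝓝 (f₀ ω))) (h0 : ∀ᵐ ω ∂P, |f₀ ω| ≤ G ω) :
    Tendsto (fun n => ∫ ω, f n ω ∂P) atTop (𝓝 (∫ ω, f₀ ω ∂P)) := by
  -- truncate at level `G`
  set c : ℕ → Ω → ℝ := fun n ω => max (-G ω) (min (G ω) (f n ω)) with hc
  have hG0 : ∀ᵐ ω ∂P, 0 ≤ G ω := h0.mono fun ω h => (abs_nonneg _).trans h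
  have hcm : ∀ n, AEStronglyMeasurable (c n) P := fun n => hG.1.neg.sup (hG.1.inf (hf n))
  have hcb : ∀ n, ∀ᵐ ω ∂P, ‖c n ω‖ ≤ G ω := fun n => hG0.mono fun ω h => by
    rw [Real.norm_eq_abs, abs_le]
    exact ⟨le_max_left _ _, max_le (by linarith) (min_le_left _ _)⟩
  have h1 : Tendsto (fun n => ∫ ω, c n ω ∂P) atTop (𝓝 (∫ ω, f₀ ω ∂P)) := by
    refine tendsto_integral_of_dominated_convergence G hcm hG hcb ?_
    filter_upwards [hlim, h0] with ω h h'
    have : f₀ ω = max (-G ω) (min (G ω) (f₀ ω)) := by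
      rw [abs_le] at h'
      rw [min_eq_right h'.2, max_eq_right h'.1]
    rw [this]
    exact tendsto_const_nhds.max (tendsto_const_nhds.min h)
  have h2 : Tendsto (fun n => ∫ ω, (f n ω - c n ω) ∂P) atTop (𝓝 0) := by
    refine squeeze_zero_norm (fun n => ?_) hr1
    refine norm_integral_le_of_norm_le (hr n) ?_
    filter_upwards [hb n, hG0] with ω h hg
    rw [Real.norm_eq_abs]
    have := hr0 n ω
    simp only [hc]
    rw [abs_le] at h ⊢
    rcases le_total (G ω) (f n ω) with h3 | h3
    · rw [min_eq_left h3, max_eq_right (by linarith)]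
      constructor <;> linarith
    · rw [min_eq_right h3]
      rcases le_total (-G ω) (f n ω) with h4 | h4
      · rw [max_eq_right h4]; constructor <;> linarith
      · rw [max_eq_left h4]; constructor <;> linarith
  have hfi : ∀ n, Integrable (f n) P := fun n => (hG.add (hr n)).mono' (hf n) (hb n)
  have hci : ∀ n, Integrable (c n) P := fun n => hG.mono' (hcm n) (hcb n)
  have := h1.add h2
  rw [add_zero] at this
  refine this.congr fun n => ?_
  rw [integral_sub (hfi n) (hci n), add_sub_cancel]

/-- The transport term `∫ D_m W_i(x, m, y) ⬝ D_p H(W(y, m), y) m(dy)`. -/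
noncomputable def transport (H : E d → E d → ℝ) (W : E d → P2 d → E d)
    (DmW : Fin d → E d → P2 d → E d → E d) (i : Fin d) (x : E d) (m : P2 d) : ℝ :=
  ∫ y, ⟪DmW i x m y, DpH H (W y m) y⟫_ℝ ∂m.meas

/-- The vector field whose `i`-th coordinate collects the terms of the `i`-th equation of the master
equation, other than `F_{x_i}`, that are not derivatives of a function of `x`. -/
noncomputable def flux (β : ℝ) (H : E d → E d → ℝ) (W : E d → P2 d → E d)
    (DmW : Fin d → E d → P2 d → E d → E d)
    (DymW DxmW : Fin d → E d → P2 d → E d → E d →L[ℝ] E d)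
    (DmmW : Fin d → Fin d → E d → P2 d → E d → E d → E d) (x : E d) (m : P2 d) : E d :=
  WithLp.toLp 2 fun i =>
    W x m i + transport H W DmW i x m - β * tr (secondOp DymW DxmW DmmW i x m)

/-- The function `-β div W + H(W, x) - F`, whose gradient is the rest of the master equation. -/
noncomputable def scalarPart (β : ℝ) (H : E d → E d → ℝ) (F : E d → P1 d → ℝ)
    (W : E d → P2 d → E d) (DxW : E d → P2 d → E d →L[ℝ] E d) (x : E d) (m : P2 d) : ℝ :=
  -β * tr (DxW x m) + H (W x m) x - F x m.toP1

/-- The master equation, integrated along the segment from `y` to `x`. -/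
noncomputable def defect (β : ℝ) (H : E d → E d → ℝ) (F : E d → P1 d → ℝ)
    (W : E d → P2 d → E d) (DxW : E d → P2 d → E d →L[ℝ] E d)
    (DmW : Fin d → E d → P2 d → E d → E d)
    (DymW DxmW : Fin d → E d → P2 d → E d → E d →L[ℝ] E d)
    (DmmW : Fin d → Fin d → E d → P2 d → E d → E d → E d) (x y : E d) (m : P2 d) : ℝ :=
  (∫ t in (0 : ℝ)..1, ⟪flux β H W DmW DymW DxmW DmmW ((1 - t) • x + t • y) m, x - y⟫_ℝ)
    + (scalarPart β H F W DxW x m - scalarPart β H F W DxW y m)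

/-- On the set `S` of random variables `X`, the drift `D_p H(W(X, ℒ(X)), X)` has linear growth. -/
def HasGrowthOn (H : E d → E d → ℝ) (W : E d → P2 d → E d) (S : Set (L2 d P)) : Prop :=
  ∃ C, 0 ≤ C ∧ ∀ X ∈ S, ∀ᵐ ω ∂P, ‖DpH H (W (X ω) (law X)) (X ω)‖ ≤ C * (1 + ‖X ω‖)

namespace HasContinuousDerivatives

lemma continuous_DmW (hD : HasContinuousDerivatives P W DxW DmW DymW DxmW DmmW) (i : Fin d)
    (x : E d) (m : P2 d) : Continuous (DmW i x m) :=
  (hD.cont_m i).comp (by fun_prop : Continuous fun y : E d => (x, m, y))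

lemma transport_law (hD : HasContinuousDerivatives P W DxW DmW DymW DxmW DmmW)
    (hH : ContDiff ℝ 1 fun q : E d × E d => H q.1 q.2) (i : Fin d) (x : E d) (X : L2 d P) :
    transport H W DmW i x (law X)
      = ∫ ω, ⟪DmW i x (law X) (X ω), DpH H (W (X ω) (law X)) (X ω)⟫_ℝ ∂P := by
  rw [transport, law_meas, integral_map (aemeasurable_coe X)
    ((hD.continuous_DmW i x _).inner (continuous_DpH_W hD hH _)).aestronglyMeasurable]

/-- `D_m W` grows at most linearly in its last variable. -/
lemma norm_DmW_le (hD : HasContinuousDerivatives P W DxW DmW DymW DxmW DmmW)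
    (X : L2 d P) (R : ℝ) :
    ∃ C, 0 ≤ C ∧ ∃ δ > 0, ∀ i, ∀ Z : L2 d P, ‖Z - X‖ < δ → ∀ x, ‖x‖ ≤ R → ∀ y,
      ‖DmW i x (law Z) y‖ ≤ ‖DmW i x (law Z) 0‖ + C * ‖y‖ := by
  obtain ⟨C, hC, δ, hδ, h⟩ := hD.exists_bound X R
  refine ⟨C, hC, δ, hδ, fun i Z hZ x hx y => ?_⟩
  have := convex_univ.norm_image_sub_le_of_norm_hasFDerivWithin_le (𝕜 := ℝ) (C := C)
    (fun z _ => (hD.deriv_ym i x (law Z) z).hasFDerivWithinAt)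
    (fun z _ => (h i i Z hZ x hx z z).1) (mem_univ (0 : E d)) (mem_univ y)
  rw [sub_zero] at this
  have h2 := norm_sub_norm_le (DmW i x (law Z) y) (DmW i x (law Z) 0)
  linarith

/-- The transport term is continuous, since its integrand has at most quadratic growth. -/
lemma continuousOn_transport (hD : HasContinuousDerivatives P W DxW DmW DymW DxmW DmmW)
    (hH : ContDiff ℝ 1 fun q : E d × E d => H q.1 q.2) {S : Set (L2 d P)}
    (hS : HasGrowthOn H W S) (i : Fin d) :
    ContinuousOn (fun p : E d × L2 d P => transport H W DmW i p.1 (law p.2)) (univ ×ˢ S) := by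
  obtain ⟨A, hA, hgr⟩ := hS
  refine continuousOn_of_tendsto_ae fun xn Xn x X hXn hXS hx hX hae => ?_
  simp only [hD.transport_law hH]
  obtain ⟨C, hC, δ, hδ, hb⟩ := hD.norm_DmW_le X (‖x‖ + 1)
  have hlaw : Tendsto (fun n => law (Xn n)) atTop (𝓝 (law X)) := (continuous_law.tendsto X).comp hX
  have hDm : ∀ (yn : ℕ → E d) y, Tendsto yn atTop (𝓝 y) →
      Tendsto (fun n => DmW i (xn n) (law (Xn n)) (yn n)) atTop (𝓝 (DmW i x (law X) y)) :=
    fun yn y hy => ((hD.cont_m i).tendsto (x, law X, y)).comp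
      (hx.prodMk_nhds (hlaw.prodMk_nhds hy))
  set B := ‖DmW i x (law X) 0‖ + 1 + C with hB
  have hB0 : 0 ≤ B := by positivity
  have hev : ∀ᶠ n in atTop, ∀ y, ‖DmW i (xn n) (law (Xn n)) y‖ ≤ B * (1 + ‖y‖) := by
    have e1 : ∀ᶠ n in atTop, ‖Xn n - X‖ < δ := by
      have := Metric.tendsto_nhds.1 hX δ hδ
      simpa only [dist_eq_norm] using this
    have e2 : ∀ᶠ n in atTop, ‖xn n‖ ≤ ‖x‖ + 1 :=
      hx.norm.eventually (eventually_le_nhds (by linarith))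
    have e3 : ∀ᶠ n in atTop, ‖DmW i (xn n) (law (Xn n)) 0‖ ≤ ‖DmW i x (law X) 0‖ + 1 :=
      (hDm _ _ tendsto_const_nhds).norm.eventually (eventually_le_nhds (by linarith))
    filter_upwards [e1, e2, e3] with n h1 h2 h3 y
    refine (hb i (Xn n) h1 (xn n) h2 y).trans ?_
    rw [hB]
    nlinarith [norm_nonneg y, norm_nonneg (DmW i x (law X) 0)]
  have hev0 : ∀ y, ‖DmW i x (law X) y‖ ≤ B * (1 + ‖y‖) := fun y => by
    refine (hb i X (by simpa using hδ) x (by linarith) y).trans ?_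
    rw [hB]
    nlinarith [norm_nonneg y, norm_nonneg (DmW i x (law X) 0)]
  obtain ⟨N, hN⟩ := eventually_atTop.1 hev
  rw [← tendsto_add_atTop_iff_nat N]
  have hquad : ∀ {u v : E d} {s : ℝ}, 0 ≤ s → ‖u‖ ≤ B * (1 + s) → ‖v‖ ≤ A * (1 + s) →
      |⟪u, v⟫_ℝ| ≤ 2 * (A * B) * (1 + s ^ 2) := by
    intro u v s hs hu hv
    refine (abs_real_inner_le_norm _ _).trans ((mul_le_mul hu hv (norm_nonneg _)
      (by positivity)).trans ?_)
    nlinarith [mul_nonneg (mul_nonneg hA hB0) (sq_nonneg (1 - s))]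
  have hsq : ∀ n, Integrable (fun ω => 4 * (A * B) * ‖(Xn (n + N) - X) ω‖ ^ 2) P := fun n =>
    (integrable_norm_sq_coe _).const_mul _
  have hGi : Integrable (fun ω => 2 * (A * B) * (1 + 2 * ‖X ω‖ ^ 2)) P :=
    ((integrable_const _).add ((integrable_norm_sq_coe X).const_mul 2)).const_mul _
  refine tendsto_integral_of_dominated_add
    (r := fun n ω => 4 * (A * B) * ‖(Xn (n + N) - X) ω‖ ^ 2)
    (fun n => ((hD.continuous_DmW i _ _).inner (continuous_DpH_W hD hH _)).comp_aestronglyMeasurable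
      (Lp.aestronglyMeasurable _)) hGi hsq (fun n => ?_) (fun n ω => by positivity) ?_ ?_ ?_
  · filter_upwards [hgr _ (hXn (n + N)), Lp.coeFn_sub (Xn (n + N)) X] with ω h1 h2
    refine (hquad (norm_nonneg (Xn (n + N) ω)) (hN _ (Nat.le_add_left _ _) _) h1).trans ?_
    have h3 : ‖Xn (n + N) ω‖ ^ 2 ≤ 2 * ‖X ω‖ ^ 2 + 2 * ‖(Xn (n + N) - X) ω‖ ^ 2 := by
      have : ‖Xn (n + N) ω‖ ≤ ‖X ω‖ + ‖(Xn (n + N) - X) ω‖ := by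
        rw [h2, Pi.sub_apply]
        simpa using norm_add_le (X ω) (Xn (n + N) ω - X ω)
      nlinarith [norm_nonneg (Xn (n + N) ω), sq_nonneg (‖X ω‖ - ‖(Xn (n + N) - X) ω‖)]
    nlinarith [mul_le_mul_of_nonneg_left h3 (mul_nonneg hA hB0)]
  · simp only [integral_const_mul, ← norm_sq_eq_integral]
    have h1 : Tendsto (fun n => ‖Xn (n + N) - X‖) atTop (𝓝 0) := by
      have := (tendsto_iff_norm_sub_tendsto_zero.1 hX)
      exact this.comp (tendsto_add_atTop_nat N)
    have h2 := (h1.pow 2).const_mul (4 * (A * B))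
    simpa using h2
  · filter_upwards [hae] with ω hω
    have hω' := hω.comp (tendsto_add_atTop_nat N)
    have t1 := (hDm _ _ hω).comp (tendsto_add_atTop_nat N)
    have hWc : Tendsto (fun n => W (Xn (n + N) ω) (law (Xn (n + N)))) atTop
        (𝓝 (W (X ω) (law X))) :=
      (hD.cont_W.tendsto (X ω, law X)).comp
        (hω'.prodMk_nhds (hlaw.comp (tendsto_add_atTop_nat N)))
    have t2 := ((continuous_DpH hH).tendsto (W (X ω) (law X), X ω)).comp (hWc.prodMk_nhds hω')
    exact t1.inner t2
  · filter_upwards [hgr X hXS] with ω h1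
    refine (hquad (norm_nonneg (X ω)) (hev0 _) h1).trans ?_
    nlinarith [mul_nonneg (mul_nonneg hA hB0) (sq_nonneg ‖X ω‖)]

lemma continuous_flux (hD : HasContinuousDerivatives P W DxW DmW DymW DxmW DmmW)
    (hH : ContDiff ℝ 1 fun q : E d × E d => H q.1 q.2) {S : Set (L2 d P)}
    (hS : HasGrowthOn H W S) :
    Continuous fun p : E d × S => flux β H W DmW DymW DxmW DmmW p.1 (law p.2.1) := by
  have hι : Continuous fun p : E d × S => (p.1, (p.2 : L2 d P)) := by fun_prop
  refine (PiLp.continuous_toLp 2 _).comp (continuous_pi fun i => ?_)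
  have h1 : Continuous fun p : E d × S => W p.1 (law p.2.1) i := by
    have := hD.cont_W.comp (continuous_fst.prodMk (continuous_law.comp
      (continuous_subtype_val.comp continuous_snd)) : Continuous fun p : E d × S => (p.1, law p.2.1))
    exact (EuclideanSpace.proj (𝕜 := ℝ) i).continuous.comp this
  have h2 : Continuous fun p : E d × S => transport H W DmW i p.1 (law p.2.1) :=
    (hD.continuousOn_transport hH hS i).comp_continuous hι fun p => ⟨mem_univ _, p.2.2⟩
  have h3 := (hD.continuous_secondOp i).comp hι
  simp only [Function.comp_def] at h3
  exact (h1.add h2).sub (continuous_const.mul (continuous_tr.comp h3))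

lemma continuous_scalarPart (hD : HasContinuousDerivatives P W DxW DmW DymW DxmW DmmW)
    (hH : ContDiff ℝ 1 fun q : E d × E d => H q.1 q.2)
    (hF : Continuous fun q : E d × P1 d => F q.1 q.2) :
    Continuous fun p : E d × L2 d P => scalarPart β H F W DxW p.1 (law p.2) := by
  have hl : Continuous fun p : E d × L2 d P => (p.1, law p.2) :=
    continuous_fst.prodMk (continuous_law.comp continuous_snd)
  have h1 := continuous_tr.comp (hD.cont_x.comp hl)
  have h2 := hH.continuous.comp ((hD.cont_W.comp hl).prodMk continuous_fst)
  have h3 := hF.comp (continuous_fst.prodMk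
    (continuous_toP1.comp (continuous_law.comp continuous_snd)) :
      Continuous fun p : E d × L2 d P => (p.1, (law p.2).toP1))
  simp only [Function.comp_def] at h1 h2 h3
  exact ((continuous_const.mul h1).add h2).sub h3

lemma continuous_defect (hD : HasContinuousDerivatives P W DxW DmW DymW DxmW DmmW)
    (hH : ContDiff ℝ 1 fun q : E d × E d => H q.1 q.2)
    (hF : Continuous fun q : E d × P1 d => F q.1 q.2) {S : Set (L2 d P)}
    (hS : HasGrowthOn H W S) :
    Continuous fun p : (E d × E d) × S =>
      defect β H F W DxW DmW DymW DxmW DmmW p.1.1 p.1.2 (law p.2.1) := by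
  have hf := hD.continuous_flux (β := β) hH hS
  have hs := hD.continuous_scalarPart (β := β) hH hF
  have h1 : Continuous fun q : ((E d × E d) × S) × ℝ =>
      flux β H W DmW DymW DxmW DmmW ((1 - q.2) • q.1.1.1 + q.2 • q.1.1.2) (law q.1.2.1) :=
    hf.comp (by fun_prop : Continuous fun q : ((E d × E d) × S) × ℝ =>
      ((1 - q.2) • q.1.1.1 + q.2 • q.1.1.2, q.1.2))
  have h2 : Continuous fun q : ((E d × E d) × S) × ℝ =>
      ⟪flux β H W DmW DymW DxmW DmmW ((1 - q.2) • q.1.1.1 + q.2 • q.1.1.2) (law q.1.2.1),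
        q.1.1.1 - q.1.1.2⟫_ℝ := h1.inner (by fun_prop)
  have h3 := intervalIntegral.continuous_parametric_intervalIntegral_of_continuous'
    (μ := volume) (f := fun (p : (E d × E d) × S) (t : ℝ) =>
      ⟪flux β H W DmW DymW DxmW DmmW ((1 - t) • p.1.1 + t • p.1.2) (law p.2.1),
        p.1.1 - p.1.2⟫_ℝ) h2 0 1
  have h4 := hs.comp (by fun_prop : Continuous fun p : (E d × E d) × S => (p.1.1, (p.2 : L2 d P)))
  have h5 := hs.comp (by fun_prop : Continuous fun p : (E d × E d) × S => (p.1.2, (p.2 : L2 d P)))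
  simp only [Function.comp_def] at h4 h5
  exact h3.add (h4.sub h5)

end HasContinuousDerivatives

end Flux

/-! ### The weak inequality as an integral of the defect -/

section Defect

variable {Ω : Type*} [MeasurableSpace Ω] {P : Measure Ω} [IsProbabilityMeasure P] {d : ℕ}
  {W : E d → P2 d → E d} {DxW : E d → P2 d → E d →L[ℝ] E d}
  {DmW : Fin d → E d → P2 d → E d → E d} {DymW DxmW : Fin d → E d → P2 d → E d → E d →L[ℝ] E d}
  {DmmW : Fin d → Fin d → E d → P2 d → E d → E d → E d}
  {β : ℝ} {H : E d → E d → ℝ} {F : E d → P1 d → ℝ}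

/-- The integral of a continuous vector field over the random segment from `Y` to `X`. -/
lemma integral_segMeas {w : E d → E d} (hw : Continuous w) {X Y : L2 d P} {R : ℝ}
    (hX : ∀ᵐ ω ∂P, ‖X ω‖ ≤ R) (hY : ∀ᵐ ω ∂P, ‖Y ω‖ ≤ R) :
    Integrable (fun q => ⟪w (seg X Y q), X q.1 - Y q.1⟫_ℝ) (segMeas P) ∧
    ∫ q, ⟪w (seg X Y q), X q.1 - Y q.1⟫_ℝ ∂segMeas P
      = ∫ ω, (∫ t in (0 : ℝ)..1, ⟪w ((1 - t) • X ω + t • Y ω), X ω - Y ω⟫_ℝ) ∂P := by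
  have hm : Measurable fun q : Ω × ℝ => X q.1 - Y q.1 :=
    ((measurable_coe X).comp measurable_fst).sub ((measurable_coe Y).comp measurable_fst)
  obtain ⟨B, hB⟩ := (isCompact_closedBall (0 : E d) R).exists_bound_of_continuousOn hw.continuousOn
  have hi : Integrable (fun q => ⟪w (seg X Y q), X q.1 - Y q.1⟫_ℝ) (segMeas P) := by
    refine .of_bound ((hw.measurable.comp (measurable_seg X Y)).inner hm).aestronglyMeasurable
      (B * (2 * R)) ?_
    filter_upwards [ae_segMeas_bound hX hY, Measure.quasiMeasurePreserving_fst.ae hX,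
      Measure.quasiMeasurePreserving_fst.ae hY] with q hq h1 h2
    have hB' := hB (seg X Y q) (by simpa using hq.1)
    exact (norm_inner_le_norm _ _).trans (mul_le_mul hB' ((norm_sub_le _ _).trans (by linarith))
      (norm_nonneg _) ((norm_nonneg _).trans hB'))
  refine ⟨hi, ?_⟩
  rw [segMeas, integral_prod _ hi]
  refine integral_congr_ae (ae_of_all _ fun ω => ?_)
  simp only [intervalIntegral.integral_of_le zero_le_one, seg]

/-- A continuous function of two bounded random variables is integrable. -/
lemma integrable_comp₂_of_bound {f : E d × E d → ℝ} (hf : Continuous f)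
    {X Y : L2 d P} {R : ℝ} (hX : ∀ᵐ ω ∂P, ‖X ω‖ ≤ R) (hY : ∀ᵐ ω ∂P, ‖Y ω‖ ≤ R) :
    Integrable (fun ω => f (X ω, Y ω)) P := by
  obtain ⟨B, hB⟩ := ((isCompact_closedBall (0 : E d) R).prod
    (isCompact_closedBall (0 : E d) R)).exists_bound_of_continuousOn hf.continuousOn
  refine .of_bound (hf.comp_aestronglyMeasurable
    ((Lp.aestronglyMeasurable X).prodMk (Lp.aestronglyMeasurable Y))) B ?_
  filter_upwards [hX, hY] with ω h1 h2 using hB _ ⟨by simpa using h1, by simpa using h2⟩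

lemma hasGrowthOn_bounded (hH : ContDiff ℝ 1 fun q : E d × E d => H q.1 q.2) {Cw : ℝ}
    (hCw : ∀ x m, ‖W x m‖ ≤ Cw) (R : ℝ) : HasGrowthOn H W {X : L2 d P | ∀ᵐ ω ∂P, ‖X ω‖ ≤ R} := by
  obtain ⟨B, hB⟩ := ((isCompact_closedBall (0 : E d) Cw).prod
    (isCompact_closedBall (0 : E d) R)).exists_bound_of_continuousOn (continuous_DpH hH).continuousOn
  refine ⟨max B 0, le_max_right _ _, fun X hX => ?_⟩
  filter_upwards [hX] with ω hω
  have := hB (W (X ω) (law X), X ω) ⟨by simpa using hCw _ _, by simpa using hω⟩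
  refine (this.trans (le_max_left _ 0)).trans (le_mul_of_one_le_right (le_max_right _ _) ?_)
  linarith [norm_nonneg (X ω)]

lemma LinearGrowth.hasGrowthOn_univ (hL : LinearGrowth H) {Cw : ℝ} (hCw : ∀ x m, ‖W x m‖ ≤ Cw) :
    HasGrowthOn H W (univ : Set (L2 d P)) := by
  obtain ⟨C, hC⟩ := hL Cw
  refine ⟨max C 0, le_max_right _ _, fun X _ => ae_of_all _ fun ω => ?_⟩
  exact (hC _ _ (hCw _ _)).trans (mul_le_mul_of_nonneg_right (le_max_left _ _) (by positivity))

namespace HasContinuousDerivatives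

/-- The flux collects the terms of the inequality that are integrals over segments. -/
lemma integral_flux (hD : HasContinuousDerivatives P W DxW DmW DymW DxmW DmmW)
    (hH : ContDiff ℝ 1 fun q : E d × E d => H q.1 q.2)
    {X Y : L2 d P} {R : ℝ} (hX : ∀ᵐ ω ∂P, ‖X ω‖ ≤ R) (hY : ∀ᵐ ω ∂P, ‖Y ω‖ ≤ R) :
    ∫ q, ⟪flux β H W DmW DymW DxmW DmmW (seg X Y q) (law X), X q.1 - Y q.1⟫_ℝ ∂segMeas P
      = What W (WithLp.toLp 2 (X, Y))
        + ∫ ω, ⟪crossGrad DmW X Y (law X) (X ω), DpH H (W (X ω) (law X)) (X ω)⟫_ℝ ∂P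
        - β * tr (segHess DymW DxmW DmmW X Y (law X)) := by
  obtain ⟨i1, e1⟩ := integral_segMeas (hD.continuous_W (law X)) hX hY
  have hDp : Integrable (fun ω => DpH H (W (X ω) (law X)) (X ω)) P :=
    integrable_comp_of_bound (continuous_DpH_W hD hH _) hX
  obtain ⟨i2, e2⟩ := hD.integral_inner_crossGrad (law X) hX hY hDp
  obtain ⟨i3, e3⟩ := integral_sum_smul_clm (fun i => hD.integrable_segHess X hX hY i) trL
  simp only [trL_apply] at i3 e3
  rw [← segHess] at e3
  have : What W (WithLp.toLp 2 (X, Y))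
      = ∫ q, ⟪W (seg X Y q) (law X), X q.1 - Y q.1⟫_ℝ ∂segMeas P := e1.symm
  rw [this, e2, e3, ← integral_const_mul, ← integral_add i1 i2]
  have i12 := i1.add i2
  simp only [Pi.add_def] at i12
  rw [← integral_sub i12 (i3.const_mul β)]
  refine integral_congr_ae (ae_of_all _ fun q => ?_)
  simp only [hD.transport_law hH, flux]
  rw [real_inner_eq_sum, real_inner_eq_sum (W _ _), Finset.mul_sum, ← Finset.sum_add_distrib, ← Finset.sum_sub_distrib]
  exact Finset.sum_congr rfl fun i _ => by ring

/-- The scalar part collects the terms of the inequality that are local. -/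
lemma integral_scalarPart (hD : HasContinuousDerivatives P W DxW DmW DymW DxmW DmmW)
    (hH : ContDiff ℝ 1 fun q : E d × E d => H q.1 q.2)
    (hF : Continuous fun q : E d × P1 d => F q.1 q.2) (m : P2 d)
    {X Y : L2 d P} {R : ℝ} (hX : ∀ᵐ ω ∂P, ‖X ω‖ ≤ R) (hY : ∀ᵐ ω ∂P, ‖Y ω‖ ≤ R) :
    Integrable (fun ω => scalarPart β H F W DxW (X ω) m - scalarPart β H F W DxW (Y ω) m) P ∧
    ∫ ω, (scalarPart β H F W DxW (X ω) m - scalarPart β H F W DxW (Y ω) m) ∂P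
      = -β * tr (diagHess DxW X Y m) + ∫ ω, (H (W (X ω) m) (X ω) - H (W (Y ω) m) (Y ω)) ∂P
        - ∫ ω, (F (X ω) m.toP1 - F (Y ω) m.toP1) ∂P := by
  have l1 := hD.integrable_DxW_comp m hX
  have l2 := hD.integrable_DxW_comp m hY
  have l3 := trL.integrable_comp (l1.sub l2)
  simp only [Pi.sub_def] at l3
  have eD : tr (diagHess DxW X Y m) = ∫ ω, trL (DxW (X ω) m - DxW (Y ω) m) ∂P := by
    rw [← trL_apply, diagHess]
    exact (trL.integral_comp_comm (l1.sub l2)).symm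
  have iF : Integrable (fun ω => F (X ω) m.toP1 - F (Y ω) m.toP1) P :=
    (integrable_comp_of_bound (continuous_F_left hF _) hX).sub
      (integrable_comp_of_bound (continuous_F_left hF _) hY)
  have iH : Integrable (fun ω => H (W (X ω) m) (X ω) - H (W (Y ω) m) (Y ω)) P :=
    (integrable_comp_of_bound (continuous_H_W hD hH m) hX).sub
      (integrable_comp_of_bound (continuous_H_W hD hH m) hY)
  have iLH := (l3.const_mul (-β)).add iH
  simp only [Pi.add_def] at iLH
  constructor
  · refine (iLH.sub iF).congr (ae_of_all _ fun ω => ?_)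
    simp only [scalarPart, map_sub, trL_apply, Pi.sub_apply]
    ring
  · rw [eD, ← integral_const_mul, ← integral_add (l3.const_mul (-β)) iH, ← integral_sub iLH iF]
    refine integral_congr_ae (ae_of_all _ fun ω => ?_)
    simp only [scalarPart, map_sub, trL_apply]
    ring

end HasContinuousDerivatives

/-- The inequality that defines weak solutions, as the integral of a function of `(X, Y)`. -/
lemma IsWeakSolution.integral_defect_nonneg (hW : IsWeakSolution P β H F W)
    (hH : ContDiff ℝ 1 fun q : E d × E d => H q.1 q.2)
    (hF : Continuous fun q : E d × P1 d => F q.1 q.2)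
    (hD : HasContinuousDerivatives P W DxW DmW DymW DxmW DmmW)
    {X Y : L2 d P} {R : ℝ} (hX : ∀ᵐ ω ∂P, ‖X ω‖ ≤ R) (hY : ∀ᵐ ω ∂P, ‖Y ω‖ ≤ R)
    (hac : X ∈ Linfac d P) {g : L2 d P} {Cg : ℝ} (hCg : 0 ≤ Cg)
    (hg : ∀ X' ∈ Linfac d P, ⟪g, X' - X⟫_ℝ - Cg * ‖X' - X‖ ^ 2
      ≤ (densSup (law X')).toReal - (densSup (law X)).toReal) :
    Integrable (fun ω => defect β H F W DxW DmW DymW DxmW DmmW (X ω) (Y ω) (law X)) P ∧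
    0 ≤ ∫ ω, defect β H F W DxW DmW DymW DxmW DmmW (X ω) (Y ω) (law X) ∂P := by
  have hineq := hW.inequality_of_bounded hH hF hD hX hY hac hCg hg
  obtain ⟨Cw, hCw⟩ := hW.bounded
  have hgr := hasGrowthOn_bounded hH hCw (P := P) R
  let X' : {X : L2 d P | ∀ᵐ ω ∂P, ‖X ω‖ ≤ R} := ⟨X, hX⟩
  have hfl : Continuous fun x => flux β H W DmW DymW DxmW DmmW x (law X) := by
    have := (hD.continuous_flux (β := β) hH hgr).comp
      (by fun_prop : Continuous fun x : E d => (x, X'))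
    simpa only [Function.comp_def] using this
  have hdf : Continuous fun q : E d × E d =>
      defect β H F W DxW DmW DymW DxmW DmmW q.1 q.2 (law X) := by
    have := (hD.continuous_defect (β := β) hH hF hgr).comp
      (by fun_prop : Continuous fun q : E d × E d => (q, X'))
    simpa only [Function.comp_def] using this
  have hdi := integrable_comp₂_of_bound hdf hX hY
  refine ⟨hdi, ?_⟩
  obtain ⟨i0, e0⟩ := integral_segMeas hfl hX hY
  obtain ⟨iS, eS⟩ := hD.integral_scalarPart (β := β) hH hF (law X) hX hY
  have iseg : Integrable (fun ω => ∫ t in (0 : ℝ)..1,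
      ⟪flux β H W DmW DymW DxmW DmmW ((1 - t) • X ω + t • Y ω) (law X), X ω - Y ω⟫_ℝ) P := by
    refine (hdi.sub iS).congr (ae_of_all _ fun ω => ?_)
    simp only [defect, Pi.sub_apply, add_sub_cancel_right]
  have hfin := integral_add iseg iS
  rw [← e0, hD.integral_flux hH hX hY, eS] at hfin
  have eQ : tr (diagHess DxW X Y (law X) + segHess DymW DxmW DmmW X Y (law X))
      = tr (diagHess DxW X Y (law X)) + tr (segHess DymW DxmW DmmW X Y (law X)) := by
    rw [← trL_apply, map_add, trL_apply, trL_apply]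
  simp only [defect]
  rw [hfin]
  rw [eQ] at hineq
  linarith

end Defect

/-! ### Blurred simple random variables and localization -/

section Blur

variable {Ω : Type*} [MeasurableSpace Ω] {P : Measure Ω} [IsProbabilityMeasure P] {d : ℕ}

/-- A simple random variable is approximated by a random variable that is, given the value `v` of
the former, uniformly distributed on the ball of radius `r` around `v`. Its density is bounded, and
maximal on the ball around the most likely value. -/
lemma Atomless.exists_blur (hP : Atomless P) (s : SimpleFunc Ω (E d)) {r : ℝ} (hr : 0 < r)
    (hs : ∀ v ∈ s.range, ∀ w ∈ s.range, v ≠ w → 2 * r ≤ dist v w) :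
    ∃ Z : Ω → E d, Measurable Z ∧ (∀ᵐ ω ∂P, dist (Z ω) (s ω) < r) ∧
      ∃ (M : ℝ≥0∞) (v : E d), M ≠ ⊤ ∧ P.map Z ≤ M • volume ∧
        (P.map Z).restrict (Metric.ball v r) = M • volume.restrict (Metric.ball v r) := by
  set c : ℝ≥0∞ := volume (Metric.ball (0 : E d) r) with hc
  have hc0 : c ≠ 0 := (Metric.measure_ball_pos volume 0 hr).ne'
  have hcT : c ≠ ⊤ := measure_ball_lt_top.ne
  have hcv : ∀ v : E d, volume (Metric.ball v r) = c := fun v =>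
    Measure.addHaar_ball_center volume v r
  set U : E d → Measure (E d) := fun v => c⁻¹ • volume.restrict (Metric.ball v r) with hU
  have hUp : ∀ v, IsProbabilityMeasure (U v) := fun v => ⟨by
    simp [hU, hcv, ENNReal.inv_mul_cancel hc0 hcT]⟩
  choose Z₀ hZ₀ hmap using fun v => hP.exists_map_restrict_eq (U v) (s.measurableSet_fiber v)
  set Z : Ω → E d := fun ω => Z₀ (s ω) ω with hZ
  have hZm : Measurable Z := s.measurable_bind Z₀ hZ₀
  have hdisj : (s.range : Set (E d)).PairwiseDisjoint fun v => Metric.ball v r := by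
    intro v hv w hw hvw
    exact Metric.ball_disjoint_ball (by linarith [hs v hv w hw hvw])
  have hform : ∀ B, MeasurableSet B → P.map Z B
      = ∑ v ∈ s.range, P (s ⁻¹' {v}) * c⁻¹ * volume (B ∩ Metric.ball v r) := by
    intro B hB
    rw [Measure.map_apply hZm hB, ← Measure.restrict_apply_univ,
      ← s.sum_range_measure_preimage_singleton]
    refine Finset.sum_congr rfl fun v _ => ?_
    have h1 : s ⁻¹' {v} ∩ Z ⁻¹' B = Z₀ v ⁻¹' B ∩ s ⁻¹' {v} := by
      ext ω
      simp only [mem_inter_iff, mem_preimage, mem_singleton_iff, hZ]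
      constructor
      · rintro ⟨h, h'⟩; exact ⟨h ▸ h', h⟩
      · rintro ⟨h', h⟩; exact ⟨h, h ▸ h'⟩
    rw [Measure.restrict_apply (s.measurableSet_fiber v), h1, ← Measure.restrict_apply (hZ₀ v hB),
      ← Measure.map_apply (hZ₀ v) hB, hmap, Measure.smul_apply, hU, Measure.smul_apply,
      Measure.restrict_apply hB, smul_eq_mul, smul_eq_mul, mul_assoc]
  have hne : s.range.Nonempty := by
    have : Nonempty Ω := P.nonempty_of_neZero
    exact ⟨s (Classical.arbitrary Ω), s.mem_range_self _⟩
  obtain ⟨v₀, hv₀, hmax⟩ := s.range.exists_max_image (fun v => P (s ⁻¹' {v})) hne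
  refine ⟨Z, hZm, ?_, P (s ⁻¹' {v₀}) * c⁻¹, v₀,
    ENNReal.mul_ne_top (measure_ne_top _ _) (ENNReal.inv_ne_top.2 hc0), ?_, ?_⟩
  · have h1 : ∀ v ∈ s.range, ∀ᵐ ω ∂P, s ω = v → dist (Z₀ v ω) v < r := by
      intro v _
      have h2 : ∀ᵐ y ∂(P.restrict (s ⁻¹' {v})).map (Z₀ v), y ∈ Metric.ball v r := by
        rw [hmap, hU]
        exact Measure.ae_smul_measure (Measure.ae_smul_measure
          (ae_restrict_mem measurableSet_ball) _) _
      have h3 := ae_of_ae_map (hZ₀ v).aemeasurable h2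
      exact (ae_restrict_iff' (s.measurableSet_fiber v)).1 h3
    filter_upwards [(s.range.eventually_all).2 h1] with ω hω
    exact hω (s ω) (s.mem_range_self ω) rfl
  · refine Measure.le_iff.2 fun B hB => ?_
    rw [hform B hB, Measure.smul_apply, smul_eq_mul]
    calc ∑ v ∈ s.range, P (s ⁻¹' {v}) * c⁻¹ * volume (B ∩ Metric.ball v r)
        ≤ ∑ v ∈ s.range, P (s ⁻¹' {v₀}) * c⁻¹ * volume (B ∩ Metric.ball v r) := by
          exact Finset.sum_le_sum fun v hv =>
            mul_le_mul' (mul_le_mul' (hmax v hv) le_rfl) le_rfl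
      _ = P (s ⁻¹' {v₀}) * c⁻¹ * volume (⋃ v ∈ s.range, B ∩ Metric.ball v r) := by
          rw [← Finset.mul_sum, measure_biUnion_finset
            (hdisj.mono fun v => inter_subset_right) fun v _ => hB.inter measurableSet_ball]
      _ ≤ _ := by
          gcongr
          exact iUnion₂_subset fun v _ => inter_subset_left
  · refine Measure.ext fun B hB => ?_
    rw [Measure.restrict_apply hB, hform _ (hB.inter measurableSet_ball), Measure.smul_apply,
      Measure.restrict_apply hB, smul_eq_mul, Finset.sum_eq_single_of_mem v₀ hv₀]
    · rw [inter_assoc, inter_self]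
    · intro v hv hvv
      have : B ∩ Metric.ball v₀ r ∩ Metric.ball v r = ∅ := by
        rw [inter_assoc, (hdisj hv₀ hv hvv.symm).inter_eq, inter_empty]
      rw [this, measure_empty, mul_zero]

lemma eventually_separated_range (s : SimpleFunc Ω (E d)) :
    ∀ᶠ r : ℝ in 𝓝[>] 0, ∀ v ∈ s.range, ∀ w ∈ s.range, v ≠ w → 2 * r ≤ dist v w := by
  refine (s.range.eventually_all).2 fun v _ => (s.range.eventually_all).2 fun w _ => ?_
  rcases eq_or_ne v w with h | h
  · exact Eventually.of_forall fun _ h' => absurd h h'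
  · filter_upwards [Ioo_mem_nhdsGT (show (0 : ℝ) < dist v w / 2 by
      have := dist_pos.2 h; positivity)] with r hr _
    linarith [hr.2]

/-- `‖X - Y‖ ≤ r` if `|X - Y| ≤ r` almost surely. -/
lemma norm_sub_le_of_ae {X Y : L2 d P} {r : ℝ} (hr : 0 ≤ r) (h : ∀ᵐ ω ∂P, ‖X ω - Y ω‖ ≤ r) :
    ‖X - Y‖ ≤ r := by
  refine abs_le_of_sq_le_sq' ?_ hr |>.2
  rw [norm_sq_eq_integral]
  have : ∫ _ : Ω, r ^ 2 ∂P = r ^ 2 := by simp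
  rw [← this]
  refine integral_mono_ae (integrable_norm_sq_coe _) (integrable_const _) ?_
  filter_upwards [h, Lp.coeFn_sub X Y] with ω h1 h2
  rw [h2, Pi.sub_apply]
  gcongr

end Blur

section Local

variable {Ω : Type*} [MeasurableSpace Ω] {P : Measure Ω} [IsProbabilityMeasure P] {d : ℕ}
  {W : E d → P2 d → E d} {DxW : E d → P2 d → E d →L[ℝ] E d}
  {DmW : Fin d → E d → P2 d → E d → E d} {DymW DxmW : Fin d → E d → P2 d → E d → E d →L[ℝ] E d}
  {DmmW : Fin d → Fin d → E d → P2 d → E d → E d → E d}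
  {β : ℝ} {H : E d → E d → ℝ} {F : E d → P1 d → ℝ}

lemma defect_self (x : E d) (m : P2 d) :
    defect β H F W DxW DmW DymW DxmW DmmW x x m = 0 := by
  simp [defect]

lemma defect_swap (x y : E d) (m : P2 d) :
    defect β H F W DxW DmW DymW DxmW DmmW y x m
      = -defect β H F W DxW DmW DymW DxmW DmmW x y m := by
  have h := intervalIntegral.integral_comp_sub_left (a := 0) (b := 1) (fun t : ℝ =>
    ⟪flux β H W DmW DymW DxmW DmmW ((1 - t) • y + t • x) m, y - x⟫_ℝ) 1
  simp only [sub_self, sub_zero, sub_sub_cancel] at h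
  unfold defect
  rw [← h, neg_add, ← intervalIntegral.integral_neg]
  congr 1
  · refine intervalIntegral.integral_congr fun t _ => ?_
    rw [← inner_neg_right, neg_sub, add_comm (t • y)]
  · ring

/-- The defect is nonnegative at `(x, y)` if `x` is a value of a simple random variable. The
inequality is tested with a blurred version `X` of the variable, and with the `Y` that is equal to
`y` where the variable is equal to `x`, and to `X` elsewhere. -/
lemma IsWeakSolution.defect_nonneg_of_simple (hW : IsWeakSolution P β H F W) (hP : Atomless P)
    (hH : ContDiff ℝ 1 fun q : E d × E d => H q.1 q.2)
    (hF : Continuous fun q : E d × P1 d => F q.1 q.2)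
    (hD : HasContinuousDerivatives P W DxW DmW DymW DxmW DmmW)
    (s : SimpleFunc Ω (E d)) {X : L2 d P} (hXs : X =ᵐ[P] s) (x y : E d)
    (hx : 0 < P (s ⁻¹' {x})) :
    0 ≤ defect β H F W DxW DmW DymW DxmW DmmW x y (law X) := by
  obtain ⟨Cw, hCw⟩ := hW.bounded
  obtain ⟨R₀, hR₀⟩ : ∃ R₀, ∀ ω, ‖s ω‖ ≤ R₀ := by
    obtain ⟨C, hC⟩ := s.exists_forall_norm_le
    exact ⟨C, hC⟩
  set R := R₀ + 1 + ‖y‖ with hR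
  have hgr := hasGrowthOn_bounded hH hCw (P := P) R
  have hXR : ∀ᵐ ω ∂P, ‖X ω‖ ≤ R := by
    filter_upwards [hXs] with ω hω
    rw [hω]; linarith [hR₀ ω, norm_nonneg y]
  by_contra! hneg
  set D := defect β H F W DxW DmW DymW DxmW DmmW with hDdef
  have hcont : Continuous fun p : (E d × E d) × {X : L2 d P | ∀ᵐ ω ∂P, ‖X ω‖ ≤ R} =>
      D p.1.1 p.1.2 (law p.2.1) := hD.continuous_defect hH hF hgr
  -- the defect is bounded away from `0` close to `(x, y, X)`
  obtain ⟨δ, hδ, hball⟩ : ∃ δ > 0, ∀ x' (X' : L2 d P), (∀ᵐ ω ∂P, ‖X' ω‖ ≤ R) → dist x' x < δ →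
      dist X' X < δ → D x' y (law X') ≤ D x y (law X) / 2 := by
    have hev := (hcont.tendsto ((x, y), ⟨X, hXR⟩)).eventually
      (gt_mem_nhds (show D x y (law X) < D x y (law X) / 2 by linarith))
    obtain ⟨δ, hδ, hb⟩ := Metric.eventually_nhds_iff.1 hev
    refine ⟨δ, hδ, fun x' X' hX' h1 h2 => (hb (y := ((x', y), ⟨X', hX'⟩)) ?_).le⟩
    rw [Prod.dist_eq, Prod.dist_eq, dist_self]
    exact max_lt (max_lt h1 hδ) h2
  obtain ⟨r, hsep, hr0, hr⟩ : ∃ r, (∀ v ∈ s.range, ∀ w ∈ s.range, v ≠ w → 2 * r ≤ dist v w) ∧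
      0 < r ∧ r < min 1 δ :=
    ((eventually_separated_range s).and (Ioo_mem_nhdsGT (lt_min one_pos hδ))).exists
  rw [lt_min_iff] at hr
  obtain ⟨Z, hZm, hZs, M, v, hM, hle, hres⟩ := hP.exists_blur s hr0 hsep
  have hZR : ∀ᵐ ω ∂P, ‖Z ω‖ ≤ R := by
    filter_upwards [hZs] with ω hω
    have : ‖Z ω‖ ≤ ‖Z ω - s ω‖ + ‖s ω‖ := by simpa using norm_add_le (Z ω - s ω) (s ω)
    rw [← dist_eq_norm] at this
    linarith [hR₀ ω, norm_nonneg y]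
  have hZL : MemLp Z 2 P := .of_bound hZm.aestronglyMeasurable R hZR
  set X' : L2 d P := hZL.toLp with hX'
  have hX'Z : X' =ᵐ[P] Z := hZL.coeFn_toLp
  have hX'R : ∀ᵐ ω ∂P, ‖X' ω‖ ≤ R := by
    filter_upwards [hX'Z, hZR] with ω h1 h2
    rwa [h1]
  have hlaw : (law X').meas = P.map Z := by rw [law_meas, Measure.map_congr hX'Z]
  obtain ⟨g, Cg, hCg, hg⟩ := exists_densSup_lower_bound hM (hlaw ▸ hle) hr0 (hlaw ▸ hres)
  have hac : X' ∈ Linfac d P := by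
    obtain ⟨h1, h2⟩ := densSup_le (m := law X') (hlaw ▸ hle)
    exact ⟨h1, h2.trans_lt hM.lt_top⟩
  set A := s ⁻¹' {x} with hA
  have hAm : MeasurableSet A := s.measurableSet_fiber x
  classical
  have hYm : Measurable (A.piecewise (fun _ => y) Z) := measurable_const.piecewise hAm hZm
  have hYR : ∀ᵐ ω ∂P, ‖A.piecewise (fun _ => y) Z ω‖ ≤ R := by
    filter_upwards [hZR] with ω h1
    by_cases h : ω ∈ A
    · rw [piecewise_eq_of_mem _ _ _ h]
      linarith [(norm_nonneg _).trans (hR₀ ω)]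
    · rwa [piecewise_eq_of_notMem _ _ _ h]
  have hYL : MemLp (A.piecewise (fun _ => y) Z) 2 P := .of_bound hYm.aestronglyMeasurable R hYR
  set Y' : L2 d P := hYL.toLp with hY'
  have hY : ∀ᵐ ω ∂P, ‖Y' ω‖ ≤ R := by
    filter_upwards [hYL.coeFn_toLp, hYR] with ω h1 h2
    rwa [h1]
  obtain ⟨hint, hnn⟩ := hW.integral_defect_nonneg hH hF hD hX'R hY hac hCg hg
  have hdist : dist X' X < δ := by
    rw [dist_eq_norm]
    refine (norm_sub_le_of_ae hr0.le ?_).trans_lt hr.2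
    filter_upwards [hX'Z, hXs, hZs] with ω h1 h2 h3
    rw [h1, h2, ← dist_eq_norm]
    exact h3.le
  have hupper : ∀ᵐ ω ∂P, D (X' ω) (Y' ω) (law X')
      ≤ A.indicator (fun _ => D x y (law X) / 2) ω := by
    filter_upwards [hX'Z, hYL.coeFn_toLp, hZs] with ω h1 h2 h3
    rw [h1, h2]
    by_cases h : ω ∈ A
    · rw [piecewise_eq_of_mem _ _ _ h, indicator_of_mem h]
      have hsx : s ω = x := h
      rw [hsx] at h3
      exact hball _ _ hX'R (h3.trans hr.2) hdist
    · rw [piecewise_eq_of_notMem _ _ _ h, indicator_of_notMem h]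
      exact (defect_self _ _).le
  have hfin := integral_mono_ae hint ((integrable_const (D x y (law X) / 2)).indicator hAm) hupper
  rw [integral_indicator_const _ hAm, smul_eq_mul] at hfin
  have hPA : 0 < P.real A := ENNReal.toReal_pos hx.ne' (measure_ne_top _ _)
  have : P.real A * (D x y (law X) / 2) < 0 := mul_neg_of_pos_of_neg hPA (by linarith)
  linarith

end Local

/-! ### The defect vanishes -/

section Approximation

variable {Ω : Type*} [MeasurableSpace Ω] {P : Measure Ω} [IsProbabilityMeasure P] {d : ℕ}
  {W : E d → P2 d → E d} {DxW : E d → P2 d → E d →L[ℝ] E d}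
  {DmW : Fin d → E d → P2 d → E d → E d} {DymW DxmW : Fin d → E d → P2 d → E d → E d →L[ℝ] E d}
  {DmmW : Fin d → Fin d → E d → P2 d → E d → E d → E d}
  {β : ℝ} {H : E d → E d → ℝ} {F : E d → P1 d → ℝ}

/-- Random variables are limits in `L²` of simple ones that take a given value with positive
probability. -/
lemma Atomless.exists_simple_approx (hP : Atomless P) (X : L2 d P) (x : E d) :
    ∃ (s : ℕ → SimpleFunc Ω (E d)) (Xn : ℕ → L2 d P), (∀ n, Xn n =ᵐ[P] s n) ∧
      (∀ n, 0 < P (s n ⁻¹' {x})) ∧ (∀ n ω, ‖s n ω‖ ≤ ‖x‖ + 2 * ‖X ω‖) ∧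
      Tendsto Xn atTop (𝓝 X) := by
  classical
  have hXm := measurable_coe X
  choose A _ hAm hA0 hAle using fun n : ℕ =>
    hP.exists_small (A := univ) MeasurableSet.univ (by simp) (c := (1 / 2) ^ n) (by positivity)
  set a : ℕ → SimpleFunc Ω (E d) := SimpleFunc.approxOn X hXm univ 0 (mem_univ 0) with ha
  set s : ℕ → SimpleFunc Ω (E d) := fun n =>
    SimpleFunc.piecewise (A n) (hAm n) (SimpleFunc.const Ω x) (a n) with hs
  have hsA : ∀ n, ∀ ω ∈ A n, s n ω = x := fun n ω hω => by
    simp [hs, SimpleFunc.coe_piecewise, hω]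
  have hsA' : ∀ n, ∀ ω ∉ A n, s n ω = a n ω := fun n ω hω => by
    simp [hs, SimpleFunc.coe_piecewise, hω]
  have hbound : ∀ n ω, ‖s n ω‖ ≤ ‖x‖ + 2 * ‖X ω‖ := by
    intro n ω
    by_cases h : ω ∈ A n
    · rw [hsA n ω h]; linarith [norm_nonneg (X ω)]
    · rw [hsA' n ω h]
      have := SimpleFunc.norm_approxOn_zero_le hXm (mem_univ 0) ω n
      linarith [norm_nonneg x]
  have hL : ∀ n, MemLp (s n) 2 P := fun n => (s n).memLp_of_isFiniteMeasure 2 P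
  refine ⟨s, fun n => (hL n).toLp, fun n => (hL n).coeFn_toLp, fun n => ?_, hbound, ?_⟩
  · exact (hA0 n).trans_le (measure_mono fun ω hω => hsA n ω hω)
  · -- almost surely, only finitely many of the sets `A n` matter
    have hsum : ∑' n, P (A n) ≠ ⊤ := by
      have hle : ∀ n, P (A n) ≤ (ENNReal.ofReal (1 / 2)) ^ n := fun n => by
        rw [← ENNReal.ofReal_pow (by positivity), ← ofReal_measureReal]
        exact ENNReal.ofReal_le_ofReal (hAle n)
      refine ne_top_of_le_ne_top ?_ (ENNReal.tsum_le_tsum hle)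
      rw [ENNReal.tsum_geometric]
      simp
    have hlim : ∀ᵐ ω ∂P, Tendsto (fun n => s n ω) atTop (𝓝 (X ω)) := by
      filter_upwards [ae_eventually_notMem hsum] with ω hω
      have := SimpleFunc.tendsto_approxOn hXm (mem_univ (0 : E d)) (x := ω) (by simp)
      refine this.congr' ?_
      filter_upwards [hω] with n hn using (hsA' n ω hn).symm
    rw [tendsto_iff_norm_sub_tendsto_zero]
    have hsq : Tendsto (fun n => ‖(hL n).toLp - X‖ ^ 2) atTop (𝓝 0) := by
      have hG : Integrable (fun ω => 2 * ‖x‖ ^ 2 + 18 * ‖X ω‖ ^ 2) P :=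
        (integrable_const _).add ((integrable_norm_sq_coe X).const_mul 18)
      have h0 : ∫ _ : Ω, (0 : ℝ) ∂P = 0 := by simp
      rw [← h0]
      simp only [norm_sq_eq_integral]
      refine tendsto_integral_of_dominated_convergence _
        (fun n => (integrable_norm_sq_coe _).aestronglyMeasurable) hG (fun n => ?_) ?_
      · filter_upwards [Lp.coeFn_sub (hL n).toLp X, (hL n).coeFn_toLp] with ω h1 h2
        rw [h1, Pi.sub_apply, h2, Real.norm_of_nonneg (by positivity)]
        have h3 : ‖s n ω - X ω‖ ≤ ‖x‖ + 3 * ‖X ω‖ :=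
          (norm_sub_le _ _).trans (by linarith [hbound n ω])
        nlinarith [norm_nonneg (s n ω - X ω), sq_nonneg (‖x‖ - 3 * ‖X ω‖)]
      · have hcoe : ∀ᵐ ω ∂P, ∀ n, ((hL n).toLp - X : L2 d P) ω = s n ω - X ω := by
          refine ae_all_iff.2 fun n => ?_
          filter_upwards [Lp.coeFn_sub (hL n).toLp X, (hL n).coeFn_toLp] with ω h1 h2
          rw [h1, Pi.sub_apply, h2]
        filter_upwards [hcoe, hlim] with ω h1 h2
        simp only [h1]
        have := ((h2.sub_const (X ω)).norm).pow 2
        simpa using this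
    have := hsq.sqrt
    simpa using this

/-- The integrated master equation: the defect vanishes. -/
lemma IsWeakSolution.defect_eq_zero (hW : IsWeakSolution P β H F W) (hP : Atomless P)
    (hH : ContDiff ℝ 1 fun q : E d × E d => H q.1 q.2)
    (hF : Continuous fun q : E d × P1 d => F q.1 q.2)
    (hD : HasContinuousDerivatives P W DxW DmW DymW DxmW DmmW)
    {X : L2 d P} (hX : LinearGrowth H ∨ ∃ R, ∀ᵐ ω ∂P, ‖X ω‖ ≤ R) (x y : E d) :
    defect β H F W DxW DmW DymW DxmW DmmW x y (law X) = 0 := by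
  obtain ⟨Cw, hCw⟩ := hW.bounded
  have key : ∀ x y, 0 ≤ defect β H F W DxW DmW DymW DxmW DmmW x y (law X) := by
    intro x y
    obtain ⟨s, Xn, hXn, hx, hb, hlim⟩ := hP.exists_simple_approx X x
    obtain ⟨S, hS, hXS, hXnS⟩ : ∃ S : Set (L2 d P), HasGrowthOn H W S ∧ X ∈ S ∧ ∀ n, Xn n ∈ S := by
      rcases hX with hL | ⟨R, hR⟩
      · exact ⟨univ, hL.hasGrowthOn_univ hCw, mem_univ _, fun _ => mem_univ _⟩
      · refine ⟨_, hasGrowthOn_bounded hH hCw (‖x‖ + 2 * R), ?_, fun n => ?_⟩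
        · filter_upwards [hR] with ω hω
          linarith [norm_nonneg x, norm_nonneg (X ω)]
        · filter_upwards [hR, hXn n] with ω hω h
          rw [h]
          linarith [hb n ω]
    have hcont := hD.continuous_defect (β := β) hH hF hS
    have hn := fun n => hW.defect_nonneg_of_simple hP hH hF hD (s n) (hXn n) x y (hx n)
    generalize defect β H F W DxW DmW DymW DxmW DmmW = D at hcont hn ⊢
    have hlim' : Tendsto (fun n => (((x, y), ⟨Xn n, hXnS n⟩) : (E d × E d) × S)) atTop
        (𝓝 ((x, y), ⟨X, hXS⟩)) :=
      tendsto_const_nhds.prodMk_nhds (tendsto_subtype_rng.2 hlim)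
    exact ge_of_tendsto ((hcont.tendsto _).comp hlim') (Eventually.of_forall hn)
  refine le_antisymm ?_ (key x y)
  have := key y x
  rw [defect_swap] at this
  linarith

end Approximation

/-! ### From the integrated to the pointwise equation -/

section Conclusion

variable {Ω : Type*} [MeasurableSpace Ω] {P : Measure Ω} [IsProbabilityMeasure P] {d : ℕ}
  {W : E d → P2 d → E d} {DxW : E d → P2 d → E d →L[ℝ] E d}
  {DmW : Fin d → E d → P2 d → E d → E d} {DymW DxmW : Fin d → E d → P2 d → E d → E d →L[ℝ] E d}
  {DmmW : Fin d → Fin d → E d → P2 d → E d → E d → E d}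
  {β : ℝ} {H : E d → E d → ℝ} {F : E d → P1 d → ℝ}

/-- If the increments of `V` along segments are the line integrals of a continuous field, then the
directional derivatives of `V` are given by the field. -/
lemma hasLineDerivAt_of_segment {Φ : E d → E d} (hΦ : Continuous Φ) {V : E d → ℝ}
    (h : ∀ x y, (∫ t in (0 : ℝ)..1, ⟪Φ ((1 - t) • x + t • y), x - y⟫_ℝ) + (V x - V y) = 0)
    (x v : E d) : HasLineDerivAt ℝ V (-⟪Φ x, v⟫_ℝ) x v := by
  set g : ℝ → ℝ := fun s => ∫ t in (0 : ℝ)..1, ⟪Φ ((1 - t) • (x + s • v) + t • x), v⟫_ℝ with hg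
  have hgc : Continuous g := by
    refine intervalIntegral.continuous_parametric_intervalIntegral_of_continuous'
      (f := fun (s t : ℝ) => ⟪Φ ((1 - t) • (x + s • v) + t • x), v⟫_ℝ) ?_ 0 1
    refine Continuous.inner (hΦ.comp ?_) continuous_const
    fun_prop
  have hg0 : g 0 = ⟪Φ x, v⟫_ℝ := by
    have : ∀ t : ℝ, (1 - t) • (x + (0 : ℝ) • v) + t • x = x := fun t => by module
    simp only [hg, this]
    simp
  have hV : ∀ s : ℝ, V (x + s • v) = V x - s * g s := by
    intro s
    have := h (x + s • v) x
    simp only [add_sub_cancel_left, real_inner_smul_right, intervalIntegral.integral_const_mul]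
      at this
    linarith
  rw [HasLineDerivAt, hasDerivAt_iff_tendsto_slope]
  have hlim : Tendsto (fun s => -g s) (𝓝[≠] 0) (𝓝 (-⟪Φ x, v⟫_ℝ)) := by
    rw [← hg0]
    exact (hgc.neg.tendsto 0).mono_left nhdsWithin_le_nhds
  refine hlim.congr' ?_
  filter_upwards [self_mem_nhdsWithin] with s hs
  have hs' : s ≠ 0 := hs
  rw [slope_def_field, hV, hV]
  field_simp
  ring

/-- The derivative of `x ↦ H(W(x, m), x)`, for irrotational `W(·, m)`. -/
lemma HasContinuousDerivatives.hasLineDerivAt_H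
    (hD : HasContinuousDerivatives P W DxW DmW DymW DxmW DmmW)
    (hH : ContDiff ℝ 1 fun q : E d × E d => H q.1 q.2) {m : P2 d}
    (hirr : Irrotational fun x => W x m) (i : Fin d) (x : E d) :
    HasLineDerivAt ℝ (fun z => H (W z m) z)
      ((DxW x m (DpH H (W x m) x)) i + DxH H (W x m) x i) x (e i) := by
  have h1 : HasFDerivAt (fun z => (W z m, z)) ((DxW x m).prod (.id ℝ (E d))) x :=
    (hD.deriv_x x m).prodMk (hasFDerivAt_id x)
  have h2 := (HasFDerivAt.comp (f := fun z => (W z m, z)) x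
    (hH.differentiable one_ne_zero (W x m, x)).hasFDerivAt h1).hasLineDerivAt (e i)
  have h3 : (fderiv ℝ (fun q : E d × E d => H q.1 q.2) (W x m, x)).comp
      ((DxW x m).prod (.id ℝ (E d))) (e i)
      = (DxW x m (DpH H (W x m) x)) i + DxH H (W x m) x i := by
    rw [ContinuousLinearMap.comp_apply, ContinuousLinearMap.prod_apply,
      ContinuousLinearMap.id_apply, fderiv_hamiltonian hH, inner_e, real_inner_comm,
      hirr.inner_symm (fun z => hD.deriv_x z m) (hD.continuous_DxW m), inner_e]
  rw [h3] at h2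
  exact h2

/-- The integrals in the master equation converge. -/
lemma HasContinuousDerivatives.integrable_terms
    (hD : HasContinuousDerivatives P W DxW DmW DymW DxmW DmmW)
    (hH : ContDiff ℝ 1 fun q : E d × E d => H q.1 q.2) {S : Set (L2 d P)}
    (hS : HasGrowthOn H W S) {X : L2 d P} (hX : X ∈ S) (i : Fin d) (x : E d) :
    Integrable (fun y => ⟪DmW i x (law X) y, DpH H (W y (law X)) y⟫_ℝ) (law X).meas ∧
      Integrable (fun y => tr (DymW i x (law X) y)) (law X).meas ∧
      Integrable (fun y => tr (DxmW i x (law X) y)) (law X).meas ∧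
      Integrable (fun q : E d × E d => ∑ j, DmmW i j x (law X) q.1 q.2 j)
        ((law X).meas.prod (law X).meas) := by
  obtain ⟨h1, h2, h3⟩ := hD.integrable_second i x X
  refine ⟨?_, ?_, ?_, ?_⟩
  · obtain ⟨A, hA, hgr⟩ := hS
    obtain ⟨C, hC, δ, hδ, hb⟩ := hD.norm_DmW_le X ‖x‖
    have hc := (hD.continuous_DmW i x (law X)).inner (𝕜 := ℝ) (continuous_DpH_W hD hH (law X))
    rw [law_meas, integrable_map_measure hc.aestronglyMeasurable (aemeasurable_coe X)]
    set B := ‖DmW i x (law X) 0‖ + C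
    have hG : Integrable (fun ω => 2 * (A * B) * (1 + ‖X ω‖ ^ 2)) P :=
      ((integrable_const _).add (integrable_norm_sq_coe X)).const_mul _
    refine hG.mono' (hc.comp_aestronglyMeasurable (Lp.aestronglyMeasurable X)) ?_
    filter_upwards [hgr X hX] with ω hω
    have hB : ‖DmW i x (law X) (X ω)‖ ≤ B * (1 + ‖X ω‖) := by
      have := hb i X (by simpa using hδ) x le_rfl (X ω)
      have h0 := mul_nonneg (norm_nonneg (DmW i x (law X) 0)) (norm_nonneg (X ω))
      have : B * (1 + ‖X ω‖) = ‖DmW i x (law X) 0‖ + C * ‖X ω‖ + C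
        + ‖DmW i x (law X) 0‖ * ‖X ω‖ := by ring
      linarith
    have hB0 : 0 ≤ B := by positivity
    refine (norm_inner_le_norm _ _).trans ((mul_le_mul hB hω (norm_nonneg _)
      (by positivity)).trans ?_)
    nlinarith [mul_nonneg (mul_nonneg hA hB0) (sq_nonneg (1 - ‖X ω‖))]
  · exact (trL.integrable_comp h1).congr (ae_of_all _ fun y => trL_apply _)
  · exact (trL.integrable_comp h2).congr (ae_of_all _ fun y => trL_apply _)
  · exact (trL.integrable_comp h3).congr (ae_of_all _ fun q => by
      simp only [trL_apply, tr_DmmOp])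

/-- The divergence of `W` has the line derivatives that the master equation requires. -/
lemma IsWeakSolution.hasLineDerivAt_div (hW : IsWeakSolution P β H F W)
    (hH : ContDiff ℝ 1 fun q : E d × E d => H q.1 q.2)
    (hF' : ∀ m : P1 d, ContDiff ℝ 1 fun x => F x m)
    (hD : HasContinuousDerivatives P W DxW DmW DymW DxmW DmmW) {m : P2 d}
    (hΦ : Continuous fun x => flux β H W DmW DymW DxmW DmmW x m)
    (h0 : ∀ x y, defect β H F W DxW DmW DymW DxmW DmmW x y m = 0) (i : Fin d) (x : E d) :
    HasLineDerivAt ℝ (fun z => β * tr (DxW z m))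
      (flux β H W DmW DymW DxmW DmmW x m i + (DxW x m (DpH H (W x m) x)) i + DxH H (W x m) x i
        - gradient (fun z => F z m.toP1) x i) x (e i) := by
  have hV := hasLineDerivAt_of_segment hΦ (V := fun z => scalarPart β H F W DxW z m) h0 x (e i)
  have hHl := hD.hasLineDerivAt_H hH (hW.irrotational m) i x
  have hFl : HasLineDerivAt ℝ (fun z => F z m.toP1) (gradient (fun z => F z m.toP1) x i) x (e i) := by
    have := (((hF' m.toP1).differentiable one_ne_zero x).hasGradientAt.hasFDerivAt).hasLineDerivAt
      (e i)
    rwa [InnerProductSpace.toDual_apply_apply, inner_e] at this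
  rw [inner_e] at hV
  have := (HasDerivAt.sub (HasDerivAt.sub hHl hFl) hV)
  refine HasDerivAt.congr_deriv (HasDerivAt.congr_of_eventuallyEq this
    (Eventually.of_forall fun t => ?_)) (by ring)
  simp only [scalarPart, Pi.sub_apply]
  ring

lemma IsWeakSolution.solvesAt (hW : IsWeakSolution P β H F W) (hP : Atomless P)
    (hH : ContDiff ℝ 1 fun q : E d × E d => H q.1 q.2)
    (hF : Continuous fun q : E d × P1 d => F q.1 q.2)
    (hF' : ∀ m : P1 d, ContDiff ℝ 1 fun x => F x m)
    (hD : HasContinuousDerivatives P W DxW DmW DymW DxmW DmmW)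
    {X : L2 d P} (hX : LinearGrowth H ∨ ∃ R, ∀ᵐ ω ∂P, ‖X ω‖ ≤ R) :
    SolvesAt β H F W DxW DmW DymW DxmW DmmW (law X) := by
  obtain ⟨Cw, hCw⟩ := hW.bounded
  obtain ⟨S, hS, hXS⟩ : ∃ S : Set (L2 d P), HasGrowthOn H W S ∧ X ∈ S := by
    rcases hX with hL | ⟨R, hR⟩
    · exact ⟨univ, hL.hasGrowthOn_univ hCw, mem_univ _⟩
    · exact ⟨_, hasGrowthOn_bounded hH hCw R, hR⟩
  have hΦ : Continuous fun x => flux β H W DmW DymW DxmW DmmW x (law X) := by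
    have := (hD.continuous_flux (β := β) hH hS).comp
      (by fun_prop : Continuous fun x : E d => (x, (⟨X, hXS⟩ : S)))
    simpa only [Function.comp_def] using this
  have hdiv := fun i => hW.hasLineDerivAt_div hH hF' hD hΦ
    (fun x y => hW.defect_eq_zero hP hH hF hD hX x y) i
  have hxi : ∀ (f : E d → E d) (i : Fin d), Continuous f → Continuous fun x => f x i :=
    fun f i hf => (EuclideanSpace.proj (𝕜 := ℝ) i).continuous.comp hf
  intro i
  set G : E d → ℝ := fun x => flux β H W DmW DymW DxmW DmmW x (law X) i
    + (DxW x (law X) (DpH H (W x (law X)) x)) i + DxH H (W x (law X)) x i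
    - gradient (fun z => F z (law X).toP1) x i with hG
  have hGc : Continuous G := by
    have g1 := hxi _ i hΦ
    have g2 := hxi _ i ((hD.continuous_DxW (law X)).clm_apply (continuous_DpH_W hD hH (law X)))
    have g3 := hxi _ i ((continuous_DxH hH).comp ((hD.continuous_W (law X)).prodMk continuous_id))
    have g4 := hxi (gradient fun z => F z (law X).toP1) i
      ((InnerProductSpace.toDual ℝ (E d)).symm.continuous.comp
        ((hF' (law X).toP1).continuous_fderiv one_ne_zero))
    exact ((g1.add g2).add g3).sub g4
  -- any number `L` such that `β L = G` satisfies the equation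
  have heq : ∀ x L, β * L = G x →
      EquationAt β H F W DxW DmW DymW DxmW DmmW i x (law X) L := by
    intro x L hL
    rw [EquationAt, ← hD.tr_secondOp i x X]
    simp only [hG, flux, transport] at hL
    linarith
  have hβ0 : β = 0 → ∀ x, G x = 0 := by
    intro hβ x
    have h1 := hdiv i x
    simp only [hβ, zero_mul] at h1
    simp only [hG, hβ]
    exact HasDerivAt.unique h1 (hasDerivAt_const _ _)
  have hLap : β ≠ 0 → IsWeakLaplacian (fun x => W x (law X) i) fun x => β⁻¹ * G x := by
    intro hβ
    refine (hW.irrotational (law X)).isWeakLaplacian (fun x => hD.deriv_x x (law X))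
      (hD.continuous_DxW (law X)) i (continuous_const.mul hGc) fun x => ?_
    have := HasDerivAt.const_mul β⁻¹ (hdiv i x)
    simp only [inv_mul_cancel_left₀ hβ] at this
    exact this
  refine ⟨hD.integrable_terms hH hS hXS i, ⟨fun x => β⁻¹ * G x, continuous_const.mul hGc, hLap,
    fun x => heq x _ ?_⟩, fun hC2 x => heq x _ ?_⟩
  · by_cases hβ : β = 0
    · rw [hβ0 hβ x, hβ, zero_mul]
    · rw [mul_inv_cancel_left₀ hβ]
  · by_cases hβ : β = 0
    · rw [hβ0 hβ x, hβ, zero_mul]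
    · rw [← congrFun ((hLap hβ).eq_laplacian (continuous_const.mul hGc) hC2) x,
        mul_inv_cancel_left₀ hβ]

end Conclusion

end MasterEq

theorem proposition3p5 {Ω : Type*} [MeasurableSpace Ω] (P : Measure Ω) [IsProbabilityMeasure P]
    (hP : Atomless P) {d : ℕ} (β : ℝ) (hβ : 0 ≤ β)
    (H : E d → E d → ℝ) (hH : ContDiff ℝ 1 fun q : E d × E d => H q.1 q.2)
    (F : E d → P1 d → ℝ) (hF : Continuous fun q : E d × P1 d => F q.1 q.2)
    (hF' : ∀ m : P1 d, ContDiff ℝ 1 fun x => F x m)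
    (W : E d → P2 d → E d) (hW : IsWeakSolution P β H F W)
    (DxW : E d → P2 d → E d →L[ℝ] E d)
    (DmW : Fin d → E d → P2 d → E d → E d)
    (DymW DxmW : Fin d → E d → P2 d → E d → E d →L[ℝ] E d)
    (DmmW : Fin d → Fin d → E d → P2 d → E d → E d → E d)
    (hD : HasContinuousDerivatives P W DxW DmW DymW DxmW DmmW) :
    (∀ m : P2 d, BoundedSupport m → SolvesAt β H F W DxW DmW DymW DxmW DmmW m) ∧
    (LinearGrowth H → ∀ m : P2 d, SolvesAt β H F W DxW DmW DymW DxmW DmmW m) := by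
  refine ⟨fun m ⟨R, hR⟩ => ?_, fun hL m => ?_⟩
  · obtain ⟨X, rfl⟩ := hP.exists_law_eq m
    refine hW.solvesAt hP hH hF hF' hD (Or.inr ⟨R, ?_⟩)
    have h1 : ∀ᵐ x ∂P.map X, x ∈ Metric.closedBall (0 : E d) R := by
      rw [ae_iff]; exact hR
    filter_upwards [ae_of_ae_map (aemeasurable_coe X) h1] with ω hω
    simpa using hω
  · obtain ⟨X, rfl⟩ := hP.exists_law_eq m
    exact hW.solvesAt hP hH hF hF' hD (Or.inl hL)
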